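/- Let $n\ge 1$, let $R=\{q_1<\dots<q_r\}\subseteq[n-1]$, and set $q_0:=0$, $q_{r+1}:=n$, $p_h:=q_h-q_{h-1}$. Let $\lambda=(\lambda_1\ge\dots\ge\lambda_n\ge 0)$ be a partition such that the set of the column lengths of its shape that are different from $n$ is $R$. **Tuples.** All tuples are $n$-tuples with entries in $[n]$. The intervals $(q_{h-1},q_h]$, $1\le h\le r+1$, are the *carrels*. A tuple $\upsilon$ is *upper* if $\upsilon_i\ge i$ for all $i$, a *flag* if it is weakly increasing, and *$R$-increasing* if it is strictly increasing on each carrel. Let $U$, $UF$, $UI_R$ be the sets of upper tuples, upper flags and $R$-increasing upper tuples. An *$R$-permutation* is an $R$-increasing tuple with distinct entries; $S_n^R$ is the set of these. An $R$-permutation $\pi$ is *$R$-312-containing* if there are $1\le h\le r-1$ and $a\le q_h<b\le q_{h+1}<c\le n$ with $\pi_b<\pi_c<\pi_a$, and *$R$-312-avoiding* otherwise; $S_n^{R\text{-}312}$ is the set of $R$-312-avoiding $R$-permutations and $C_n^R:=|S_n^{R\text{-}312}|$. For $\sigma\in S_3$, an $R$-permutation is *$R$-$\sigma$-avoiding* if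 no three of its entries from three different carrels, read from left to right, are in the relative order $\sigma$. A *gapless $R$-tuple* is a $\gamma\in UI_R$ such that whenever $1\le h\le r$ and $\gamma_{q_h}>\gamma_{q_h+1}$, the number $s:=\gamma_{q_h}-\gamma_{q_h+1}+1$ is at most $p_{h+1}$ and the first $s$ entries of the carrel $(q_h,q_{h+1}]$ are $\gamma_{q_h}-s+1,\dots,\gamma_{q_h}$. The *critical indices* of $\upsilon\in U$ in the $h$-th carrel are $x_1=q_h$ and, recursively, $x_u$ := the largest $x\in(q_{h-1},x_{u-1})$ with $\upsilon_{x_{u-1}}-\upsilon_x>x_{u-1}-x$, as long as one exists; the *critical pairs* are the $(x_u,\upsilon_{x_u})$, and the sequence of the $r+1$ sets of critical pairs is the *$R$-critical list* of $\upsilon$. In general, an *$R$-critical list* is a sequence, for $1\le h\le r+1$, of sets $\{(x_u,y_u):1\le u\le f_h\}$ with $f_h\ge 1$, $q_{h-1}<x_{f_h}<\dots<x_1=q_h$, $x_u\le y_u\le n$ and $y_{u-1}-y_u>x_{u-1}-x_u$. It is a *flag $R$-critical list* if for $1\le h\le r$ the entry paired with $q_h$ is at most the entry paired with the leftmost index in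 the $(h+1)$-st set. An *$R$-shell tuple* is a $\rho\in U$ with $\rho_i=n$ for all non-critical $i$; an *$R$-canopy tuple* is an $R$-shell tuple whose $R$-critical list is a flag list. An *$R$-floor flag* is a $\tau\in UF$ for which every maximal constant run of length at least $2$ starts at some $q_h$, $1\le h\le r$. An *$R$-ceiling flag* is a $\xi\in UF$ with $\xi_i=\xi_x$ whenever $x$ is the smallest critical index with $x\ge i$. The *$R$-core* $\Delta_R(\upsilon)$ of $\upsilon\in U$ has $i$-th entry $\upsilon_x-(x-i)$, where $x$ is the smallest critical index with $x\ge i$. Let $UGC_R$ be the set of the $\eta\in U$ whose $R$-core is a gapless $R$-tuple (*gapless core tuples*). For $\beta,\beta'\in U$ write $\beta\sim_R\beta'$ if the same elements of $UI_R$ are entrywise $\le\beta$ and $\le\beta'$. An *$R$-chain* is a chain $\emptyset=B_0\subset B_1\subset\dots\subset B_{r+1}=[n]$ with $|B_h|=q_h$. It is *$R$-rightmost clump deleting* if for $1\le h\le r$, with $B_{h+1}=L_1\cup\dots\cup L_f$ the decomposition into maximal sets of consecutive integers in increasing order, some $e\in[f]$ satisfies $L_e\cup\dots\cup L_f\supseteq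 B_{h+1}\setminus B_h\supseteq L_{e+1}\cup\dots\cup L_f$. **Tableaux.** Let $\mathcal T_\lambda$ be the set of semistandard tableaux of shape $\lambda$ with values in $[n]$ (strictly increasing down columns, weakly increasing along rows), ordered entrywise. $T_j(i)$ is the value in column $j$ and row $i$, $T_j$ is the $j$-th column, and $\zeta_j$ is its length. $T$ is a *$\lambda$-key* if the value set of $T_l$ contains that of $T_j$ for all $l\le j$. A $\lambda$-key is *gapless* if the following holds for $1\le h\le r-1$. Let $b$ be the smallest value in a column of length $q_{h+1}$ that is not in a column of length $q_h$, and $m$ the largest value in the columns of length $q_h$. If $b\le m$, then in every column of length $q_{h+1}$ the successive values from $b$ down to the box with value $m$ are $b,b+1,\dots,m$. For $\pi\in S_n^R$, the key $Y_\lambda(\pi)$ is the tableau whose $j$-th column has value set $\{\pi_1,\dots,\pi_{\zeta_j}\}$. The *scanning tableau* $S(T)$ has $j$-th column filled from bottom to top as follows: among columns $j,j+1,\dots$ of $T$, take the sequence of the bottom values of the non-exhausted columns, form its earliest weakly increasing subsequence (start with the first term; the next term is always the first later one that is at least the last one chosen), record its final value, remove the boxes used, and repeat until column $j$ is exhausted.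 Set $\mathcal D_\lambda(\pi):=\{T\in\mathcal T_\lambda:S(T)\le Y_\lambda(\pi)\}$ (Demazure tableaux) and, for $\beta\in U$, $\mathcal S_\lambda(\beta):=\{T\in\mathcal T_\lambda:T_j(i)\le\beta_i\text{ for all }i,j\}$. Write $\beta\approx_\lambda\beta'$ if $\mathcal S_\lambda(\beta)=\mathcal S_\lambda(\beta')$. A subset of $\mathbb Z^{|\lambda|}$ is *convex* if it is the set of integer solutions of a finite system of linear inequalities. Let $x^{\Theta(T)}$ be the product of $x_v$ over all values $v$ of $T$, and let $s_\lambda(\beta;x)$ and $d_\lambda(\pi;x)$ be the sums of $x^{\Theta(T)}$ over $\mathcal S_\lambda(\beta)$ and $\mathcal D_\lambda(\pi)$; $s_\lambda(\beta;x)$ is a *flag Schur polynomial* if $\beta\in UF$. For $\beta\in U$, the pair $(\lambda,\beta)$ is *nonpermutable* if for every permutation $w\ne\mathrm{id}$ of $[n]$ there are no pairwise vertex-disjoint lattice paths, with unit steps east and north, from $(n-i,i)$ to $(\lambda_{w(i)}+n-w(i),\beta_{w(i)})$, $i\in[n]$. The *cost* of $\beta$ is the total number of monomials in the entries $h_{\lambda_j-j+i}(x_i,\dots,x_{\beta_j})$,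 $i,j\in[n]$, of the Gessel–Viennot determinant, where $h_k$ is the complete homogeneous symmetric polynomial ($0$ for $k<0$). **Theorem.** Each of the following numbers is equal to $C_n^R$. (i) The number of ordered partitions $(P_1,\dots,P_{r+1})$ of $[n]$ with $|P_h|=p_h$ that avoid $312$ (no elements of three different blocks, in the order of the blocks, have the relative order $312$); and, for each $\sigma\in\{123,132,213,231,321\}$, the number of $R$-$\sigma$-avoiding $R$-permutations. (ii) The number of gapless $R$-tuples, of $R$-canopy tuples, of $R$-floor flags, and of $R$-ceiling flags. (iii) The number of flag $R$-critical lists; and the number of $r$-tuples $(\mu^{(1)},\dots,\mu^{(r)})$ of shapes with $\mu^{(h)}$ contained in a rectangle with $p_h$ rows and $n-q_h$ columns such that for $1\le h\le r-1$ the length of the first row of $\mu^{(h)}$ does not exceed the length of the $p_{h+1}$-st row of $\mu^{(h+1)}$ plus the number of times that this (possibly zero) length occurs among the $p_{h+1}$ rows of $\mu^{(h+1)}$. (iv) The number of equivalence classes of $\sim_R$ in $UGC_R$, of $\sim_R$ in $UF$, of $\approx_\lambda$ in $UGC_R$, and of $\approx_\lambda$ in $UF$. (v) The number of $R$-rightmost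 clump deleting chains, and of gapless $\lambda$-keys. (vi) The number of sets among the $\mathcal D_\lambda(\pi)$, $\pi\in S_n^R$, that are convex in $\mathbb Z^{|\lambda|}$. (vii) The number of distinct sets $\mathcal D_\lambda(\pi)$ with $\pi\in S_n^{R\text{-}312}$, of distinct sets $\mathcal S_\lambda(\eta)$ with $\eta\in UGC_R$, and of distinct sets $\mathcal S_\lambda(\varphi)$ with $\varphi\in UF$. (viii) The number of pairs of sets $(\mathcal S_\lambda(\beta),\mathcal D_\lambda(\pi))$, with $\beta\in U$ and $\pi\in S_n^R$, whose two components are equal. (ix) The number of distinct polynomials $d_\lambda(\pi;x)$ with $\pi\in S_n^{R\text{-}312}$, of distinct polynomials $s_\lambda(\eta;x)$ with $\eta\in UGC_R$, and of distinct polynomials $s_\lambda(\varphi;x)$ with $\varphi\in UF$. (x) The number of pairs of polynomials $(s_\lambda(\beta;x),d_\lambda(\pi;x))$, with $\beta\in U$ and $\pi\in S_n^R$, whose two components are equal. (xi) The number of $\beta\in U$ such that $(\lambda,\beta)$ is nonpermutable, $s_\lambda(\beta;x)$ is a flag Schur polynomial, and the cost of $\beta$ is strictly smaller than that of every other $\beta'\in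 U$ with $(\lambda,\beta')$ nonpermutable and $s_\lambda(\beta';x)=s_\lambda(\beta;x)$. -/

import Mathlib

/-
Conventions. All indices and values are 1-based. An `n`-tuple is a function `ν : ℕ → ℕ` whose entries
are `ν 1, …, ν n`; outside of `{1, …, n}` it is pinned to `0`. The subset `R = {q 1 < … < q r}` of
`{1, …, n - 1}` is handled through its increasing enumeration, prolonged by `q 0 = 0` and
`q (r + 1) = n`. The `h`-th carrel is `Set.Ioc (q (h - 1)) (q h)`, for `1 ≤ h ≤ r + 1`.
-/

namespace ParabolicCatalan

/-! ### Tuples, permutations, pattern avoidance -/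

/-- The tuples with entries `ν 1, …, ν n` in `{1, …, n}`. -/
def Tuples (n : ℕ) : Set (ℕ → ℕ) :=
  {ν | (∀ i, 1 ≤ i → i ≤ n → 1 ≤ ν i ∧ ν i ≤ n) ∧ ∀ i, ¬ (1 ≤ i ∧ i ≤ n) → ν i = 0}

/-- Upper tuples. -/
def Upper (n : ℕ) : Set (ℕ → ℕ) :=
  {ν | ν ∈ Tuples n ∧ ∀ i, 1 ≤ i → i ≤ n → i ≤ ν i}

/-- Upper flags. -/
def UpperFlags (n : ℕ) : Set (ℕ → ℕ) :=
  {ν | ν ∈ Upper n ∧ ∀ i j, 1 ≤ i → i ≤ j → j ≤ n → ν i ≤ ν j}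

/-- `ν` is strictly increasing on each carrel. -/
def IsRIncreasing (r : ℕ) (q : ℕ → ℕ) (ν : ℕ → ℕ) : Prop :=
  ∀ h, 1 ≤ h → h ≤ r + 1 → StrictMonoOn ν (Set.Ioc (q (h - 1)) (q h))

/-- The `R`-increasing upper tuples. -/
def UpperIncreasing (n r : ℕ) (q : ℕ → ℕ) : Set (ℕ → ℕ) :=
  {ν | ν ∈ Upper n ∧ IsRIncreasing r q ν}

/-- The `R`-permutations. -/
def RPerms (n r : ℕ) (q : ℕ → ℕ) : Set (ℕ → ℕ) :=
  {ν | ν ∈ Tuples n ∧ Set.InjOn ν (Set.Icc 1 n) ∧ IsRIncreasing r q ν}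

/-- `R`-312-containment. -/
def Contains312 (n r : ℕ) (q : ℕ → ℕ) (π : ℕ → ℕ) : Prop :=
  ∃ h, 1 ≤ h ∧ h + 1 ≤ r ∧ ∃ a b c, 1 ≤ a ∧ a ≤ q h ∧ q h < b ∧ b ≤ q (h + 1) ∧
    q (h + 1) < c ∧ c ≤ n ∧ π a > π b ∧ π b < π c ∧ π a > π c

/-- The `R`-312-avoiding `R`-permutations. -/
def Avoid312 (n r : ℕ) (q : ℕ → ℕ) : Set (ℕ → ℕ) :=
  {π | π ∈ RPerms n r q ∧ ¬ Contains312 n r q π}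

/-- The parabolic Catalan number. -/
noncomputable def parabolicCatalan (n r : ℕ) (q : ℕ → ℕ) : ℕ := (Avoid312 n r q).ncard

/-- The three-term sequence `b` is in the same relative order as the pattern `σ`. -/
def OrderIso3 (b σ : Fin 3 → ℕ) : Prop := ∀ s t, b s < b t ↔ σ s < σ t

/-- The `R`-`σ`-avoiding `R`-permutations: no three entries taken from three different carrels, from
left to right, form the pattern `σ`. -/
def AvoidPattern (n r : ℕ) (q : ℕ → ℕ) (σ : Fin 3 → ℕ) : Set (ℕ → ℕ) :=
  {π | π ∈ RPerms n r q ∧ ¬ ∃ h i : Fin 3 → ℕ, StrictMono h ∧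
    (∀ s, 1 ≤ h s ∧ h s ≤ r + 1 ∧ q (h s - 1) < i s ∧ i s ≤ q (h s)) ∧
    OrderIso3 (fun s => π (i s)) σ}

/-- The ordered partitions `(B 1, …, B (r + 1))` of `{1, …, n}` with block sizes
`q h - q (h - 1)`. -/
def OrderedPartitions (n r : ℕ) (q : ℕ → ℕ) : Set (ℕ → Finset ℕ) :=
  {B | (∀ h, 1 ≤ h → h ≤ r + 1 → (B h).card = q h - q (h - 1)) ∧
    (∀ h, ¬ (1 ≤ h ∧ h ≤ r + 1) → B h = ∅) ∧
    (∀ g h, g ≠ h → Disjoint (B g) (B h)) ∧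
    (Finset.Icc 1 (r + 1)).biUnion B = Finset.Icc 1 n}

/-- The ordered partitions that avoid the pattern `σ`: no three elements taken from three different
blocks, from left to right, form the pattern `σ`. -/
def OrderedPartitionsAvoid (n r : ℕ) (q : ℕ → ℕ) (σ : Fin 3 → ℕ) : Set (ℕ → Finset ℕ) :=
  {B | B ∈ OrderedPartitions n r q ∧ ¬ ∃ h b : Fin 3 → ℕ, StrictMono h ∧
    (∀ s, 1 ≤ h s ∧ h s ≤ r + 1 ∧ b s ∈ B (h s)) ∧ OrderIso3 b σ}

/-! ### Gapless tuples, critical lists, shells, canopies, floors, ceilings, cores -/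

/-- The gapless `R`-tuples. -/
def Gapless (n r : ℕ) (q : ℕ → ℕ) : Set (ℕ → ℕ) :=
  {γ | γ ∈ UpperIncreasing n r q ∧ ∀ h, 1 ≤ h → h ≤ r → γ (q h) > γ (q h + 1) →
    γ (q h) - γ (q h + 1) + 1 ≤ q (h + 1) - q h ∧
    ∀ t, t < γ (q h) - γ (q h + 1) + 1 → γ (q h + 1 + t) = γ (q h + 1) + t}

/-- The critical indices of `υ` in the `h`-th carrel, found recursively from the right: `q h` is
critical, and the next one to the left of `x` is the largest `y < x` in the carrel such that
`υ x - υ y > x - y`. -/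
inductive IsCriticalIn (q : ℕ → ℕ) (υ : ℕ → ℕ) (h : ℕ) : ℕ → Prop
  | last : IsCriticalIn q υ h (q h)
  | next {x y : ℕ} : IsCriticalIn q υ h x →
      IsGreatest {y | q (h - 1) < y ∧ y < x ∧ (υ x : ℤ) - υ y > (x : ℤ) - y} y →
      IsCriticalIn q υ h y

/-- `x` is a critical index of `υ` in some carrel. -/
def IsCritical (r : ℕ) (q : ℕ → ℕ) (υ : ℕ → ℕ) (x : ℕ) : Prop :=
  ∃ h, 1 ≤ h ∧ h ≤ r + 1 ∧ IsCriticalIn q υ h x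

/-- The `R`-critical list of `υ`: the `h`-th term is the set of critical pairs `(x, υ x)` in the
`h`-th carrel. -/
def critList (r : ℕ) (q : ℕ → ℕ) (υ : ℕ → ℕ) : ℕ → Set (ℕ × ℕ) :=
  fun h => {p | 1 ≤ h ∧ h ≤ r + 1 ∧ IsCriticalIn q υ h p.1 ∧ p.2 = υ p.1}

/-- `C` is a set of critical pairs `(x u, y u)`, `1 ≤ u ≤ f`, for the `h`-th carrel. -/
def IsCritSet (n : ℕ) (q : ℕ → ℕ) (h : ℕ) (C : Set (ℕ × ℕ)) : Prop :=
  ∃ (f : ℕ) (x y : ℕ → ℕ), 1 ≤ f ∧ x 1 = q h ∧ q (h - 1) < x f ∧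
    (∀ u, 1 ≤ u → u ≤ f → x u ≤ y u ∧ y u ≤ n) ∧
    (∀ u, 1 < u → u ≤ f →
      x u < x (u - 1) ∧ (y (u - 1) : ℤ) - y u > (x (u - 1) : ℤ) - x u) ∧
    C = {p | ∃ u, 1 ≤ u ∧ u ≤ f ∧ p = (x u, y u)}

/-- The `R`-critical lists. -/
def CritLists (n r : ℕ) (q : ℕ → ℕ) : Set (ℕ → Set (ℕ × ℕ)) :=
  {C | (∀ h, 1 ≤ h → h ≤ r + 1 → IsCritSet n q h (C h)) ∧
    ∀ h, ¬ (1 ≤ h ∧ h ≤ r + 1) → C h = ∅}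

/-- The flag condition: the critical entry at `q h` is at most the entry of the leftmost critical
pair of the next carrel. -/
def IsFlagList (r : ℕ) (q : ℕ → ℕ) (C : ℕ → Set (ℕ × ℕ)) : Prop :=
  ∀ h, 1 ≤ h → h ≤ r → ∀ y k z, (q h, y) ∈ C h → (k, z) ∈ C (h + 1) →
    (∀ p ∈ C (h + 1), k ≤ p.1) → y ≤ z

/-- The flag `R`-critical lists. -/
def FlagCritLists (n r : ℕ) (q : ℕ → ℕ) : Set (ℕ → Set (ℕ × ℕ)) :=
  {C | C ∈ CritLists n r q ∧ IsFlagList r q C}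

/-- The `R`-shell tuples. -/
def Shells (n r : ℕ) (q : ℕ → ℕ) : Set (ℕ → ℕ) :=
  {ρ | ρ ∈ Upper n ∧ ∀ i, 1 ≤ i → i ≤ n → ¬ IsCritical r q ρ i → ρ i = n}

/-- The `R`-canopy tuples. -/
def Canopies (n r : ℕ) (q : ℕ → ℕ) : Set (ℕ → ℕ) :=
  {κ | κ ∈ Shells n r q ∧ IsFlagList r q (critList r q κ)}

/-- `ν a, …, ν b` is a maximal constant nonempty subsequence of `ν 1, …, ν n`. -/
def IsPlateau (n : ℕ) (ν : ℕ → ℕ) (a b : ℕ) : Prop :=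
  1 ≤ a ∧ a ≤ b ∧ b ≤ n ∧ (∀ i, a ≤ i → i ≤ b → ν i = ν a) ∧
    (a = 1 ∨ ν (a - 1) ≠ ν a) ∧ (b = n ∨ ν (b + 1) ≠ ν b)

/-- The `R`-floor flags. -/
def Floors (n r : ℕ) (q : ℕ → ℕ) : Set (ℕ → ℕ) :=
  {τ | τ ∈ UpperFlags n ∧ ∀ a b, IsPlateau n τ a b → a < b → ∃ h, 1 ≤ h ∧ h ≤ r ∧ a = q h}

/-- The `R`-ceiling flags: upper flags that are constant on each interval of indices that runs from
just after a critical index (or from `1`) up to the next critical index. -/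
def Ceilings (n r : ℕ) (q : ℕ → ℕ) : Set (ℕ → ℕ) :=
  {ξ | ξ ∈ UpperFlags n ∧ ∀ i x, 1 ≤ i → i ≤ x → IsCritical r q ξ x →
    (∀ k, i ≤ k → k < x → ¬ IsCritical r q ξ k) → ξ i = ξ x}

/-- The `R`-core of `υ`: staircases descending to the left from the critical entries. -/
noncomputable def core (n r : ℕ) (q : ℕ → ℕ) (υ : ℕ → ℕ) : ℕ → ℕ := fun i =>
  if 1 ≤ i ∧ i ≤ n then
    υ (sInf {x | i ≤ x ∧ IsCritical r q υ x}) - (sInf {x | i ≤ x ∧ IsCritical r q υ x} - i)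
  else 0

/-- The gapless core `R`-tuples. -/
def GaplessCore (n r : ℕ) (q : ℕ → ℕ) : Set (ℕ → ℕ) :=
  {η | η ∈ Upper n ∧ core n r q η ∈ Gapless n r q}

/-- The set of `R`-increasing upper tuples that are entrywise at most `β`. -/
def below (n r : ℕ) (q : ℕ → ℕ) (β : ℕ → ℕ) : Set (ℕ → ℕ) :=
  {ε | ε ∈ UpperIncreasing n r q ∧ ∀ i, 1 ≤ i → i ≤ n → ε i ≤ β i}

/-- The collection of equivalence classes in the set `U` for the relation `f β = f β'`. -/
def classesOf {α : Type*} (U : Set (ℕ → ℕ)) (f : (ℕ → ℕ) → α) : Set (Set (ℕ → ℕ)) :=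
  {c | ∃ β ∈ U, c = {β' | β' ∈ U ∧ f β' = f β}}

/-- The sequences `(μ 1, …, μ r)` of shapes such that `μ h` fits into a rectangle with
`q h - q (h - 1)` rows and `n - q h` columns, and for `1 ≤ h ≤ r - 1` the length of the first row of
`μ h` is at most `ℓ` plus the multiplicity of `ℓ` among the rows of `μ (h + 1)`, where `ℓ` is the
(possibly zero) length of its last, `(q (h + 1) - q h)`-th, row. -/
def ShapeSequences (n r : ℕ) (q : ℕ → ℕ) : Set (ℕ → YoungDiagram) :=
  {μ | (∀ h, ¬ (1 ≤ h ∧ h ≤ r) → μ h = ⊥) ∧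
    (∀ h, 1 ≤ h → h ≤ r → ∀ c ∈ μ h, c.1 < q h - q (h - 1) ∧ c.2 < n - q h) ∧
    ∀ h, 1 ≤ h → h + 1 ≤ r →
      (μ h).rowLen 0 ≤ (μ (h + 1)).rowLen (q (h + 1) - q h - 1) +
        ((Finset.range (q (h + 1) - q h)).filter fun i =>
          (μ (h + 1)).rowLen i = (μ (h + 1)).rowLen (q (h + 1) - q h - 1)).card}

/-! ### Rightmost clump deleting chains -/

/-- The `R`-chains `∅ = B 0 ⊂ B 1 ⊂ … ⊂ B (r + 1) = {1, …, n}` with `|B h| = q h`. -/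
def RChains (n r : ℕ) (q : ℕ → ℕ) : Set (ℕ → Finset ℕ) :=
  {B | B 0 = ∅ ∧ B (r + 1) = Finset.Icc 1 n ∧ (∀ h, h ≤ r → B h ⊂ B (h + 1)) ∧
    (∀ h, 1 ≤ h → h ≤ r → (B h).card = q h) ∧ ∀ h, r + 1 < h → B h = ∅}

/-- `L` is a clump of `Q`: a maximal nonempty subset of consecutive integers. -/
def IsClump (Q L : Finset ℕ) : Prop :=
  Maximal (fun L : Finset ℕ => L ⊆ Q ∧ ∃ a b, a ≤ b ∧ L = Finset.Icc a b) L

/-- The clump `E` lies to the left of the clump `L`. -/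
def Before (E L : Finset ℕ) : Prop := ∀ x ∈ E, ∀ y ∈ L, x < y

/-- The `R`-rightmost clump deleting chains: for `1 ≤ h ≤ r` there is a clump `E` of `B (h + 1)` such
that `B (h + 1) \ B h` is contained in the union of `E` and the clumps to its right, and contains all
of the clumps to the right of `E`. -/
def ClumpDeletingChains (n r : ℕ) (q : ℕ → ℕ) : Set (ℕ → Finset ℕ) :=
  {B | B ∈ RChains n r q ∧ ∀ h, 1 ≤ h → h ≤ r → ∃ E, IsClump (B (h + 1)) E ∧
    (∀ x ∈ B (h + 1) \ B h, ∃ L, IsClump (B (h + 1)) L ∧ (L = E ∨ Before E L) ∧ x ∈ L) ∧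
    ∀ L, IsClump (B (h + 1)) L → Before E L → L ⊆ B (h + 1) \ B h}

/-! ### Shapes and tableaux

A partition with at most `n` parts is a `YoungDiagram` with at most `n` rows. -/

/-- The length of the `i`-th row. -/
def row (lam : YoungDiagram) (i : ℕ) : ℕ := lam.rowLen (i - 1)

/-- The length of the `j`-th column. -/
def col (lam : YoungDiagram) (j : ℕ) : ℕ := lam.colLen (j - 1)

/-- The set of the column lengths of `lam` other than the trivial length `n`. -/
def columnLengths (n : ℕ) (lam : YoungDiagram) : Set ℕ :=
  {c | c ≠ n ∧ ∃ j, 1 ≤ j ∧ j ≤ row lam 1 ∧ c = col lam j}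

/-- The value of `T` in the `j`-th column and `i`-th row. -/
def val {lam : YoungDiagram} (T : SemistandardYoungTableau lam) (j i : ℕ) : ℕ := T (i - 1) (j - 1)

/-- The semistandard tableaux of shape `lam` with values in `{1, …, n}`. -/
def Tableaux (n : ℕ) (lam : YoungDiagram) : Set (SemistandardYoungTableau lam) :=
  {T | ∀ c ∈ lam, 1 ≤ T c.1 c.2 ∧ T c.1 c.2 ≤ n}

/-- The set of values in the `j`-th column of `T`. -/
def colSet {lam : YoungDiagram} (T : SemistandardYoungTableau lam) (j : ℕ) : Set ℕ :=
  {v | ∃ i, 1 ≤ i ∧ i ≤ col lam j ∧ v = val T j i}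

/-- The `λ`-keys. -/
def Keys (n : ℕ) (lam : YoungDiagram) : Set (SemistandardYoungTableau lam) :=
  {T | T ∈ Tableaux n lam ∧ ∀ l j, 1 ≤ l → l ≤ j → j ≤ row lam 1 → colSet T j ⊆ colSet T l}

/-- The gapless `λ`-keys: for `1 ≤ h ≤ r - 1`, let `b` be the smallest value in a column of length
`q (h + 1)` that is not in a column of length `q h`, and `m` the largest value in the columns of
length `q h`. If `b ≤ m`, then in the columns of length `q (h + 1)` the values increase by exactly one
at each step from `b` to `m`. -/
def GaplessKeys (n r : ℕ) (q : ℕ → ℕ) (lam : YoungDiagram) :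
    Set (SemistandardYoungTableau lam) :=
  {T | T ∈ Keys n lam ∧ ∀ h, 1 ≤ h → h + 1 ≤ r →
    ∀ j l, 1 ≤ j → 1 ≤ l → col lam j = q (h + 1) → col lam l = q h →
    ∀ b m, IsLeast (colSet T j \ colSet T l) b → IsGreatest (colSet T l) m → b ≤ m →
    ∀ i k, 1 ≤ i → i ≤ col lam j → 1 ≤ k → k ≤ col lam j → val T j i = b → val T j k = m →
    ∀ t, i ≤ t → t ≤ k → val T j t = b + (t - i)}

/-- The value in the `j`-th column and `i`-th row of the `λ`-key of `π`: this is the `i`-th smallest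
element of `{π 1, …, π c}`, where `c` is the length of the `j`-th column. -/
noncomputable def keyVal (lam : YoungDiagram) (π : ℕ → ℕ) (j i : ℕ) : ℕ :=
  Nat.nth (fun v => ∃ k, 1 ≤ k ∧ k ≤ col lam j ∧ v = π k) (i - 1)

/-! ### Scanning tableaux and Demazure tableaux -/

/-- The last value selected so far when the earliest weakly increasing subsequence of
`x j, x (j + 1), …` has been formed up to the term `x (j + d)`. The subsequence starts with `x j`, and
the next selected term is always the first one that is at least the last selected value. -/
def ewisLast (x : ℕ → ℕ) (j : ℕ) : ℕ → ℕ
  | 0 => x j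
  | d + 1 => if ewisLast x j d ≤ x (j + d + 1) then x (j + d + 1) else ewisLast x j d

/-- The term `x l` is selected for the earliest weakly increasing subsequence of
`x j, x (j + 1), …`. -/
def EwisMem (x : ℕ → ℕ) (j l : ℕ) : Prop :=
  l = j ∨ (j < l ∧ ewisLast x j (l - 1 - j) ≤ x l)

instance (x : ℕ → ℕ) (j l : ℕ) : Decidable (EwisMem x j l) :=
  inferInstanceAs (Decidable (l = j ∨ (j < l ∧ ewisLast x j (l - 1 - j) ≤ x l)))

/-- The bottom unmarked value in the `l`-th column, when the unmarked boxes of each column are its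
`c l` topmost ones. It is `0`, which is never selected, if there are none. -/
def bottom {lam : YoungDiagram} (T : SemistandardYoungTableau lam) (c : ℕ → ℕ) (l : ℕ) : ℕ :=
  if c l = 0 then 0 else val T l (c l)

/-- The numbers of unmarked boxes in the columns `j, j + 1, …` of `T` after `k` scanning paths that
originate in the `j`-th column have been marked. -/
def scanHeights {lam : YoungDiagram} (T : SemistandardYoungTableau lam) (j : ℕ) : ℕ → ℕ → ℕ
  | 0 => fun l => if j ≤ l then col lam l else 0
  | k + 1 => fun l =>
      if EwisMem (bottom T (scanHeights T j k)) j l then scanHeights T j k l - 1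
      else scanHeights T j k l

/-- The value of the scanning tableau of `T` in the `j`-th column and `i`-th row. The `j`-th column is
filled from the bottom with the final values of the successive scanning paths that originate in the
`j`-th column of `T`. -/
def scanVal {lam : YoungDiagram} (T : SemistandardYoungTableau lam) (j i : ℕ) : ℕ :=
  ewisLast (bottom T (scanHeights T j (col lam j - i))) j (row lam 1 - j)

/-- The set of Demazure tableaux of shape `lam` for `π`. -/
def Demazure (n : ℕ) (lam : YoungDiagram) (π : ℕ → ℕ) : Set (SemistandardYoungTableau lam) :=
  {T | T ∈ Tableaux n lam ∧ ∀ j i, 1 ≤ j → 1 ≤ i → i ≤ col lam j →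
    scanVal T j i ≤ keyVal lam π j i}

/-- The row bound set of tableaux. The first condition on `β` comes from the latent column
`1, 2, …, n`, which stands to the left of the first column. -/
def RowBound (n : ℕ) (lam : YoungDiagram) (β : ℕ → ℕ) : Set (SemistandardYoungTableau lam) :=
  {T | T ∈ Tableaux n lam ∧ (∀ i, 1 ≤ i → i ≤ n → i ≤ β i) ∧
    ∀ j i, 1 ≤ j → 1 ≤ i → i ≤ col lam j → val T j i ≤ β i}

/-- `D` is the solution set in the integer lattice of a finite system of linear inequalities. -/
def IsConvexPolytope {ι : Type*} [Fintype ι] (D : Set (ι → ℤ)) : Prop :=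
  ∃ (m : ℕ) (A : Fin m → ι → ℝ) (b : Fin m → ℝ),
    D = {x | ∀ k, ∑ i, A k i * (x i : ℝ) ≤ b k}

/-- A tableau as a point of the lattice with one coordinate for each box of the shape. -/
def toPoint {lam : YoungDiagram} (T : SemistandardYoungTableau lam) : lam.cells → ℤ :=
  fun c => (T c.1.1 c.1.2 : ℤ)

/-! ### Polynomials -/

/-- The number of values of `T` that are equal to `k`. -/
def content {lam : YoungDiagram} (T : SemistandardYoungTableau lam) (k : ℕ) : ℕ :=
  (lam.cells.filter fun c => T c.1 c.2 = k).card

/-- The monomial `x_1 ^ θ_1 ⋯ x_n ^ θ_n` of a tableau with content `θ`. -/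
noncomputable def monomialOf (n : ℕ) {lam : YoungDiagram} (T : SemistandardYoungTableau lam) :
    MvPolynomial ℕ ℤ :=
  ∏ k ∈ Finset.Icc 1 n, MvPolynomial.X k ^ content T k

/-- The sum of the monomials of the tableaux in a (finite) set. -/
noncomputable def genFun (n : ℕ) {lam : YoungDiagram} (D : Set (SemistandardYoungTableau lam)) :
    MvPolynomial ℕ ℤ :=
  ∑ᶠ T ∈ D, monomialOf n T

/-- The row bound sum `s_λ(β; x)`; it is the flag Schur polynomial if `β` is an upper flag and the
gapless core Schur polynomial if `β` is a gapless core tuple. -/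
noncomputable def rowBoundSum (n : ℕ) (lam : YoungDiagram) (β : ℕ → ℕ) : MvPolynomial ℕ ℤ :=
  genFun n (RowBound n lam β)

/-- The Demazure polynomial `d_λ(π; x)`. -/
noncomputable def demazurePoly (n : ℕ) (lam : YoungDiagram) (π : ℕ → ℕ) : MvPolynomial ℕ ℤ :=
  genFun n (Demazure n lam π)

/-! ### Gessel-Viennot determinants -/

/-- `L` is the list of lattice points visited by a path from `P` to `Q` with unit steps to the east
and to the north. -/
def IsLatticePath (P Q : ℕ × ℕ) (L : List (ℕ × ℕ)) : Prop :=
  L.head? = some P ∧ L.getLast? = some Q ∧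
    L.IsChain fun u v => v = (u.1 + 1, u.2) ∨ v = (u.1, u.2 + 1)

/-- The source of the `i`-th path. -/
def source (n i : ℕ) : ℕ × ℕ := (n - i, i)

/-- The terminal of the `j`-th path. -/
def terminal (n : ℕ) (lam : YoungDiagram) (β : ℕ → ℕ) (j : ℕ) : ℕ × ℕ :=
  (row lam j + (n - j), β j)

/-- The pair `(lam, β)` is nonpermutable: pairwise disjoint lattice paths from the sources to a
permutation of the terminals exist for the identity permutation at most. -/
def Nonpermutable (n : ℕ) (lam : YoungDiagram) (β : ℕ → ℕ) : Prop :=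
  ∀ w : ℕ → ℕ, Set.BijOn w (Set.Icc 1 n) (Set.Icc 1 n) →
    (∃ L : ℕ → List (ℕ × ℕ),
      (∀ i, 1 ≤ i → i ≤ n → IsLatticePath (source n i) (terminal n lam β (w i)) (L i)) ∧
      ∀ i j, 1 ≤ i → i < j → j ≤ n → List.Disjoint (L i) (L j)) →
    ∀ i, 1 ≤ i → i ≤ n → w i = i

/-- The complete homogeneous symmetric polynomial of degree `k` in the variables `x_a, …, x_b`. -/
noncomputable def completeHom (k a b : ℕ) : MvPolynomial ℕ ℤ :=
  MvPolynomial.rename Subtype.val (MvPolynomial.hsymm (Finset.Icc a b) ℤ k)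

/-- The `(i, j)` entry of the Gessel-Viennot determinant for `s_λ(β; x)`: the complete homogeneous
symmetric polynomial of degree `λ_j - j + i` in `x_i, …, x_{β_j}`, or zero if that degree is
negative. -/
noncomputable def gvEntry (lam : YoungDiagram) (β : ℕ → ℕ) (i j : ℕ) : MvPolynomial ℕ ℤ :=
  if j ≤ row lam j + i then completeHom (row lam j + i - j) i (β j) else 0

/-- The total number of monomials among the entries of the Gessel-Viennot determinant. -/
noncomputable def gvCost (n : ℕ) (lam : YoungDiagram) (β : ℕ → ℕ) : ℕ :=
  ∑ i ∈ Finset.Icc 1 n, ∑ j ∈ Finset.Icc 1 n, (gvEntry lam β i j).support.card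

/-- The valid inputs to Gessel-Viennot determinant expressions for flag Schur polynomials on the shape
`lam` that attain maximum efficiency: the determinant has fewer monomials among its entries than the
one for any other valid input that produces the same polynomial. -/
def EfficientInputs (n : ℕ) (lam : YoungDiagram) : Set (ℕ → ℕ) :=
  {β | β ∈ Upper n ∧ Nonpermutable n lam β ∧
    (∃ φ ∈ UpperFlags n, rowBoundSum n lam β = rowBoundSum n lam φ) ∧
    ∀ β' ∈ Upper n, Nonpermutable n lam β' → rowBoundSum n lam β' = rowBoundSum n lam β →
      β' ≠ β → gvCost n lam β < gvCost n lam β'}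

end ParabolicCatalan

open ParabolicCatalan

/-! Everything is counted by gapless tuples, and these correspond to 312-avoiding chains of sets.

On a carrel, all conditions on a bound `β` concern the sequence `β x - x`. Its strict minima from
the right are the critical indices. The core is the suffix minimum `colMax β m i`, the least `β x -
(x - i)` with `i ≤ x ≤ m`, where `m` is the end of the carrel of `i`. It is also the largest
possible `i`-th entry of a strict column of length `m` under `β`; so the core decides which
increasing tuples and which tableaux lie under `β`. It is gapless exactly under the condition
`IsFlagLike`, which all upper flags meet. Over a gapless `γ` there is one canopy (the largest bound
with core `γ`), one ceiling (the largest such flag) and one floor (the least). Flag critical lists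
encode canopies, and shape sequences record the differences `γ i - i`.

An `R`-permutation amounts to the chain of its sets `B h` of the first `q h` values. It avoids 312
iff no value missing from `B (h + 1)` lies between an element of `B (h + 1) \ B h` and a larger
element of `B h`. The map `colMaxChain` sends `γ` to the value sets of the maximal columns of
lengths `q h`. When the length grows, entries drop only along staircases of consecutive integers, so
these chains avoid; conversely an avoiding chain is recovered from the tuple whose `i`-th entry is
the `i`-th element of the set for the carrel of `i` (`colMaxChain_bijOn`). Clump deletion and
gapless keys rephrase the avoidance.

For the other patterns an ordered partition becomes the word of the block labels of `1, …, n`, which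
inverts patterns. As in the argument of Simion and Schmidt, each placement of the letters without a
smaller predecessor extends to exactly one 123-avoiding and exactly one 132-avoiding word. Reversal
and complementation give the rest.

For tableaux, `RowBound n lam β` has a largest element with columns `colMax`, so it determines and
is determined by the core. Scanning takes values from the same or higher rows, so under a flag the
scanning tableau obeys the same bounds; hence row bound sets with gapless core are Demazure sets of
avoiding permutations. Keys are fixed by scanning, so distinct permutations have distinct Demazure
sets. Row bound sets are convex. If `π` contains 312, two keys in its Demazure set differ by
exchanging a value `a` for `s`, and the lattice point between them with `s + 1` instead violates the
scanning condition. Thus convexity, avoidance and coincidence with a row bound set are equivalent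
(`isConvexPolytope_demazure_iff`). A key is the only tableau with its content, and this carries all
comparisons of sets over to polynomials.

Finally, the Gessel-Viennot cost is strictly monotone in the bound, and the core is the least bound
with a given tableau set. Gapless tuples are nonpermutable, because a reversed pair of disjoint
paths would make one of them run through the terminal of a third. So the efficient inputs are the
gapless tuples (`efficientInputs_eq`). -/

namespace ParabolicCatalan

/-! ### The increasing enumeration of a finite set -/

/-- The `i`-th smallest element of `B`, for `1 ≤ i ≤ B.card`. -/
noncomputable def srt (B : Finset ℕ) (i : ℕ) : ℕ := Nat.nth (· ∈ B) (i - 1)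

theorem finite_ofPred_mem (B : Finset ℕ) : (Set.ofPred (· ∈ B)).Finite := B.finite_toSet

theorem card_ofPred_mem (B : Finset ℕ) : (finite_ofPred_mem B).toFinset.card = B.card := by
  congr 1; ext x; simp [Set.ofPred]

theorem srt_mem {B : Finset ℕ} {i : ℕ} (h1 : 1 ≤ i) (h2 : i ≤ B.card) : srt B i ∈ B :=
  Nat.nth_mem_of_lt_card (p := (· ∈ B)) (finite_ofPred_mem B) (by rw [card_ofPred_mem]; omega)

theorem srt_lt {B : Finset ℕ} {i j : ℕ} (h1 : 1 ≤ i) (hij : i < j) (h2 : j ≤ B.card) :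
    srt B i < srt B j :=
  Nat.nth_lt_nth_of_lt_card (p := (· ∈ B)) (finite_ofPred_mem B) (by omega)
    (by rw [card_ofPred_mem]; omega)

theorem srt_le {B : Finset ℕ} {i j : ℕ} (h1 : 1 ≤ i) (hij : i ≤ j) (h2 : j ≤ B.card) :
    srt B i ≤ srt B j := by
  rcases hij.eq_or_lt with rfl | h
  · exact le_rfl
  · exact (srt_lt h1 h h2).le

theorem exists_srt_eq {B : Finset ℕ} {a : ℕ} (ha : a ∈ B) :
    ∃ i, 1 ≤ i ∧ i ≤ B.card ∧ srt B i = a := by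
  obtain ⟨k, hk, rfl⟩ := Nat.exists_lt_card_finite_nth_eq (p := (· ∈ B)) (finite_ofPred_mem B) ha
  rw [card_ofPred_mem] at hk
  exact ⟨k + 1, by omega, by omega, by simp [srt]⟩

theorem lt_of_srt_lt {B : Finset ℕ} {i j : ℕ} (h1 : 1 ≤ j) (h2 : i ≤ B.card)
    (h : srt B i < srt B j) : i < j := by
  by_contra hc
  exact absurd (srt_le h1 (not_lt.1 hc) h2) (not_le.2 h)

theorem srt_add_le {B : Finset ℕ} {i j : ℕ} (h1 : 1 ≤ i) (hij : i ≤ j) (h2 : j ≤ B.card) :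
    srt B i + (j - i) ≤ srt B j := by
  induction j, hij using Nat.le_induction with
  | base => simp
  | succ j hij ih =>
    have := ih (by omega)
    have := srt_lt (B := B) (i := j) (j := j + 1) (by omega) (by omega) h2
    omega

theorem card_image_of_strict {m : ℕ} {f : ℕ → ℕ}
    (hf : ∀ i j, 1 ≤ i → i < j → j ≤ m → f i < f j) : ((Finset.Icc 1 m).image f).card = m := by
  rw [Finset.card_image_of_injOn]
  · simp
  · intro a ha b hb hab
    simp only [Finset.coe_Icc, Set.mem_Icc] at ha hb
    rcases lt_trichotomy a b with h | h | h
    · have := hf a b ha.1 h hb.2; omega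
    · exact h
    · have := hf b a hb.1 h ha.2; omega

/-- A set of size `m` contained in `B` on values at most `v` forces `srt B m ≤ v`. -/
theorem srt_le_of_card {B A : Finset ℕ} {v k : ℕ} (hk : 1 ≤ k) (hA : A ⊆ B)
    (hv : ∀ a ∈ A, a ≤ v) (hc : k ≤ A.card) : srt B k ≤ v := by
  by_contra hlt
  rw [not_le] at hlt
  have hkB : k ≤ B.card := hc.trans (Finset.card_le_card hA)
  have : A ⊆ (Finset.Icc 1 (k - 1)).image (srt B) := by
    intro a ha
    obtain ⟨i, hi1, hi2, rfl⟩ := exists_srt_eq (hA ha)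
    have := lt_of_srt_lt hk hi2 ((hv _ ha).trans_lt hlt)
    exact Finset.mem_image_of_mem _ (Finset.mem_Icc.2 ⟨hi1, by omega⟩)
  have := (Finset.card_le_card this).trans Finset.card_image_le
  simp at this
  omega

/-- The `k` smallest elements of `A` have `k` distinct images in `B`, none above `srt A k`. -/
theorem srt_le_srt_of_inj {A B : Finset ℕ} (f : ℕ → ℕ) (hf : Set.InjOn f A)
    (hfB : ∀ a ∈ A, f a ∈ B ∧ f a ≤ a) {k : ℕ} (h1 : 1 ≤ k) (h2 : k ≤ A.card) :
    srt B k ≤ srt A k := by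
  have hsub : ∀ i ∈ Finset.Icc 1 k, srt A i ∈ A := fun i hi => by
    rw [Finset.mem_Icc] at hi; exact srt_mem hi.1 (hi.2.trans h2)
  refine srt_le_of_card (A := ((Finset.Icc 1 k).image (srt A)).image f) h1 ?_ ?_ ?_
  · intro x hx
    simp only [Finset.mem_image] at hx
    obtain ⟨_, ⟨i, hi, rfl⟩, rfl⟩ := hx
    exact (hfB _ (hsub i hi)).1
  · intro x hx
    simp only [Finset.mem_image] at hx
    obtain ⟨_, ⟨i, hi, rfl⟩, rfl⟩ := hx
    rw [Finset.mem_Icc] at hi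
    exact (hfB _ (srt_mem hi.1 (hi.2.trans h2))).2.trans (srt_le hi.1 hi.2 h2)
  · rw [Finset.card_image_of_injOn, card_image_of_strict]
    · intro i j hi hij hj
      exact srt_lt hi hij (hj.trans h2)
    · intro x hx y hy hxy
      simp only [Finset.coe_image, Set.mem_image] at hx hy
      obtain ⟨i, hi, rfl⟩ := hx
      obtain ⟨j, hj, rfl⟩ := hy
      exact hf (hsub i hi) (hsub j hj) hxy

theorem srt_le_srt_of_subset {A B : Finset ℕ} (h : A ⊆ B) {k : ℕ} (h1 : 1 ≤ k)
    (h2 : k ≤ A.card) : srt B k ≤ srt A k :=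
  srt_le_srt_of_inj id (Set.injOn_id _) (fun _ ha => ⟨h ha, le_rfl⟩) h1 h2

/-- By counting, `f` exhausts `B`; two increasing enumerations of the same set agree. -/
theorem eq_srt_of_strict {B : Finset ℕ} {f : ℕ → ℕ}
    (hf : ∀ i j, 1 ≤ i → i < j → j ≤ B.card → f i < f j)
    (hB : ∀ i, 1 ≤ i → i ≤ B.card → f i ∈ B) {i : ℕ} (h1 : 1 ≤ i) (h2 : i ≤ B.card) :
    f i = srt B i := by
  have himg : (Finset.Icc 1 B.card).image f = B := by
    apply Finset.eq_of_subset_of_card_le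
    · intro x hx
      simp only [Finset.mem_image, Finset.mem_Icc] at hx
      obtain ⟨i, hi, rfl⟩ := hx
      exact hB i hi.1 hi.2
    · rw [card_image_of_strict hf]
  induction i using Nat.strong_induction_on with
  | _ i ih =>
    obtain ⟨j, hj1, hj2, hj⟩ := exists_srt_eq (hB i h1 h2)
    rcases lt_trichotomy j i with h | h | h
    · have := ih j h hj1 hj2
      have := hf j i hj1 h h2
      omega
    · rw [← hj, h]
    · have hm : srt B i ∈ (Finset.Icc 1 B.card).image f := by rw [himg]; exact srt_mem h1 h2
      rw [Finset.mem_image] at hm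
      obtain ⟨k, hk, hk'⟩ := hm
      rw [Finset.mem_Icc] at hk
      rcases lt_trichotomy k i with h' | h' | h'
      · have e := ih k h' hk.1 hk.2
        have := srt_lt hk.1 h' h2
        omega
      · rw [← hk', h']
      · have := hf i k h1 h' hk.2
        have := srt_lt h1 h hj2
        omega

theorem srt_image_eq {m : ℕ} {f : ℕ → ℕ} (hf : ∀ i j, 1 ≤ i → i < j → j ≤ m → f i < f j)
    {i : ℕ} (h1 : 1 ≤ i) (h2 : i ≤ m) : srt ((Finset.Icc 1 m).image f) i = f i := by
  have hc := card_image_of_strict hf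
  refine (eq_srt_of_strict (B := (Finset.Icc 1 m).image f) ?_ ?_ h1 (by omega)).symm
  · intro i j hi hij hj
    exact hf i j hi hij (by omega)
  · intro i hi hi'
    exact Finset.mem_image_of_mem _ (Finset.mem_Icc.2 ⟨hi, by omega⟩)

theorem eq_of_srt_eq {A B : Finset ℕ} (hc : A.card = B.card)
    (h : ∀ i, 1 ≤ i → i ≤ A.card → srt A i = srt B i) : A = B := by
  apply Finset.eq_of_subset_of_card_le _ hc.ge
  intro a ha
  obtain ⟨i, h1, h2, rfl⟩ := exists_srt_eq ha
  rw [h i h1 h2]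
  exact srt_mem h1 (hc ▸ h2)

theorem srt_Icc_one {n i : ℕ} (h1 : 1 ≤ i) (h2 : i ≤ n) : srt (Finset.Icc 1 n) i = i := by
  have := srt_image_eq (m := n) (f := id) (fun i j _ h _ => h) h1 h2
  simpa using this

/-- If all the values from `srt B i` to `a ∈ B` lie in `B`, then they are enumerated consecutively. -/
theorem srt_eq_add_of_Icc_subset {B : Finset ℕ} {i a : ℕ} (h1 : 1 ≤ i) (h2 : i ≤ B.card)
    (hI : ∀ c, srt B i ≤ c → c ≤ a → c ∈ B) {t : ℕ} (ht : srt B i + t ≤ a) :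
    i + t ≤ B.card ∧ srt B (i + t) = srt B i + t := by
  induction t with
  | zero => exact ⟨h2, rfl⟩
  | succ t ih =>
    obtain ⟨ha, hb⟩ := ih (by omega)
    obtain ⟨j, hj1, hj2, hj⟩ := exists_srt_eq (hI (srt B i + (t + 1)) (by omega) ht)
    have hlt : i + t < j := lt_of_srt_lt hj1 ha (by omega)
    refine ⟨by omega, ?_⟩
    have h3 := srt_lt (B := B) (i := i + t) (j := i + t + 1) (by omega) (by omega) (by omega)
    have h4 := srt_le (B := B) (i := i + t + 1) (j := j) (by omega) (by omega) hj2
    rw [← add_assoc]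
    omega

/-! ### Carrels -/

/-- `q` enumerates `R`, prolonged by `q 0 = 0` and `q (r + 1) = n`. -/
structure CarrelEnum (n r : ℕ) (q : ℕ → ℕ) : Prop where
  zero : q 0 = 0
  top : q (r + 1) = n
  lt_succ : ∀ h, h ≤ r → q h < q (h + 1)

namespace CarrelEnum

variable {n r : ℕ} {q : ℕ → ℕ}

theorem mono (E : CarrelEnum n r q) {g h : ℕ} (hgh : g ≤ h) (hh : h ≤ r + 1) : q g ≤ q h := by
  induction h, hgh using Nat.le_induction with
  | base => exact le_rfl
  | succ h hgh ih => exact (ih (by omega)).trans (E.lt_succ h (by omega)).le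

theorem strict (E : CarrelEnum n r q) {g h : ℕ} (hgh : g < h) (hh : h ≤ r + 1) : q g < q h :=
  (E.lt_succ g (by omega)).trans_le (E.mono hgh hh)

theorem le_top (E : CarrelEnum n r q) {h : ℕ} (hh : h ≤ r + 1) : q h ≤ n :=
  (E.mono hh le_rfl).trans_eq E.top

theorem one_le (E : CarrelEnum n r q) {h : ℕ} (h1 : 1 ≤ h) (hh : h ≤ r + 1) : 1 ≤ q h := by
  have := E.strict (g := 0) h1 hh
  omega

theorem lt_top (E : CarrelEnum n r q) {h : ℕ} (hh : h ≤ r) : q h < n :=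
  (E.strict (by omega) le_rfl).trans_eq E.top

theorem pred_lt (E : CarrelEnum n r q) {h : ℕ} (h1 : 1 ≤ h) (hh : h ≤ r + 1) :
    q (h - 1) < q h := E.strict (by omega) hh

theorem lt_of_lt (E : CarrelEnum n r q) {g h : ℕ} (hg : g ≤ r + 1) (hlt : q g < q h) : g < h := by
  by_contra hc
  have := E.mono (not_lt.1 hc) hg
  omega

theorem exists_carrel (E : CarrelEnum n r q) {i : ℕ} (h1 : 1 ≤ i) (h2 : i ≤ n) :
    ∃ h, 1 ≤ h ∧ h ≤ r + 1 ∧ q (h - 1) < i ∧ i ≤ q h := by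
  have hex : ∃ h, i ≤ q h := ⟨r + 1, by rw [E.top]; exact h2⟩
  classical
  have hp : 1 ≤ Nat.find hex := by
    by_contra hc
    have h0 : Nat.find hex = 0 := by omega
    have := Nat.find_spec hex
    rw [h0, E.zero] at this
    omega
  exact ⟨Nat.find hex, hp, Nat.find_le (by rw [E.top]; exact h2),
    not_le.1 (Nat.find_min hex (by omega)), Nat.find_spec hex⟩

theorem carrel_le (E : CarrelEnum n r q) {g h i j : ℕ} (hg1 : 1 ≤ g)
    (hi : q (g - 1) < i) (hij : i ≤ j) (hj : j ≤ q h) (hg : g ≤ r + 1) : g ≤ h := by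
  by_contra hc
  have := E.mono (show h ≤ g - 1 by omega) (by omega)
  omega

theorem carrel_unique (E : CarrelEnum n r q) {g h i : ℕ} (hg1 : 1 ≤ g) (hg2 : g ≤ r + 1)
    (hh1 : 1 ≤ h) (hh2 : h ≤ r + 1) (hg : q (g - 1) < i ∧ i ≤ q g) (hh : q (h - 1) < i ∧ i ≤ q h) :
    g = h :=
  le_antisymm (E.carrel_le hg1 hg.1 le_rfl hh.2 hg2) (E.carrel_le hh1 hh.1 le_rfl hg.2 hh2)

end CarrelEnum

theorem bijOn_of_leftInverse {α β : Type*} {s : Set α} {t : Set β} (f : α → β) (g : β → α)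
    (hf : Set.MapsTo f s t) (hg : Set.MapsTo g t s) (hgf : ∀ x ∈ s, g (f x) = x)
    (hfg : ∀ y ∈ t, f (g y) = y) : Set.BijOn f s t :=
  ⟨hf, fun x hx y hy h => by rw [← hgf x hx, ← hgf y hy, h], fun y hy => ⟨g y, hg hy, hfg y hy⟩⟩

/-! ### Suffix minima -/

/-- The largest possible `i`-th value of a strictly increasing column of length `m` bounded by `β`. -/
noncomputable def colMax (β : ℕ → ℕ) (m i : ℕ) : ℕ :=
  sInf {v | ∃ x, i ≤ x ∧ x ≤ m ∧ v = β x - (x - i)}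

section colMax

variable {β : ℕ → ℕ} {m i : ℕ}

/-- The assumption `x ≤ β x` makes the truncated subtraction in `colMax` exact; it therefore
accompanies most estimates below. -/
theorem colMax_add_le (hu : ∀ x, 1 ≤ x → x ≤ m → x ≤ β x) (h1 : 1 ≤ i) {x : ℕ} (hx : i ≤ x)
    (hxm : x ≤ m) : colMax β m i + (x - i) ≤ β x := by
  have h : colMax β m i ≤ β x - (x - i) := Nat.sInf_le ⟨x, hx, hxm, rfl⟩
  have := hu x (by omega) hxm
  omega

theorem exists_colMax_add (hu : ∀ x, 1 ≤ x → x ≤ m → x ≤ β x) (h1 : 1 ≤ i) (hm : i ≤ m) :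
    ∃ x, i ≤ x ∧ x ≤ m ∧ colMax β m i + (x - i) = β x := by
  obtain ⟨x, hx, hxm, h⟩ : colMax β m i ∈ {v | ∃ x, i ≤ x ∧ x ≤ m ∧ v = β x - (x - i)} :=
    Nat.sInf_mem ⟨_, i, le_rfl, hm, rfl⟩
  have := hu x (by omega) hxm
  exact ⟨x, hx, hxm, by omega⟩

theorem le_colMax (hm : i ≤ m) {v : ℕ} (h : ∀ x, i ≤ x → x ≤ m → v + (x - i) ≤ β x) :
    v ≤ colMax β m i := by
  obtain ⟨x, hx, hxm, he⟩ : colMax β m i ∈ {v | ∃ x, i ≤ x ∧ x ≤ m ∧ v = β x - (x - i)} :=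
    Nat.sInf_mem ⟨_, i, le_rfl, hm, rfl⟩
  have := h x hx hxm
  omega

theorem colMax_le_self (hm : i ≤ m) : colMax β m i ≤ β i := by
  have h : colMax β m i ≤ β i - (i - i) := Nat.sInf_le ⟨i, le_rfl, hm, rfl⟩
  omega

theorem self_le_colMax (hu : ∀ x, 1 ≤ x → x ≤ m → x ≤ β x) (h1 : 1 ≤ i) (hm : i ≤ m) :
    i ≤ colMax β m i :=
  le_colMax hm fun x hx hxm => by have := hu x (by omega) hxm; omega

theorem colMax_add_le_colMax (hu : ∀ x, 1 ≤ x → x ≤ m → x ≤ β x) (h1 : 1 ≤ i) {j : ℕ}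
    (hij : i ≤ j) (hm : j ≤ m) : colMax β m i + (j - i) ≤ colMax β m j :=
  le_colMax hm fun x hx hxm => by
    have := colMax_add_le hu h1 (hij.trans hx) hxm
    omega

theorem colMax_lt (hu : ∀ x, 1 ≤ x → x ≤ m → x ≤ β x) (h1 : 1 ≤ i) {j : ℕ}
    (hij : i < j) (hm : j ≤ m) : colMax β m i < colMax β m j := by
  have := colMax_add_le_colMax hu h1 hij.le hm
  omega

theorem colMax_le_of_le (hm : i ≤ m) {m' : ℕ} (hmm : m ≤ m') : colMax β m' i ≤ colMax β m i := by
  obtain ⟨x, hx, hxm, he⟩ : colMax β m i ∈ {v | ∃ x, i ≤ x ∧ x ≤ m ∧ v = β x - (x - i)} :=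
    Nat.sInf_mem ⟨_, i, le_rfl, hm, rfl⟩
  rw [he]
  exact Nat.sInf_le ⟨x, hx, hxm.trans hmm, rfl⟩

/-- Enlarging the length of the column: either the old entry survives, or the entry is determined by
the first of the new entries. -/
theorem colMax_eq_or {m' : ℕ} (hu : ∀ x, 1 ≤ x → x ≤ m' → x ≤ β x) (h1 : 1 ≤ i) (hm : i ≤ m)
    (hmm : m < m') : colMax β m' i = colMax β m i ∨
      (colMax β m' i + (m + 1 - i) = colMax β m' (m + 1) ∧ colMax β m' i ≤ colMax β m i) := by
  obtain ⟨x, hx, hxm, he⟩ := exists_colMax_add hu h1 (hm.trans hmm.le)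
  have h3 := colMax_le_of_le (β := β) hm hmm.le
  -- Here `x` attains the minimum. In the old range it gives the old entry; in the new range it also
  -- determines entry `m + 1`, so a staircase joins `i` to `m + 1`.
  rcases le_or_gt x m with h | h
  · left
    have := colMax_add_le (m := m) (β := β) (fun y hy hy' => hu y hy (by omega)) h1 hx h
    omega
  · right
    have h1' := colMax_add_le hu (i := m + 1) (by omega) h hxm
    have h2' := colMax_add_le_colMax hu h1 (j := m + 1) (by omega) (by omega)
    omega

end colMax

/-! ### Critical indices and cores -/

/-- Applied to `y ↦ υ y - y` on the rest of a carrel, the last minimiser is the next critical index.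
-/
theorem exists_last_min (f : ℕ → ℤ) {a b : ℕ} (hab : a ≤ b) :
    ∃ X, a ≤ X ∧ X ≤ b ∧ (∀ y, a ≤ y → y ≤ b → f X ≤ f y) ∧ ∀ y, X < y → y ≤ b → f X < f y := by
  induction b, hab using Nat.le_induction with
  | base =>
    refine ⟨a, le_rfl, le_rfl, fun y h h' => ?_, fun y h h' => by omega⟩
    rw [le_antisymm h' h]
  | succ b hab ih =>
    obtain ⟨X, h1, h2, h3, h4⟩ := ih
    rcases le_or_gt (f (b + 1)) (f X) with h | h
    · refine ⟨b + 1, by omega, le_rfl, fun y hy hy' => ?_, fun y hy hy' => by omega⟩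
      rcases hy'.eq_or_lt with rfl | hlt
      · exact le_rfl
      · exact h.trans (h3 y hy (by omega))
    · refine ⟨X, h1, by omega, fun y hy hy' => ?_, fun y hy hy' => ?_⟩
      · rcases hy'.eq_or_lt with rfl | hlt
        · exact h.le
        · exact h3 y hy (by omega)
      · rcases hy'.eq_or_lt with rfl | hlt
        · exact h
        · exact h4 y hy (by omega)

section critical

variable {n r : ℕ} {q : ℕ → ℕ}

/-- The inequality in the recursion says that `υ y - y` is smaller than `υ x - x`; so the recursion
lists the strict minima of this difference, seen from the right. -/
theorem isCriticalIn_iff (E : CarrelEnum n r q) (υ : ℕ → ℕ) {h : ℕ} (h1 : 1 ≤ h)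
    (h2 : h ≤ r + 1) (x : ℕ) : IsCriticalIn q υ h x ↔ q (h - 1) < x ∧ x ≤ q h ∧
      ∀ y, x < y → y ≤ q h → (υ x : ℤ) - x < (υ y : ℤ) - y := by
  constructor
  · intro hx
    induction hx with
    | last => exact ⟨E.pred_lt h1 h2, le_rfl, fun y hy hy' => by omega⟩
    | @next x y hx hg ih =>
      obtain ⟨⟨ha, hb, hc⟩, hd⟩ := hg
      refine ⟨ha, by omega, fun z hz hz' => ?_⟩
      rcases lt_trichotomy z x with hzx | rfl | hzx
      · by_contra hcon
        have := hd (show z ∈ _ from ⟨by omega, hzx, by omega⟩)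
        omega
      · omega
      · have := ih.2.2 z hzx hz'
        omega
  · intro hx
    induction hk : q h - x using Nat.strong_induction_on generalizing x with
    | _ k ih =>
      obtain ⟨ha, hb, hc⟩ := hx
      rcases hb.eq_or_lt with rfl | hlt
      · exact .last
      -- The critical index just before `x` in the recursion is the last minimiser to its right.
      · obtain ⟨X, hX1, hX2, hX3, hX4⟩ := exists_last_min (fun y => (υ y : ℤ) - y)
          (show x + 1 ≤ q h by omega)
        refine .next (ih (q h - X) (by omega) X ⟨by omega, hX2, hX4⟩ rfl)
          ⟨⟨ha, by omega, ?_⟩, ?_⟩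
        · have := hc X (by omega) hX2
          omega
        · rintro z ⟨hz1, hz2, hz3⟩
          by_contra hcon
          have := hX3 z (by omega) (by omega)

          omega

theorem isCritical_iff (E : CarrelEnum n r q) (υ : ℕ → ℕ) {h x : ℕ} (h1 : 1 ≤ h)
    (h2 : h ≤ r + 1) (hx : q (h - 1) < x) (hx' : x ≤ q h) : IsCritical r q υ x ↔
      ∀ y, x < y → y ≤ q h → (υ x : ℤ) - x < (υ y : ℤ) - y := by
  constructor
  · rintro ⟨g, hg1, hg2, hg⟩
    rw [isCriticalIn_iff E υ hg1 hg2] at hg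
    obtain rfl := E.carrel_unique hg1 hg2 h1 h2 ⟨hg.1, hg.2.1⟩ ⟨hx, hx'⟩
    exact hg.2.2
  · intro hc
    exact ⟨h, h1, h2, (isCriticalIn_iff E υ h1 h2 x).2 ⟨hx, hx', hc⟩⟩

theorem isCriticalIn_iff_isCritical (E : CarrelEnum n r q) (υ : ℕ → ℕ) {h x : ℕ} (h1 : 1 ≤ h)
    (h2 : h ≤ r + 1) : IsCriticalIn q υ h x ↔ q (h - 1) < x ∧ x ≤ q h ∧ IsCritical r q υ x := by
  rw [isCriticalIn_iff E υ h1 h2]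
  constructor
  · rintro ⟨a, b, c⟩
    exact ⟨a, b, (isCritical_iff E υ h1 h2 a b).2 c⟩
  · rintro ⟨a, b, c⟩
    exact ⟨a, b, (isCritical_iff E υ h1 h2 a b).1 c⟩

theorem isCritical_end (υ : ℕ → ℕ) {h : ℕ} (h1 : 1 ≤ h)
    (h2 : h ≤ r + 1) : IsCritical r q υ (q h) := ⟨h, h1, h2, .last⟩

theorem isCritical_mem_range (E : CarrelEnum n r q) {υ : ℕ → ℕ} {x : ℕ}
    (hx : IsCritical r q υ x) : ∃ h, 1 ≤ h ∧ h ≤ r + 1 ∧ q (h - 1) < x ∧ x ≤ q h := by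
  obtain ⟨g, hg1, hg2, hg⟩ := hx
  rw [isCriticalIn_iff E υ hg1 hg2] at hg
  exact ⟨g, hg1, hg2, hg.1, hg.2.1⟩

theorem isCritical_le (E : CarrelEnum n r q) {υ : ℕ → ℕ} {x : ℕ}
    (hx : IsCritical r q υ x) : 1 ≤ x ∧ x ≤ n := by
  obtain ⟨h, h1, h2, h3, h4⟩ := isCritical_mem_range E hx
  have := E.le_top h2
  omega

theorem Upper.le {β : ℕ → ℕ} (hβ : β ∈ Upper n) {m : ℕ} (hm : m ≤ n) :
    ∀ x, 1 ≤ x → x ≤ m → x ≤ β x := fun x h1 h2 => hβ.2 x h1 (h2.trans hm)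

theorem Tuples.ext {β β' : ℕ → ℕ} (hβ : β ∈ Tuples n) (hβ' : β' ∈ Tuples n)
    (h : ∀ i, 1 ≤ i → i ≤ n → β i = β' i) : β = β' := by
  funext i
  by_cases hi : 1 ≤ i ∧ i ≤ n
  · exact h i hi.1 hi.2
  · rw [hβ.2 i hi, hβ'.2 i hi]

/-- The next critical index. -/
theorem exists_next_critical (E : CarrelEnum n r q) {β : ℕ → ℕ} (hβ : β ∈ Upper n) {h i : ℕ}
    (h1 : 1 ≤ h) (h2 : h ≤ r + 1) (hi : q (h - 1) < i) (hi' : i ≤ q h) :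
    ∃ X, i ≤ X ∧ X ≤ q h ∧ IsCritical r q β X ∧ (∀ k, i ≤ k → k < X → ¬ IsCritical r q β k) ∧
      colMax β (q h) i + (X - i) = β X := by
  obtain ⟨X, hX1, hX2, hX3, hX4⟩ := exists_last_min (fun y => (β y : ℤ) - y) hi'
  refine ⟨X, hX1, hX2, (isCritical_iff E β h1 h2 (by omega) hX2).2 hX4, fun k hk hk' hc => ?_, ?_⟩
  · have := (isCritical_iff E β h1 h2 (by omega) (by omega)).1 hc X hk' hX2
    have := hX3 k hk (by omega)

    omega
  · have hu := Upper.le hβ (E.le_top h2)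
    obtain ⟨x, hx, hxm, he⟩ := exists_colMax_add hu (by omega) hi'
    have h3 := colMax_add_le hu (by omega) hX1 hX2
    have := hX3 x hx hxm

    omega

/-- The minimum of `β x - (x - i)` on the rest of the carrel is attained at the next critical index,
through which the core is defined. -/
theorem core_eq_colMax (E : CarrelEnum n r q) {β : ℕ → ℕ} (hβ : β ∈ Upper n) {h i : ℕ}
    (h1 : 1 ≤ h) (h2 : h ≤ r + 1) (hi : q (h - 1) < i) (hi' : i ≤ q h) :
    core n r q β i = colMax β (q h) i := by
  obtain ⟨X, hX1, hX2, hX3, hX4, hX5⟩ := exists_next_critical E hβ h1 h2 hi hi'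
  have hs : sInf {x | i ≤ x ∧ IsCritical r q β x} = X := by
    refine le_antisymm (Nat.sInf_le ⟨hX1, hX3⟩) ?_
    have hm : sInf {x | i ≤ x ∧ IsCritical r q β x} ∈ {x | i ≤ x ∧ IsCritical r q β x} :=
      Nat.sInf_mem ⟨X, hX1, hX3⟩
    by_contra hc
    exact hX4 _ hm.1 (not_le.1 hc) hm.2
  have := E.le_top h2
  rw [core, if_pos ⟨by omega, by omega⟩, hs]
  omega

theorem core_le_self (E : CarrelEnum n r q) {β : ℕ → ℕ} (hβ : β ∈ Upper n) (i : ℕ) (h1 : 1 ≤ i)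
    (h2 : i ≤ n) : core n r q β i ≤ β i := by
  obtain ⟨h, ha, hb, hc, hd⟩ := E.exists_carrel h1 h2
  rw [core_eq_colMax E hβ ha hb hc hd]
  exact colMax_le_self hd

theorem core_mem_upperIncreasing (E : CarrelEnum n r q) {β : ℕ → ℕ} (hβ : β ∈ Upper n) :
    core n r q β ∈ UpperIncreasing n r q := by
  have key : ∀ i, 1 ≤ i → i ≤ n → i ≤ core n r q β i := fun i h1 h2 => by
    obtain ⟨h, ha, hb, hc, hd⟩ := E.exists_carrel h1 h2
    rw [core_eq_colMax E hβ ha hb hc hd]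
    exact self_le_colMax (Upper.le hβ (E.le_top hb)) h1 hd
  refine ⟨⟨⟨fun i h1 h2 => ⟨by have := key i h1 h2; omega, ?_⟩, fun i hi => ?_⟩, key⟩, ?_⟩
  · exact (core_le_self E hβ i h1 h2).trans (hβ.1.1 i h1 h2).2
  · rw [core, if_neg hi]
  · intro h h1 h2 i hi j hj hij
    rw [core_eq_colMax E hβ h1 h2 hi.1 hi.2, core_eq_colMax E hβ h1 h2 hj.1 hj.2]
    exact colMax_lt (Upper.le hβ (E.le_top h2)) (by have := hi.1; omega) hij hj.2

theorem rIncreasing_add_le {γ : ℕ → ℕ} (hγ : IsRIncreasing r q γ) {h i j : ℕ} (h1 : 1 ≤ h)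
    (h2 : h ≤ r + 1) (hi : q (h - 1) < i) (hij : i ≤ j) (hj : j ≤ q h) :
    γ i + (j - i) ≤ γ j := by
  induction j, hij using Nat.le_induction with
  | base => simp
  | succ j hij ih =>
    have := ih (by omega)
    have := hγ h h1 h2 (show j ∈ Set.Ioc _ _ from ⟨by omega, by omega⟩)
      (show j + 1 ∈ Set.Ioc _ _ from ⟨by omega, by omega⟩) (by omega)
    omega

theorem colMax_eq_self {γ : ℕ → ℕ} (hγ : IsRIncreasing r q γ) {h i : ℕ} (h1 : 1 ≤ h)
    (h2 : h ≤ r + 1) (hi : q (h - 1) < i) (hi' : i ≤ q h) : colMax γ (q h) i = γ i :=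
  le_antisymm (colMax_le_self hi') (le_colMax hi' fun _ hx hx' => rIncreasing_add_le hγ h1 h2 hi hx hx')

theorem core_eq_self (E : CarrelEnum n r q) {γ : ℕ → ℕ} (hγ : γ ∈ UpperIncreasing n r q) :
    core n r q γ = γ := by
  refine Tuples.ext (core_mem_upperIncreasing E hγ.1).1.1 hγ.1.1 fun i h1 h2 => ?_
  obtain ⟨h, ha, hb, hc, hd⟩ := E.exists_carrel h1 h2
  rw [core_eq_colMax E hγ.1 ha hb hc hd, colMax_eq_self hγ.2 ha hb hc hd]

/-- An increasing tuple is a staircase below each critical entry, hence fixed by its critical pairs.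
This criterion identifies the cores of the canopies, ceilings and floors constructed below. -/
theorem core_eq_iff (E : CarrelEnum n r q) {γ β : ℕ → ℕ} (hγ : γ ∈ UpperIncreasing n r q)
    (hβ : β ∈ Upper n) : core n r q β = γ ↔ (∀ i, 1 ≤ i → i ≤ n → γ i ≤ β i) ∧
      ∀ x, IsCritical r q γ x → β x = γ x := by
  constructor
  · rintro rfl
    refine ⟨core_le_self E hβ, fun x hx => ?_⟩
    obtain ⟨h, h1, h2, h3, h4⟩ := isCritical_mem_range E hx
    rw [isCritical_iff E _ h1 h2 h3 h4] at hx
    obtain ⟨X, hX1, hX2, hX3⟩ := exists_colMax_add (Upper.le hβ (E.le_top h2)) (by omega) h4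
    rw [← core_eq_colMax E hβ h1 h2 h3 h4] at hX3
    rcases hX1.eq_or_lt with rfl | hlt
    · omega
    · have := hx X hlt hX2
      have := core_le_self E hβ X (by omega) (hX2.trans (E.le_top h2))
      omega
  · rintro ⟨ha, hb⟩
    refine Tuples.ext (core_mem_upperIncreasing E hβ).1.1 hγ.1.1 fun i h1 h2 => ?_
    obtain ⟨h, h3, h4, h5, h6⟩ := E.exists_carrel h1 h2
    rw [core_eq_colMax E hβ h3 h4 h5 h6]
    apply le_antisymm
    · obtain ⟨X, hX1, hX2, hX3, -, hX5⟩ := exists_next_critical E hγ.1 h3 h4 h5 h6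
      rw [colMax_eq_self hγ.2 h3 h4 h5 h6] at hX5
      have := colMax_add_le (Upper.le hβ (E.le_top h4)) h1 hX1 hX2
      have := hb X hX3
      omega
    · refine le_colMax h6 fun x hx hx' => ?_
      have := rIncreasing_add_le hγ.2 h3 h4 h5 hx hx'
      have := ha x (by omega) (hx'.trans (E.le_top h4))
      omega

/-- The core lowers `β` only at noncritical indices, and only to the staircase of the next critical
entry, so the strict minima from the right stay where they are. -/
theorem isCritical_core_iff (E : CarrelEnum n r q) {β : ℕ → ℕ} (hβ : β ∈ Upper n) (x : ℕ) :
    IsCritical r q (core n r q β) x ↔ IsCritical r q β x := by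
  have hγ := core_mem_upperIncreasing E hβ
  constructor
  · intro hx
    obtain ⟨h, h1, h2, h3, h4⟩ := isCritical_mem_range E hx
    have he := ((core_eq_iff E hγ hβ).1 rfl).2 x hx
    rw [isCritical_iff E _ h1 h2 h3 h4] at hx ⊢
    intro y hy hy'
    have := hx y hy hy'
    have := core_le_self E hβ y (by omega) (hy'.trans (E.le_top h2))
    omega
  · intro hx
    obtain ⟨h, h1, h2, h3, h4⟩ := isCritical_mem_range E hx
    rw [isCritical_iff E _ h1 h2 h3 h4] at hx ⊢
    intro y hy hy'
    obtain ⟨X, hX1, hX2, hX3⟩ := exists_colMax_add (Upper.le hβ (E.le_top h2)) (by omega) hy'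
    rw [← core_eq_colMax E hβ h1 h2 (by omega) hy'] at hX3
    have := core_le_self E hβ x (by omega) (h4.trans (E.le_top h2))
    have := hx X (by omega) hX2
    omega

theorem core_apply_of_isCritical (E : CarrelEnum n r q) {β : ℕ → ℕ} (hβ : β ∈ Upper n) {x : ℕ}
    (hx : IsCritical r q β x) : core n r q β x = β x :=
  (((core_eq_iff E (core_mem_upperIncreasing E hβ) hβ).1 rfl).2 x
    ((isCritical_core_iff E hβ x).2 hx)).symm

theorem critList_core (E : CarrelEnum n r q) {β : ℕ → ℕ} (hβ : β ∈ Upper n) :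
    critList r q (core n r q β) = critList r q β := by
  funext h
  ext p
  simp only [critList, Set.mem_ofPred_eq]
  refine and_congr_right fun h1 => and_congr_right fun h2 => ?_
  rw [isCriticalIn_iff_isCritical E _ h1 h2, isCriticalIn_iff_isCritical E _ h1 h2,
    isCritical_core_iff E hβ]
  refine and_congr_right fun h3 => ?_
  rw [core_apply_of_isCritical E hβ h3.2.2]

/-- A minimum over several carrels is the least of the minima over each. So even the maximal columns
that span several carrels depend on the core alone. -/
theorem colMax_core (E : CarrelEnum n r q) {β : ℕ → ℕ} (hβ : β ∈ Upper n) {h i : ℕ}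
    (h2 : h ≤ r + 1) (hi : 1 ≤ i) (hi' : i ≤ q h) :
    colMax (core n r q β) (q h) i = colMax β (q h) i := by
  have hc := core_mem_upperIncreasing E hβ
  apply le_antisymm
  · refine le_colMax hi' fun x hx hx' => ?_
    have := colMax_add_le (Upper.le hc.1 (E.le_top h2)) hi hx hx'
    have := core_le_self E hβ x (by omega) (hx'.trans (E.le_top h2))
    omega
  · refine le_colMax hi' fun x hx hx' => ?_
    obtain ⟨g, hg1, hg2, hg3, hg4⟩ := E.exists_carrel (show 1 ≤ x by omega)
      (hx'.trans (E.le_top h2))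
    rw [core_eq_colMax E hβ hg1 hg2 hg3 hg4]
    have hgh := E.carrel_le hg1 hg3 le_rfl hx' hg2
    refine (colMax_add_le_colMax (Upper.le hβ (E.le_top h2)) hi hx hx').trans
      (colMax_le_of_le hg4 (E.mono hgh h2))

end critical

/-! ### Gapless cores -/

/-- The entry of `β` at the end of each carrel is at most the entry of `β` at an index of the next
carrel that determines the first entry of the core there. -/
def IsFlagLike (r : ℕ) (q : ℕ → ℕ) (β : ℕ → ℕ) : Prop :=
  ∀ h, 1 ≤ h → h ≤ r → ∃ x, q h < x ∧ x ≤ q (h + 1) ∧ β (q h) ≤ β x ∧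
    colMax β (q (h + 1)) (q h + 1) + (x - (q h + 1)) = β x

section gapless

variable {n r : ℕ} {q : ℕ → ℕ}

/-- A minimiser `x` of `β x - x` on a carrel lies weakly before every critical index `k`, and then
`β x ≤ β k`. Conversely the leftmost critical index is itself a minimiser. -/
theorem isFlagLike_iff (E : CarrelEnum n r q) {β : ℕ → ℕ} (hβ : β ∈ Upper n) :
    IsFlagLike r q β ↔ IsFlagList r q (critList r q β) := by
  constructor
  · rintro hF h h1 h2 y k z ⟨-, -, -, hy⟩ ⟨-, -, hk, hz⟩ -
    obtain ⟨x, hx1, hx2, hx3, hx4⟩ := hF h h1 h2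
    simp only at hy hk hz
    rw [isCriticalIn_iff E β (by omega) (by omega)] at hk
    have hk1 : q h < k := hk.1
    have hu := Upper.le hβ (E.le_top (show h + 1 ≤ r + 1 by omega))
    have h3 := colMax_add_le hu (i := q h + 1) (by omega) hk1 hk.2.1
    by_cases hxk : x ≤ k
    · omega
    · have := hk.2.2 x (by omega) hx2
      omega
  · intro hF h h1 h2
    have hlt := E.lt_succ h h2
    obtain ⟨X, hX1, hX2, hX3, hX4, hX5⟩ := exists_next_critical E hβ (h := h + 1) (i := q h + 1)
      (by omega) (by omega) (by simp) (by omega)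
    refine ⟨X, hX1, hX2, ?_, hX5⟩
    refine hF h h1 h2 (β (q h)) X (β X) ⟨h1, by omega, .last, rfl⟩
      ⟨by omega, by omega, ?_, rfl⟩ ?_
    · rw [isCriticalIn_iff_isCritical E β (by omega) (by omega)]
      exact ⟨hX1, hX2, hX3⟩
    · rintro ⟨k, y⟩ ⟨-, -, hk, -⟩
      rw [isCriticalIn_iff_isCritical E β (by omega) (by omega)] at hk
      by_contra hc
      exact hX4 k hk.1 (not_le.1 hc) hk.2.2

theorem isFlagLike_core_iff (E : CarrelEnum n r q) {β : ℕ → ℕ} (hβ : β ∈ Upper n) :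
    IsFlagLike r q (core n r q β) ↔ IsFlagLike r q β := by
  rw [isFlagLike_iff E hβ, isFlagLike_iff E (core_mem_upperIncreasing E hβ).1, critList_core E hβ]

/-- For an increasing tuple, `x` minimises iff the entries from `q h + 1` to `x` are consecutive
integers. The flag condition says that such a run climbs to at least `γ (q h)`. -/
theorem mem_gapless_iff (E : CarrelEnum n r q) {γ : ℕ → ℕ} (hγ : γ ∈ UpperIncreasing n r q) :
    γ ∈ Gapless n r q ↔ IsFlagLike r q γ := by
  have hcm : ∀ h, h ≤ r → colMax γ (q (h + 1)) (q h + 1) = γ (q h + 1) := fun h h2 =>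
    colMax_eq_self hγ.2 (h := h + 1) (by omega) (by omega) (by simp) (E.lt_succ h h2)
  constructor
  · rintro ⟨-, hG⟩ h h1 h2
    have hlt := E.lt_succ h h2
    rw [hcm h h2]
    rcases le_or_gt (γ (q h)) (γ (q h + 1)) with hle | hgt
    · exact ⟨q h + 1, by omega, hlt, hle, by omega⟩
    · obtain ⟨ha, hb⟩ := hG h h1 h2 hgt
      have := hb (γ (q h) - γ (q h + 1)) (by omega)
      exact ⟨q h + 1 + (γ (q h) - γ (q h + 1)), by omega, by omega, by omega, by omega⟩
  · intro hF
    refine ⟨hγ, fun h h1 h2 hgt => ?_⟩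
    obtain ⟨x, hx1, hx2, hx3, hx4⟩ := hF h h1 h2
    rw [hcm h h2] at hx4
    refine ⟨by omega, fun t ht => ?_⟩
    have h3 := rIncreasing_add_le hγ.2 (h := h + 1) (i := q h + 1) (j := q h + 1 + t) (by omega)
      (by omega) (by simp) (by omega) (by omega)
    have h4 := rIncreasing_add_le hγ.2 (h := h + 1) (i := q h + 1 + t) (j := x) (by omega)
      (by omega) (by simp; omega) (by omega) (by omega)
    omega

theorem core_mem_gapless_iff (E : CarrelEnum n r q) {β : ℕ → ℕ} (hβ : β ∈ Upper n) :
    core n r q β ∈ Gapless n r q ↔ IsFlagLike r q β := by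
  rw [mem_gapless_iff E (core_mem_upperIncreasing E hβ), isFlagLike_core_iff E hβ]

theorem gapless_flagLike (E : CarrelEnum n r q) {γ : ℕ → ℕ} (hγ : γ ∈ Gapless n r q) :
    IsFlagLike r q γ := (mem_gapless_iff E hγ.1).1 hγ

/-- Any minimiser will do, since every later entry of a flag is at least the one at `q h`. -/
theorem upperFlags_flagLike (E : CarrelEnum n r q) {φ : ℕ → ℕ} (hφ : φ ∈ UpperFlags n) :
    IsFlagLike r q φ := by
  intro h h1 h2
  obtain ⟨x, hx1, hx2, hx3⟩ := exists_colMax_add (i := q h + 1)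
    (Upper.le hφ.1 (E.le_top (show h + 1 ≤ r + 1 by omega))) (by omega) (E.lt_succ h h2)
  exact ⟨x, hx1, hx2, hφ.2 _ _ (E.one_le h1 (by omega)) (by omega)
    (hx2.trans (E.le_top (by omega))), hx3⟩

theorem core_upperFlag_mem_gapless (E : CarrelEnum n r q) {φ : ℕ → ℕ} (hφ : φ ∈ UpperFlags n) :
    core n r q φ ∈ Gapless n r q :=
  (core_mem_gapless_iff E hφ.1).2 (upperFlags_flagLike E hφ)

/-- The critical entries of a gapless tuple increase weakly. -/
theorem gapless_critical_mono (E : CarrelEnum n r q) {γ : ℕ → ℕ} (hγ : γ ∈ Gapless n r q)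
    {x y : ℕ} (hx : IsCritical r q γ x) (hy : IsCritical r q γ y) (hxy : x ≤ y) : γ x ≤ γ y := by
  have hF := gapless_flagLike E hγ
  have step : ∀ h, 1 ≤ h → h ≤ r → ∀ z, q h < z → z ≤ q (h + 1) → IsCritical r q γ z →
      γ (q h) ≤ γ z := by
    intro h h1 h2 z hz1 hz2 hz
    obtain ⟨x, hx1, hx2, hx3, hx4⟩ := hF h h1 h2
    rw [isCritical_iff E γ (h := h + 1) (by omega) (by omega) (by simpa using hz1) hz2] at hz
    have := colMax_add_le (Upper.le hγ.1.1 (E.le_top (show h + 1 ≤ r + 1 by omega)))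
      (i := q h + 1) (by omega) hz1 hz2
    by_cases hxz : x ≤ z
    · omega
    · have := hz x (by omega) hx2
      omega
  have ends : ∀ g h, 1 ≤ g → g ≤ h → h ≤ r + 1 → γ (q g) ≤ γ (q h) := by
    intro g h hg hgh
    induction h, hgh using Nat.le_induction with
    | base => exact fun _ => le_rfl
    | succ h hgh ih =>
      intro hh
      exact (ih (by omega)).trans (step h (by omega) (by omega) _ (E.lt_succ h (by omega)) le_rfl
        (isCritical_end _ (by omega) (by omega)))
  obtain ⟨g, hg1, hg2, hg3, hg4⟩ := isCritical_mem_range E hx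
  obtain ⟨h, hh1, hh2, hh3, hh4⟩ := isCritical_mem_range E hy
  have hgh : g ≤ h := E.carrel_le hg1 hg3 hxy hh4 hg2
  rcases hgh.eq_or_lt with rfl | hlt
  · exact (Nat.le_add_right _ _).trans (rIncreasing_add_le hγ.1.2 hg1 hg2 hg3 hxy hh4)
  · obtain ⟨k, rfl⟩ : ∃ k, h = k + 1 := ⟨h - 1, by omega⟩
    have h1 : γ x ≤ γ (q g) :=
      (Nat.le_add_right _ _).trans (rIncreasing_add_le hγ.1.2 hg1 hg2 hg3 hg4 le_rfl)
    exact (h1.trans (ends g k hg1 (by omega) (by omega))).trans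
      (step k (by omega) (by omega) y hh3 hh4 hy)

/-- The next critical entry of a gapless tuple. -/
theorem gapless_exists_next (E : CarrelEnum n r q) {γ : ℕ → ℕ} (hγ : γ ∈ UpperIncreasing n r q)
    {i : ℕ} (h1 : 1 ≤ i) (h2 : i ≤ n) : ∃ h X, 1 ≤ h ∧ h ≤ r + 1 ∧ q (h - 1) < i ∧ i ≤ X ∧
      X ≤ q h ∧ IsCritical r q γ X ∧ (∀ k, i ≤ k → k < X → ¬ IsCritical r q γ k) ∧
      γ i + (X - i) = γ X := by
  obtain ⟨h, ha, hb, hc, hd⟩ := E.exists_carrel h1 h2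
  obtain ⟨X, hX1, hX2, hX3, hX4, hX5⟩ := exists_next_critical E hγ.1 ha hb hc hd
  rw [colMax_eq_self hγ.2 ha hb hc hd] at hX5
  exact ⟨h, X, ha, hb, hc, hX1, hX2, hX3, hX4, hX5⟩

/-! ### Canopies -/

/-- The core fixes the critical pairs, and a canopy has `n` elsewhere: it is the largest bound with
its core. -/
theorem canopies_bijOn (E : CarrelEnum n r q) :
    Set.BijOn (core n r q) (Canopies n r q) (Gapless n r q) := by
  classical
  refine ⟨fun κ hκ => ?_, fun κ hκ κ' hκ' he => ?_, fun γ hγ => ?_⟩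
  · exact (core_mem_gapless_iff E hκ.1.1).2 ((isFlagLike_iff E hκ.1.1).2 hκ.2)
  · refine Tuples.ext hκ.1.1.1 hκ'.1.1.1 fun i h1 h2 => ?_
    have hcrit : IsCritical r q κ i ↔ IsCritical r q κ' i := by
      rw [← isCritical_core_iff E hκ.1.1, he, isCritical_core_iff E hκ'.1.1]
    by_cases hi : IsCritical r q κ i
    · rw [← core_apply_of_isCritical E hκ.1.1 hi, he,
        core_apply_of_isCritical E hκ'.1.1 (hcrit.1 hi)]
    · rw [hκ.1.2 i h1 h2 hi, hκ'.1.2 i h1 h2 (fun h => hi (hcrit.2 h))]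
  · set κ : ℕ → ℕ := fun i => if 1 ≤ i ∧ i ≤ n then if IsCritical r q γ i then γ i else n else 0
      with hκ
    have hin : ∀ i, 1 ≤ i → i ≤ n → κ i = if IsCritical r q γ i then γ i else n := fun i h1 h2 => by
      simp only [hκ]; rw [if_pos ⟨h1, h2⟩]
    have hge : ∀ i, 1 ≤ i → i ≤ n → γ i ≤ κ i ∧ κ i ≤ n := fun i h1 h2 => by
      have := (hγ.1.1.1.1 i h1 h2).2
      rw [hin i h1 h2]
      split_ifs <;> omega
    have hU : κ ∈ Upper n := by
      refine ⟨⟨fun i h1 h2 => ?_, fun i hi => by simp only [hκ]; rw [if_neg hi]⟩, fun i h1 h2 => ?_⟩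
      · have := hge i h1 h2
        have := (hγ.1.1.1.1 i h1 h2).1
        omega
      · exact (hγ.1.1.2 i h1 h2).trans (hge i h1 h2).1
    have hc : core n r q κ = γ := by
      rw [core_eq_iff E hγ.1 hU]
      refine ⟨fun i h1 h2 => (hge i h1 h2).1, fun x hx => ?_⟩
      obtain ⟨h1, h2⟩ := isCritical_le E hx
      rw [hin x h1 h2, if_pos hx]
    refine ⟨κ, ⟨⟨hU, fun i h1 h2 hi => ?_⟩, ?_⟩, hc⟩
    · rw [← isCritical_core_iff E hU, hc] at hi
      rw [hin i h1 h2, if_neg hi]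
    · rw [← isFlagLike_iff E hU, ← isFlagLike_core_iff E hU, hc]
      exact gapless_flagLike E hγ

/-! ### Ceilings and floors -/

/-- The preimage of `γ` copies the next critical entry to each index; this is weakly increasing
because the critical entries of a gapless tuple are. It is the largest flag with core `γ`. -/
theorem ceilings_bijOn (E : CarrelEnum n r q) :
    Set.BijOn (core n r q) (Ceilings n r q) (Gapless n r q) := by
  refine ⟨fun ξ hξ => core_upperFlag_mem_gapless E hξ.1, fun ξ hξ ξ' hξ' he => ?_, fun γ hγ => ?_⟩
  · refine Tuples.ext hξ.1.1.1 hξ'.1.1.1 fun i h1 h2 => ?_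
    have hcrit : ∀ k, IsCritical r q ξ k ↔ IsCritical r q ξ' k := fun k => by
      rw [← isCritical_core_iff E hξ.1.1, he, isCritical_core_iff E hξ'.1.1]
    obtain ⟨h, ha, hb, hc, hd⟩ := E.exists_carrel h1 h2
    obtain ⟨X, hX1, hX2, hX3, hX4, -⟩ := exists_next_critical E hξ.1.1 ha hb hc hd
    rw [hξ.2 i X h1 hX1 hX3 hX4, hξ'.2 i X h1 hX1 ((hcrit X).1 hX3)
      (fun k hk hk' h => hX4 k hk hk' ((hcrit k).2 h)), ← core_apply_of_isCritical E hξ.1.1 hX3, he,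
      core_apply_of_isCritical E hξ'.1.1 ((hcrit X).1 hX3)]
  · have hnext := fun i h1 h2 => gapless_exists_next E hγ.1 (i := i) h1 h2
    choose! h X hX using hnext
    classical
    set ξ : ℕ → ℕ := fun i => if 1 ≤ i ∧ i ≤ n then γ (X i) else 0 with hξ
    have hin : ∀ i, 1 ≤ i → i ≤ n → ξ i = γ (X i) := fun i h1 h2 => by
      simp only [hξ]; rw [if_pos ⟨h1, h2⟩]
    have hge : ∀ i, 1 ≤ i → i ≤ n → γ i ≤ ξ i ∧ ξ i ≤ n := fun i h1 h2 => by
      obtain ⟨-, -, -, -, -, hc, -, hs⟩ := hX i h1 h2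
      obtain ⟨h3, h4⟩ := isCritical_le E hc
      have := (hγ.1.1.1.1 _ h3 h4).2
      rw [hin i h1 h2]
      omega
    have hfl : ∀ i j, 1 ≤ i → i ≤ j → j ≤ n → ξ i ≤ ξ j := fun i j h1 hij h2 => by
      obtain ⟨-, -, -, hi1, -, hc, hn, -⟩ := hX i h1 (hij.trans h2)
      obtain ⟨-, -, -, hj1, -, hc', hn', -⟩ := hX j (h1.trans hij) h2
      rw [hin i h1 (by omega), hin j (by omega) h2]
      refine gapless_critical_mono E hγ hc hc' ?_
      by_contra hlt
      exact hn (X j) (by omega) (by omega) hc'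
    have hU : ξ ∈ Upper n := by
      refine ⟨⟨fun i h1 h2 => ?_, fun i hi => by simp only [hξ]; rw [if_neg hi]⟩, fun i h1 h2 => ?_⟩
      · have := hge i h1 h2
        have := (hγ.1.1.1.1 i h1 h2).1
        omega
      · exact (hγ.1.1.2 i h1 h2).trans (hge i h1 h2).1
    have hXc : ∀ i x, 1 ≤ i → i ≤ x → IsCritical r q γ x →
        (∀ k, i ≤ k → k < x → ¬ IsCritical r q γ k) → X i = x := by
      intro i x h1 hix hx hn
      have hxn := (isCritical_le E hx).2
      obtain ⟨-, -, -, hi1, -, hc, hn', -⟩ := hX i h1 (by omega)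
      rcases lt_trichotomy (X i) x with hlt | heq | hlt
      · exact absurd hc (hn _ hi1 hlt)
      · exact heq
      · exact absurd hx (hn' _ hix hlt)
    have hcrit : ∀ x, IsCritical r q γ x → ξ x = γ x := fun x hx => by
      obtain ⟨h1, h2⟩ := isCritical_le E hx
      rw [hin x h1 h2, hXc x x h1 le_rfl hx (fun k hk hk' => by omega)]
    have hc : core n r q ξ = γ := by
      rw [core_eq_iff E hγ.1 hU]
      exact ⟨fun i h1 h2 => (hge i h1 h2).1, hcrit⟩
    refine ⟨ξ, ⟨⟨hU, hfl⟩, fun i x h1 hix hx hn => ?_⟩, hc⟩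
    have hx' : IsCritical r q γ x := by rwa [← isCritical_core_iff E hU, hc] at hx
    rw [hcrit x hx', hin i h1 (hix.trans (isCritical_le E hx).2), hXc i x h1 hix hx' fun k hk hk' h =>
      hn k hk hk' (by rwa [← isCritical_core_iff E hU, hc])]

/-- The maximal plateau through `k` and `k + 1` has length at least two, so its start is some `q g`.
-/
theorem floor_exists_end {τ : ℕ → ℕ} (hτ : τ ∈ Floors n r q) {k : ℕ}
    (h1 : 1 ≤ k) (h2 : k < n) (he : τ k = τ (k + 1)) :
    ∃ g, 1 ≤ g ∧ g ≤ r ∧ q g ≤ k ∧ τ (q g) = τ k := by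
  classical
  have hex : ∃ a, 1 ≤ a ∧ τ a = τ k := ⟨k, h1, rfl⟩
  obtain ⟨ha1, ha2⟩ := Nat.find_spec hex
  have hak : Nat.find hex ≤ k := Nat.find_le ⟨h1, rfl⟩
  have hPk : τ (k + 1) = τ k := he.symm
  have hb : τ (Nat.findGreatest (fun b => τ b = τ k) n) = τ k :=
    Nat.findGreatest_spec (P := fun b => τ b = τ k) h2 hPk
  have hkb : k + 1 ≤ Nat.findGreatest (fun b => τ b = τ k) n := Nat.le_findGreatest h2 hPk
  have hbn : Nat.findGreatest (fun b => τ b = τ k) n ≤ n := Nat.findGreatest_le n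
  have hbmax : ∀ c, Nat.findGreatest (fun b => τ b = τ k) n < c → c ≤ n → τ c ≠ τ k :=
    fun c hc hcn => Nat.findGreatest_is_greatest (P := fun b => τ b = τ k) hc hcn
  have hamin : ∀ c, c < Nat.find hex → ¬ (1 ≤ c ∧ τ c = τ k) := fun c hc => Nat.find_min hex hc
  generalize Nat.find hex = a at *
  generalize Nat.findGreatest (fun b => τ b = τ k) n = b at *
  obtain ⟨g, hg1, hg2, rfl⟩ := hτ.2 a b ⟨ha1, by omega, hbn, fun i hi hi' => by
      have := hτ.1.2 a i ha1 hi (by omega)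
      have := hτ.1.2 i b (by omega) hi' hbn
      omega, by
      rcases ha1.eq_or_lt with h | h
      · exact .inl h.symm
      · refine .inr fun hc => hamin (a - 1) (by omega) ⟨by omega, hc.trans ha2⟩, by
      rcases hbn.eq_or_lt with h | h
      · exact .inl h
      · exact .inr fun hc => hbmax (b + 1) (by omega) h (hc.trans hb)⟩ (by omega)
  exact ⟨g, hg1, hg2, hak, ha2⟩

/-- A floor exceeds its core only on plateaus, which start at carrel ends, where floor and core
agree. Hence it is the running maximum of its core. -/
theorem floor_eq_sup (E : CarrelEnum n r q) {τ : ℕ → ℕ} (hτ : τ ∈ Floors n r q) {i : ℕ}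
    (h1 : 1 ≤ i) (h2 : i ≤ n) : τ i = (Finset.Icc 1 i).sup (core n r q τ) := by
  apply le_antisymm
  · suffices ∃ j, 1 ≤ j ∧ j ≤ i ∧ τ i = core n r q τ j by
      obtain ⟨j, hj1, hj2, hj3⟩ := this
      rw [hj3]
      exact Finset.le_sup (Finset.mem_Icc.2 ⟨hj1, hj2⟩)
    obtain ⟨h, ha, hb, hc, hd⟩ := E.exists_carrel h1 h2
    have hqn := E.le_top hb
    by_cases he : τ i = core n r q τ i
    · exact ⟨i, h1, le_rfl, he⟩
    obtain ⟨X, hX1, hX2, hX3⟩ := exists_colMax_add (Upper.le hτ.1.1 (E.le_top hb)) h1 hd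
    rw [← core_eq_colMax E hτ.1.1 ha hb hc hd] at hX3
    have hlt : core n r q τ i < τ i := lt_of_le_of_ne (core_le_self E hτ.1.1 i h1 h2) (Ne.symm he)
    -- Strict growth from `i` to `X` would give `τ i + (X - i) ≤ τ X`, hence `τ i ≤ core n r q τ i`.
    -- So some plateau meets this stretch; its start `q g` is left of the carrel end `q h`, thus at
    -- most `q (h - 1) < i`.
    obtain ⟨k, hk1, hk2, hk3⟩ : ∃ k, i ≤ k ∧ k < X ∧ τ k = τ (k + 1) := by
      by_contra! hcon
      have : ∀ j, i ≤ j → j ≤ X → τ i + (j - i) ≤ τ j := by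
        intro j hij
        induction j, hij using Nat.le_induction with
        | base => simp
        | succ j hij ih =>
          intro hj
          have := ih (by omega)
          have := hcon j hij (by omega)
          have := hτ.1.2 j (j + 1) (by omega) (by omega) (by omega)
          omega
      have := this X hX1 le_rfl
      omega
    obtain ⟨g, hg1, hg2, hg3, hg4⟩ := floor_exists_end hτ (by omega) (by omega) hk3
    have hgi : q g ≤ i := by
      have : g < h := E.lt_of_lt (by omega) (by omega)
      have := E.mono (show g ≤ h - 1 by omega) (by omega)
      omega
    have hg0 := E.one_le hg1 (by omega)
    refine ⟨q g, hg0, hgi, ?_⟩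
    rw [core_apply_of_isCritical E hτ.1.1 (isCritical_end _ hg1 (by omega))]
    have := hτ.1.2 (q g) i hg0 hgi h2
    have := hτ.1.2 i k h1 hk1 (by omega)
    omega
  · refine Finset.sup_le fun j hj => ?_
    rw [Finset.mem_Icc] at hj
    exact (core_le_self E hτ.1.1 j hj.1 (hj.2.trans h2)).trans (hτ.1.2 j i hj.1 hj.2 h2)

/-- The preimage of `γ` is its running maximum, the least flag above `γ`. At a critical index it
equals `γ`, since each earlier entry is bounded by its next critical entry. -/
theorem floors_bijOn (E : CarrelEnum n r q) :
    Set.BijOn (core n r q) (Floors n r q) (Gapless n r q) := by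
  refine ⟨fun τ hτ => core_upperFlag_mem_gapless E hτ.1, fun τ hτ τ' hτ' he => ?_, fun γ hγ => ?_⟩
  · refine Tuples.ext hτ.1.1.1 hτ'.1.1.1 fun i h1 h2 => ?_
    rw [floor_eq_sup E hτ h1 h2, floor_eq_sup E hτ' h1 h2, he]
  · set τ : ℕ → ℕ := fun i => if 1 ≤ i ∧ i ≤ n then (Finset.Icc 1 i).sup γ else 0 with hτ
    have hin : ∀ i, 1 ≤ i → i ≤ n → τ i = (Finset.Icc 1 i).sup γ := fun i h1 h2 => by
      simp only [hτ]; rw [if_pos ⟨h1, h2⟩]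
    have hle : ∀ i j, 1 ≤ j → j ≤ i → i ≤ n → γ j ≤ τ i := fun i j h1 h2 h3 => by
      rw [hin i (by omega) h3]
      exact Finset.le_sup (Finset.mem_Icc.2 ⟨h1, h2⟩)
    have hfl : ∀ i j, 1 ≤ i → i ≤ j → j ≤ n → τ i ≤ τ j := fun i j h1 hij h2 => by
      rw [hin i h1 (by omega)]
      refine Finset.sup_le fun k hk => ?_
      rw [Finset.mem_Icc] at hk
      exact hle j k hk.1 (by omega) h2
    have hU : τ ∈ Upper n := by
      refine ⟨⟨fun i h1 h2 => ?_, fun i hi => by simp only [hτ]; rw [if_neg hi]⟩, fun i h1 h2 => ?_⟩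
      · refine ⟨(hγ.1.1.1.1 i h1 h2).1.trans (hle i i h1 le_rfl h2), ?_⟩
        rw [hin i h1 h2]
        refine Finset.sup_le fun k hk => ?_
        rw [Finset.mem_Icc] at hk
        exact (hγ.1.1.1.1 k hk.1 (by omega)).2
      · exact (hγ.1.1.2 i h1 h2).trans (hle i i h1 le_rfl h2)
    have hc : core n r q τ = γ := by
      rw [core_eq_iff E hγ.1 hU]
      refine ⟨fun i h1 h2 => hle i i h1 le_rfl h2, fun x hx => ?_⟩
      obtain ⟨h1, h2⟩ := isCritical_le E hx
      refine le_antisymm ?_ (hle x x h1 le_rfl h2)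
      rw [hin x h1 h2]
      refine Finset.sup_le fun j hj => ?_
      rw [Finset.mem_Icc] at hj
      obtain ⟨h, X, -, -, -, hX1, -, hX3, hX4, hX5⟩ := gapless_exists_next E hγ.1 hj.1 (by omega)
      have : X ≤ x := by
        by_contra hcon
        exact hX4 x hj.2 (by omega) hx
      have := gapless_critical_mono E hγ hX3 hx this
      omega
    refine ⟨τ, ⟨⟨hU, hfl⟩, fun a b hab hlt => ?_⟩, hc⟩
    obtain ⟨ha, hab', hbn, heq, hstart, -⟩ := hab
    obtain ⟨h, h1, h2, h3, h4⟩ := E.exists_carrel ha (by omega)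
    have hhr : q h = a ∨ a + 1 ≤ q h := by omega
    rcases hhr with hqa | hqa
    · refine ⟨h, h1, ?_, hqa.symm⟩
      by_contra hcon
      have : h = r + 1 := by omega
      rw [this, E.top] at hqa
      omega
    · exfalso
      -- If `a` is not a carrel end, then `γ a < γ (a + 1) ≤ τ (a + 1) = τ a`. So the maximum `τ a`
      -- is already reached before `a`, and the plateau does not start at `a`.
      have hs := rIncreasing_add_le hγ.1.2 h1 h2 h3 (show a ≤ a + 1 by omega) hqa
      have h5 := hle (a + 1) (a + 1) (by omega) le_rfl (by omega)
      have h6 := heq (a + 1) (by omega) (by omega)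
      obtain ⟨j, hj, hj'⟩ := Finset.exists_mem_eq_sup (Finset.Icc 1 a) ⟨1, by simpa using ha⟩ γ
      rw [← hin a ha (by omega)] at hj'
      rw [Finset.mem_Icc] at hj
      have hja : j ≠ a := by rintro rfl; omega
      have h7 := hle (a - 1) j hj.1 (by omega) (by omega)
      have h8 := hfl (a - 1) a (by omega) (by omega) (by omega)
      rcases hstart with h | h <;> omega

/-- Every gapless tuple is the core of an upper flag. -/
theorem exists_upperFlag_core_eq (E : CarrelEnum n r q) {γ : ℕ → ℕ} (hγ : γ ∈ Gapless n r q) :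
    ∃ φ ∈ UpperFlags n, core n r q φ = γ := by
  obtain ⟨ξ, hξ, he⟩ := (ceilings_bijOn E).surjOn hγ
  exact ⟨ξ, hξ.1, he⟩

theorem core_image_gaplessCore (E : CarrelEnum n r q) :
    core n r q '' GaplessCore n r q = Gapless n r q := by
  ext γ
  constructor
  · rintro ⟨η, hη, rfl⟩
    exact hη.2
  · intro hγ
    exact ⟨γ, ⟨hγ.1.1, by rwa [core_eq_self E hγ.1]⟩, core_eq_self E hγ.1⟩

theorem core_image_upperFlags (E : CarrelEnum n r q) :
    core n r q '' UpperFlags n = Gapless n r q := by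
  ext γ
  constructor
  · rintro ⟨φ, hφ, rfl⟩
    exact core_upperFlag_mem_gapless E hφ
  · intro hγ
    obtain ⟨φ, hφ, he⟩ := exists_upperFlag_core_eq E hγ
    exact ⟨φ, hφ, he⟩

end gapless

section lists

variable {n r : ℕ} {q : ℕ → ℕ}

/-! ### Critical lists -/

theorem isCritSet_critList (E : CarrelEnum n r q) {β : ℕ → ℕ} (hβ : β ∈ Upper n) {h : ℕ}
    (h1 : 1 ≤ h) (h2 : h ≤ r + 1) : IsCritSet n q h (critList r q β h) := by
  classical
  set A : Finset ℕ := (Finset.Ioc (q (h - 1)) (q h)).filter (IsCritical r q β) with hA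
  have hmem : ∀ x, x ∈ A ↔ q (h - 1) < x ∧ x ≤ q h ∧ IsCritical r q β x := fun x => by
    simp [hA, and_assoc]
  have hqA : q h ∈ A := (hmem _).2 ⟨E.pred_lt h1 h2, le_rfl, isCritical_end _ h1 h2⟩
  have hpos : 1 ≤ A.card := Finset.card_pos.2 ⟨_, hqA⟩
  have hxm : ∀ u, 1 ≤ u → u ≤ A.card → srt A (A.card + 1 - u) ∈ A := fun u hu hu' =>
    srt_mem (by omega) (by omega)
  -- Critical pairs are numbered from the right, `srt` from the left.
  refine ⟨A.card, fun u => srt A (A.card + 1 - u), fun u => β (srt A (A.card + 1 - u)), hpos, ?_,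
    ((hmem _).1 (hxm _ hpos le_rfl)).1, ?_, ?_, ?_⟩
  · obtain ⟨i, hi1, hi2, hi3⟩ := exists_srt_eq hqA
    have := srt_le hi1 hi2 le_rfl
    have := ((hmem _).1 (srt_mem hpos le_rfl)).2.1
    simp only [Nat.add_sub_cancel]
    omega
  · intro u hu hu'
    dsimp only
    obtain ⟨ha, hb, hc⟩ := (hmem _).1 (hxm u hu hu')
    have := E.le_top h2
    exact ⟨hβ.2 _ (by omega) (by omega), (hβ.1.1 _ (by omega) (by omega)).2⟩
  · intro u hu hu'
    dsimp only
    obtain ⟨ha, hb, hc⟩ := (hmem _).1 (hxm u (by omega) hu')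
    obtain ⟨ha', hb', -⟩ := (hmem _).1 (hxm (u - 1) (by omega) (by omega))
    have hlt : srt A (A.card + 1 - u) < srt A (A.card + 1 - (u - 1)) :=
      srt_lt (by omega) (by omega) (by omega)
    rw [isCritical_iff E β h1 h2 ha hb] at hc
    have := hc _ hlt hb'
    exact ⟨hlt, by omega⟩
  · ext ⟨x, y⟩
    simp only [critList, Set.mem_ofPred_eq, Prod.mk.injEq]
    rw [isCriticalIn_iff_isCritical E β h1 h2, ← hmem]
    constructor
    · rintro ⟨-, -, hx, rfl⟩
      obtain ⟨i, hi1, hi2, rfl⟩ := exists_srt_eq hx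
      exact ⟨A.card + 1 - i, by omega, by omega, by
        rw [show A.card + 1 - (A.card + 1 - i) = i by omega]; exact ⟨rfl, rfl⟩⟩
    · rintro ⟨u, hu, hu', rfl, rfl⟩
      exact ⟨h1, h2, hxm u hu hu', rfl⟩

/-- Telescoping the step inequalities removes the numbering: what remains is a partial function on
the carrel, defined at `q h`, along which `y - x` increases strictly. -/
theorem isCritSet_props {h : ℕ} {C : Set (ℕ × ℕ)} (hC : IsCritSet n q h C) :
    (∃ y, (q h, y) ∈ C) ∧
    (∀ x y, (x, y) ∈ C → q (h - 1) < x ∧ x ≤ q h ∧ x ≤ y ∧ y ≤ n) ∧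
    ∀ x y x' y', (x, y) ∈ C → (x', y') ∈ C →
      (x = x' → y = y') ∧ (x < x' → (y : ℤ) - x < (y' : ℤ) - x') := by
  obtain ⟨f, x, y, hf, hx1, hxf, hle, hstep, rfl⟩ := hC
  have hchain : ∀ u v, 1 ≤ u → u < v → v ≤ f →
      x v < x u ∧ (y v : ℤ) - x v < (y u : ℤ) - x u := by
    intro u v hu huv
    induction v, huv using Nat.le_induction with
    | base =>
      intro hv
      obtain ⟨h1, h2⟩ := hstep (u + 1) (by omega) hv
      rw [Nat.add_sub_cancel] at h1 h2
      simp only [Nat.succ_eq_add_one]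
      exact ⟨h1, by omega⟩
    | succ v huv ih =>
      intro hv
      obtain ⟨h1, h2⟩ := hstep (v + 1) (by omega) hv
      rw [Nat.add_sub_cancel] at h1 h2
      have := ih (by omega)
      omega
  refine ⟨⟨y 1, 1, le_rfl, hf, by rw [hx1]⟩, ?_, ?_⟩
  · rintro _ _ ⟨u, hu, hu', h⟩
    rw [Prod.mk.injEq] at h
    obtain ⟨rfl, rfl⟩ := h
    obtain ⟨h3, h4⟩ := hle u hu hu'
    refine ⟨?_, ?_, h3, h4⟩
    · rcases hu'.eq_or_lt with rfl | hlt
      · exact hxf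
      · exact hxf.trans (hchain u f hu hlt le_rfl).1
    · rcases hu.eq_or_lt with rfl | hlt
      · exact hx1.le
      · exact (hchain 1 u le_rfl hlt hu').1.le.trans hx1.le
  · rintro _ _ _ _ ⟨u, hu, hu', h⟩ ⟨v, hv, hv', h'⟩
    rw [Prod.mk.injEq] at h h'
    obtain ⟨rfl, rfl⟩ := h
    obtain ⟨rfl, rfl⟩ := h'
    rcases lt_trichotomy u v with huv | rfl | huv
    · have := hchain u v hu huv hv'
      omega
    · exact ⟨fun _ => rfl, fun h => by omega⟩
    · have := hchain v u hv huv hu'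
      omega

/-- The preimage of a list takes the listed entries and `n` elsewhere; filling with `n` creates no
new critical index and destroys none. -/
theorem critList_bijOn (E : CarrelEnum n r q) :
    Set.BijOn (critList r q) (Canopies n r q) (FlagCritLists n r q) := by
  classical
  refine ⟨fun κ hκ => ⟨⟨fun h h1 h2 => isCritSet_critList E hκ.1.1 h1 h2, fun h hh => ?_⟩, hκ.2⟩,
    fun κ hκ κ' hκ' he => ?_, fun C hC => ?_⟩
  · ext p
    simp only [critList, Set.mem_ofPred_eq, Set.mem_empty_iff_false, iff_false]
    rintro ⟨h1, h2, -⟩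
    exact hh ⟨h1, h2⟩
  · have key : ∀ κ κ', critList r q κ = critList r q κ' → ∀ x, IsCritical r q κ x →
        IsCritical r q κ' x ∧ κ' x = κ x := by
      rintro κ κ' he x ⟨h, h1, h2, h3⟩
      have : (x, κ x) ∈ critList r q κ' h := by rw [← he]; exact ⟨h1, h2, h3, rfl⟩
      exact ⟨⟨h, h1, h2, this.2.2.1⟩, this.2.2.2.symm⟩
    refine Tuples.ext hκ.1.1.1 hκ'.1.1.1 fun i h1 h2 => ?_
    by_cases hi : IsCritical r q κ i
    · exact (key κ κ' he i hi).2.symm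
    · rw [hκ.1.2 i h1 h2 hi, hκ'.1.2 i h1 h2 fun h => hi (key κ' κ he.symm i h).1]
  · have hP := fun h h1 h2 => isCritSet_props (hC.1.1 h h1 h2)
    set κ : ℕ → ℕ := fun i =>
      if hi : ∃ y h, 1 ≤ h ∧ h ≤ r + 1 ∧ (i, y) ∈ C h then hi.choose
      else if 1 ≤ i ∧ i ≤ n then n else 0 with hκ
    have hκC : ∀ h i y, 1 ≤ h → h ≤ r + 1 → (i, y) ∈ C h → κ i = y := by
      intro h i y h1 h2 hy
      have hi : ∃ y h, 1 ≤ h ∧ h ≤ r + 1 ∧ (i, y) ∈ C h := ⟨y, h, h1, h2, hy⟩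
      simp only [hκ]
      rw [dif_pos hi]
      obtain ⟨g, hg1, hg2, hg⟩ := hi.choose_spec
      have ha := (hP g hg1 hg2).2.1 _ _ hg
      have hb := (hP h h1 h2).2.1 _ _ hy
      obtain rfl := E.carrel_unique hg1 hg2 h1 h2 ⟨ha.1, ha.2.1⟩ ⟨hb.1, hb.2.1⟩
      exact ((hP g h1 h2).2.2 _ _ _ _ hg hy).1 rfl
    have hκn : ∀ i, (¬ ∃ y h, 1 ≤ h ∧ h ≤ r + 1 ∧ (i, y) ∈ C h) → 1 ≤ i → i ≤ n → κ i = n := by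
      intro i hi h1 h2
      simp only [hκ]
      rw [dif_neg hi, if_pos ⟨h1, h2⟩]
    have hrange : ∀ i, 1 ≤ i → i ≤ n → i ≤ κ i ∧ κ i ≤ n := by
      intro i h1 h2
      by_cases hi : ∃ y h, 1 ≤ h ∧ h ≤ r + 1 ∧ (i, y) ∈ C h
      · obtain ⟨y, h, ha, hb, hy⟩ := hi
        rw [hκC h i y ha hb hy]
        exact ((hP h ha hb).2.1 _ _ hy).2.2
      · rw [hκn i hi h1 h2]; omega
    have hU : κ ∈ Upper n := by
      refine ⟨⟨fun i h1 h2 => ⟨by have := hrange i h1 h2; omega, (hrange i h1 h2).2⟩, fun i hi => ?_⟩,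
        fun i h1 h2 => (hrange i h1 h2).1⟩
      simp only [hκ]
      rw [dif_neg, if_neg hi]
      rintro ⟨y, h, ha, hb, hy⟩
      have := (hP h ha hb).2.1 _ _ hy
      have := E.le_top hb
      omega
    have hcrit : ∀ h x, 1 ≤ h → h ≤ r + 1 → q (h - 1) < x → x ≤ q h →
        (IsCritical r q κ x ↔ ∃ y, (x, y) ∈ C h) := by
      intro h x h1 h2 h3 h4
      have hqn := E.le_top h2
      have hnot : ∀ z, q (h - 1) < z → z ≤ q h → (¬ ∃ y, (z, y) ∈ C h) → κ z = n := by
        intro z hz hz' hn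
        refine hκn z ?_ (by omega) (by omega)
        rintro ⟨y, g, hg1, hg2, hy⟩
        have ha := (hP g hg1 hg2).2.1 _ _ hy
        obtain rfl := E.carrel_unique hg1 hg2 h1 h2 ⟨ha.1, ha.2.1⟩ ⟨hz, hz'⟩
        exact hn ⟨y, hy⟩
      obtain ⟨y0, hy0⟩ := (hP h h1 h2).1
      rw [isCritical_iff E κ h1 h2 h3 h4]
      constructor
      · intro hc
        by_contra hn
        have hxn := hnot x h3 h4 hn
        have hlt : x < q h := lt_of_le_of_ne h4 (by rintro rfl; exact hn ⟨y0, hy0⟩)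
        -- An entry `n` at `x < q h` is not critical: `n - x` exceeds `κ (q h) - q h`.
        have := hc (q h) hlt le_rfl
        have := (hrange (q h) (by omega) hqn).2
        omega
      · rintro ⟨y, hy⟩ z hz hz'
        rw [hκC h x y h1 h2 hy]
        by_cases hzC : ∃ y, (z, y) ∈ C h
        · obtain ⟨y', hy'⟩ := hzC
          rw [hκC h z y' h1 h2 hy']
          exact ((hP h h1 h2).2.2 _ _ _ _ hy hy').2 hz
        · rw [hnot z (by omega) hz' hzC]
          have := ((hP h h1 h2).2.2 _ _ _ _ hy hy0).2 (by omega)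
          have := ((hP h h1 h2).2.1 _ _ hy0).2.2.2
          omega
    have hlist : critList r q κ = C := by
      funext h
      by_cases hh : 1 ≤ h ∧ h ≤ r + 1
      · ext ⟨x, y⟩
        simp only [critList, Set.mem_ofPred_eq]
        rw [isCriticalIn_iff_isCritical E κ hh.1 hh.2]
        constructor
        · rintro ⟨-, -, ⟨h3, h4, h5⟩, rfl⟩
          obtain ⟨y, hy⟩ := (hcrit h x hh.1 hh.2 h3 h4).1 h5
          rwa [hκC h x y hh.1 hh.2 hy]
        · intro hy
          have ha := (hP h hh.1 hh.2).2.1 _ _ hy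
          exact ⟨hh.1, hh.2, ⟨ha.1, ha.2.1, (hcrit h x hh.1 hh.2 ha.1 ha.2.1).2 ⟨y, hy⟩⟩,
            (hκC h x y hh.1 hh.2 hy).symm⟩
      · rw [hC.1.2 h hh]
        ext p
        simp only [critList, Set.mem_ofPred_eq, Set.mem_empty_iff_false, iff_false]
        rintro ⟨h1, h2, -⟩
        exact hh ⟨h1, h2⟩
    refine ⟨κ, ⟨⟨hU, fun i h1 h2 hi => hκn i ?_ h1 h2⟩, ?_⟩, hlist⟩
    · rintro ⟨y, h, ha, hb, hy⟩
      have hc := (hP h ha hb).2.1 _ _ hy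
      exact hi ((hcrit h i ha hb hc.1 hc.2.1).2 ⟨y, hy⟩)
    · rw [hlist]; exact hC.2

/-! ### Sequences of shapes -/

/-- In the last carrel, a core has no freedom. -/
theorem upperIncreasing_last (E : CarrelEnum n r q) {γ : ℕ → ℕ} (hγ : γ ∈ UpperIncreasing n r q)
    {i : ℕ} (h1 : q r < i) (h2 : i ≤ n) : γ i = i := by
  have := rIncreasing_add_le hγ.2 (h := r + 1) (i := i) (j := n) (by omega) le_rfl (by simpa using h1)
    h2 E.top.ge
  have := hγ.1.2 i (by omega) h2
  have := (hγ.1.1.1 n (by omega) le_rfl).2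
  omega

theorem rowLen_eq_zero_of {μ : YoungDiagram} {p m a : ℕ} (hμ : ∀ c ∈ μ, c.1 < p ∧ c.2 < m)
    (ha : p ≤ a) : μ.rowLen a = 0 := by
  by_contra h
  have := (hμ _ (YoungDiagram.mem_iff_lt_rowLen.2 (Nat.pos_of_ne_zero h))).1
  simp only at this
  omega

theorem rowLen_le_of {μ : YoungDiagram} {p m : ℕ} (hμ : ∀ c ∈ μ, c.1 < p ∧ c.2 < m) (a : ℕ) :
    μ.rowLen a ≤ m := by
  by_contra h
  have := (hμ _ (YoungDiagram.mem_iff_lt_rowLen.2 (not_le.1 h))).2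
  simp only at this
  omega

theorem youngDiagram_ext_rowLen {μ ν : YoungDiagram} (h : ∀ a, μ.rowLen a = ν.rowLen a) :
    μ = ν := by
  ext ⟨a, b⟩
  simp only [YoungDiagram.mem_cells]
  rw [YoungDiagram.mem_iff_lt_rowLen, YoungDiagram.mem_iff_lt_rowLen, h]

/-- The Young diagram with `p` rows of lengths `f 0 ≥ f 1 ≥ …`. -/
def diagramOf (p : ℕ) (f : ℕ → ℕ) (hf : ∀ a b, a ≤ b → b < p → f b ≤ f a) : YoungDiagram where
  cells := (Finset.range p ×ˢ Finset.range (f 0)).filter fun c => c.2 < f c.1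
  isLowerSet := by
    rintro ⟨a, b⟩ ⟨c, d⟩ hle h
    simp only [Finset.coe_filter, Finset.mem_product, Finset.mem_range, Set.mem_ofPred_eq] at h ⊢
    have h3 : c ≤ a := hle.1
    have h4 : d ≤ b := hle.2
    have := hf c a h3 h.1.1
    omega

theorem mem_diagramOf {p : ℕ} {f : ℕ → ℕ} {hf : ∀ a b, a ≤ b → b < p → f b ≤ f a} {a b : ℕ} :
    (a, b) ∈ diagramOf p f hf ↔ a < p ∧ b < f a := by
  rw [← YoungDiagram.mem_cells]
  simp only [diagramOf, Finset.mem_filter, Finset.mem_product, Finset.mem_range]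
  refine ⟨fun h => ⟨h.1.1, h.2⟩, fun h => ⟨⟨h.1, ?_⟩, h.2⟩⟩
  have := hf 0 a (by omega) h.1
  omega

theorem rowLen_diagramOf {p : ℕ} {f : ℕ → ℕ} {hf : ∀ a b, a ≤ b → b < p → f b ≤ f a} {a : ℕ}
    (ha : a < p) : (diagramOf p f hf).rowLen a = f a := by
  apply eq_of_forall_lt_iff
  intro b
  rw [← YoungDiagram.mem_iff_lt_rowLen, mem_diagramOf]
  simp [ha]

/-- The rows of a diagram that have the length of the last of `p` rows are the last ones. -/
theorem rowLen_eq_iff_of_card {μ : YoungDiagram} {p : ℕ} (i : ℕ) (hi : i < p) :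
    μ.rowLen i = μ.rowLen (p - 1) ↔ p - ((Finset.range p).filter fun i =>
      μ.rowLen i = μ.rowLen (p - 1)).card ≤ i := by
  classical
  set A := (Finset.range p).filter fun i => μ.rowLen i = μ.rowLen (p - 1) with hA
  have hup : ∀ i j, i ∈ A → i ≤ j → j < p → j ∈ A := by
    intro i j hi hij hj
    simp only [hA, Finset.mem_filter, Finset.mem_range] at hi ⊢
    have h1 := μ.rowLen_anti i j hij
    have h2 := μ.rowLen_anti j (p - 1) (by omega)
    omega
  have hAp : A ⊆ Finset.range p := Finset.filter_subset _ _
  have hmem : i ∈ A ↔ μ.rowLen i = μ.rowLen (p - 1) := by simp [hA, hi]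
  rw [← hmem]
  constructor
  · intro h
    have : Finset.Ico i p ⊆ A := fun j hj => by
      rw [Finset.mem_Ico] at hj
      exact hup i j h hj.1 hj.2
    have := Finset.card_le_card this
    rw [Nat.card_Ico] at this
    omega
  · intro h
    by_contra hn
    have : A ⊆ Finset.Ico (i + 1) p := fun j hj => by
      rw [Finset.mem_Ico]
      have := Finset.mem_range.1 (hAp hj)
      refine ⟨?_, this⟩
      by_contra hc
      exact hn (hup j i hj (by omega) hi)
    have := Finset.card_le_card this
    rw [Nat.card_Ico] at this
    omega

/-- The tuple obtained by adding `i` to the row lengths of the shapes, read from right to left in each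
carrel. -/
noncomputable def tupleOfShapes (n : ℕ) (q : ℕ → ℕ) (μ : ℕ → YoungDiagram) : ℕ → ℕ := fun i =>
  if 1 ≤ i ∧ i ≤ n then i + (μ (sInf {h | i ≤ q h})).rowLen (q (sInf {h | i ≤ q h}) - i) else 0

theorem tupleOfShapes_apply (E : CarrelEnum n r q) (μ : ℕ → YoungDiagram) {h i : ℕ} (h1 : 1 ≤ h)
    (h2 : h ≤ r + 1) (hi : q (h - 1) < i) (hi' : i ≤ q h) :
    tupleOfShapes n q μ i = i + (μ h).rowLen (q h - i) := by
  have hs : sInf {h | i ≤ q h} = h := by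
    refine le_antisymm (Nat.sInf_le hi') ?_
    have hm : sInf {h | i ≤ q h} ∈ {h | i ≤ q h} := Nat.sInf_mem ⟨h, hi'⟩
    exact E.carrel_le h1 hi le_rfl hm h2
  have := E.le_top h2
  rw [tupleOfShapes, if_pos ⟨by omega, by omega⟩, hs]

/-- The rows of `μ h`, from last to first, are the differences `γ i - i` along the carrel. The last
row length `ℓ` of `μ (h + 1)` belongs to `q h + 1`, and its multiplicity `m` is the length of the
run of consecutive integers that starts there. The run ends at `q h + m` with value `q h + m + ℓ`,
so the row inequality says that it climbs to `γ (q h)`. -/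
theorem tupleOfShapes_bijOn (E : CarrelEnum n r q) :
    Set.BijOn (tupleOfShapes n q) (ShapeSequences n r q) (Gapless n r q) := by
  refine ⟨fun μ hμ => ?_, fun μ hμ μ' hμ' he => ?_, fun γ hγ => ?_⟩
  · obtain ⟨hμ0, hμ1, hμ2⟩ := hμ
    have happ := fun h i => tupleOfShapes_apply E μ (h := h) (i := i)
    have hlast : ∀ a, (μ (r + 1)).rowLen a = 0 := fun a => by
      rw [hμ0 (r + 1) (by omega)]
      by_contra hc
      exact YoungDiagram.notMem_bot _ (YoungDiagram.mem_iff_lt_rowLen.2 (Nat.pos_of_ne_zero hc))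
    have hUI : tupleOfShapes n q μ ∈ UpperIncreasing n r q := by
      refine ⟨⟨⟨fun i h1 h2 => ?_, fun i hi => ?_⟩, fun i h1 h2 => ?_⟩, ?_⟩
      · obtain ⟨h, ha, hb, hc, hd⟩ := E.exists_carrel h1 h2
        rw [happ h i ha hb hc hd]
        refine ⟨by omega, ?_⟩
        by_cases hr : h ≤ r
        · have := rowLen_le_of (hμ1 h ha hr) (q h - i)
          have := E.lt_top hr
          omega
        · obtain rfl : h = r + 1 := by omega
          rw [hlast]; omega
      · rw [tupleOfShapes, if_neg hi]
      · obtain ⟨h, ha, hb, hc, hd⟩ := E.exists_carrel h1 h2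
        rw [happ h i ha hb hc hd]
        omega
      · rintro h h1 h2 i ⟨hi, hi'⟩ j ⟨hj, hj'⟩ hij
        rw [happ h i h1 h2 hi hi', happ h j h1 h2 hj hj']
        have := (μ h).rowLen_anti (q h - j) (q h - i) (by omega)
        omega
    rw [mem_gapless_iff E hUI]
    intro h h1 h2
    have hlt := E.lt_succ h h2
    rw [colMax_eq_self hUI.2 (h := h + 1) (by omega) (by omega) (by simp) (by omega)]
    rw [happ h (q h) h1 (by omega) (E.pred_lt h1 (by omega)) le_rfl, Nat.sub_self,
      happ (h + 1) (q h + 1) (by omega) (by omega) (by simp) hlt]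
    set p := q (h + 1) - q h with hp
    set m := ((Finset.range p).filter fun i =>
      (μ (h + 1)).rowLen i = (μ (h + 1)).rowLen (p - 1)).card with hm
    rw [show q (h + 1) - (q h + 1) = p - 1 by omega]
    have hmp : m ≤ p := (Finset.card_filter_le _ _).trans (Finset.card_range p).le
    have hm1 : 1 ≤ m := by
      have := (rowLen_eq_iff_of_card (μ := μ (h + 1)) (p := p) (p - 1) (by omega)).1 rfl
      omega
    have hrow := (rowLen_eq_iff_of_card (μ := μ (h + 1)) (p := p) (p - m) (by omega)).2 le_rfl
    have hx := happ (h + 1) (q h + m) (by omega) (by omega) (by simp; omega) (by omega)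
    rw [show q (h + 1) - (q h + m) = p - m by omega, hrow] at hx
    refine ⟨q h + m, by omega, by omega, ?_, by omega⟩
    rw [hx]
    by_cases hr : h + 1 ≤ r
    · have := hμ2 h h1 hr
      rw [← hp, ← hm] at this
      omega
    -- No shape inequality is imposed for `h = r`. There the next carrel carries the identity, so
    -- the run is the whole carrel and ends with the largest value `n`.
    · obtain rfl : h = r := by omega
      have hpm : m = p := by
        rw [hm, Finset.filter_true_of_mem, Finset.card_range]
        intro i _
        rw [hlast, hlast]
      have := rowLen_le_of (hμ1 h h1 h2) 0
      have := E.top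
      omega
  · funext h
    by_cases hh : 1 ≤ h ∧ h ≤ r
    · apply youngDiagram_ext_rowLen
      intro a
      by_cases ha : a < q h - q (h - 1)
      · have h1 := tupleOfShapes_apply E μ (h := h) (i := q h - a) hh.1 (by omega) (by omega)
          (by omega)
        have h2 := tupleOfShapes_apply E μ' (h := h) (i := q h - a) hh.1 (by omega) (by omega)
          (by omega)
        rw [he] at h1
        rw [show q h - (q h - a) = a by omega] at h1 h2
        omega
      · rw [rowLen_eq_zero_of (hμ.2.1 h hh.1 hh.2) (by omega),
          rowLen_eq_zero_of (hμ'.2.1 h hh.1 hh.2) (by omega)]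
    · rw [hμ.1 h hh, hμ'.1 h hh]
  · classical
    have hanti : ∀ h, 1 ≤ h ∧ h ≤ r → ∀ a b, a ≤ b → b < q h - q (h - 1) →
        γ (q h - b) - (q h - b) ≤ γ (q h - a) - (q h - a) := by
      intro h hh a b hab hb
      have h1 := rIncreasing_add_le hγ.1.2 (h := h) (i := q h - b) (j := q h - a) hh.1 (by omega)
        (by omega) (by omega) (by omega)
      have := E.le_top (h := h) (by omega)
      have := hγ.1.1.2 (q h - b) (by omega) (by omega)
      omega
    set μ : ℕ → YoungDiagram := fun h =>
      if hh : 1 ≤ h ∧ h ≤ r then diagramOf (q h - q (h - 1)) (fun a => γ (q h - a) - (q h - a))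
        (hanti h hh) else ⊥ with hμ
    have hμin : ∀ h (hh : 1 ≤ h ∧ h ≤ r), μ h = diagramOf (q h - q (h - 1))
        (fun a => γ (q h - a) - (q h - a)) (hanti h hh) := fun h hh => by
      simp only [hμ]; rw [dif_pos hh]
    have hμout : ∀ h, ¬ (1 ≤ h ∧ h ≤ r) → μ h = ⊥ := fun h hh => by
      simp only [hμ]; rw [dif_neg hh]
    have hrow : ∀ h a, 1 ≤ h → h ≤ r → a < q h - q (h - 1) →
        (μ h).rowLen a = γ (q h - a) - (q h - a) := by
      intro h a h1 h2 ha
      rw [hμin h ⟨h1, h2⟩, rowLen_diagramOf ha]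
    have he : tupleOfShapes n q μ = γ := by
      funext i
      by_cases hi : 1 ≤ i ∧ i ≤ n
      · obtain ⟨h, ha, hb, hc, hd⟩ := E.exists_carrel hi.1 hi.2
        rw [tupleOfShapes_apply E μ ha hb hc hd]
        by_cases hr : h ≤ r
        · rw [hrow h _ ha hr (by omega), show q h - (q h - i) = i by omega]
          have := hγ.1.1.2 i hi.1 hi.2
          omega
        · obtain rfl : h = r + 1 := by omega
          rw [upperIncreasing_last E hγ.1 (by simpa using hc) hi.2, hμout _ (by omega)]
          have : (⊥ : YoungDiagram).rowLen (q (r + 1) - i) = 0 := by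
            by_contra hc
            exact YoungDiagram.notMem_bot _
              (YoungDiagram.mem_iff_lt_rowLen.2 (Nat.pos_of_ne_zero hc))
          omega
      · rw [tupleOfShapes, if_neg hi, hγ.1.1.1.2 i hi]
    refine ⟨μ, ⟨hμout, fun h h1 h2 c hc => ?_, fun h h1 h2 => ?_⟩, he⟩
    · obtain ⟨a, b⟩ := c
      rw [hμin h ⟨h1, h2⟩, mem_diagramOf] at hc
      refine ⟨hc.1, hc.2.trans_le ?_⟩
      have h3 := rIncreasing_add_le hγ.1.2 (h := h) (i := q h - a) (j := q h) h1 (by omega)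
        (by omega) (by omega) le_rfl
      have := E.le_top (h := h) (by omega)
      have := E.one_le (h := h) h1 (by omega)
      have := (hγ.1.1.1.1 (q h) (by omega) (by omega)).2
      change γ (q h - a) - (q h - a) ≤ n - q h
      omega
    · obtain ⟨x, hx1, hx2, hx3, hx4⟩ := gapless_flagLike E hγ h h1 (by omega)
      have hlt := E.lt_succ h (by omega)
      have hlt' := E.pred_lt (h := h) h1 (by omega)
      rw [colMax_eq_self hγ.1.2 (h := h + 1) (by omega) (by omega) (by simp) (by omega)] at hx4
      set p := q (h + 1) - q h with hp
      have hsub : q (h + 1) - q (h + 1 - 1) = p := by simp [hp]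
      set m := ((Finset.range p).filter fun i =>
        (μ (h + 1)).rowLen i = (μ (h + 1)).rowLen (p - 1)).card with hm
      have e0 := hrow h 0 h1 (by omega) (by omega)
      have e1 := hrow (h + 1) (p - 1) (by omega) h2 (by omega)
      have e2 := hrow (h + 1) (q (h + 1) - x) (by omega) h2 (by omega)
      rw [show q (h + 1) - (p - 1) = q h + 1 by omega] at e1
      rw [show q (h + 1) - (q (h + 1) - x) = x by omega] at e2
      rw [Nat.sub_zero] at e0
      have hqn := E.le_top (h := h + 1) (by omega)
      have hu1 := hγ.1.1.2 (q h + 1) (by omega) (by omega)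
      -- The row of the minimiser `x` has the length of the last row, so `x` lies in the initial
      -- run: `x ≤ q h + m`.
      have := (rowLen_eq_iff_of_card (μ := μ (h + 1)) (p := p) (q (h + 1) - x) (by omega)).1
        (by omega)
      omega

/-! ### Equivalence classes of bounds -/

/-- The core is the largest increasing tuple under `β`. -/
theorem below_eq_iff (E : CarrelEnum n r q) {β β' : ℕ → ℕ} (hβ : β ∈ Upper n)
    (hβ' : β' ∈ Upper n) : below n r q β = below n r q β' ↔ core n r q β = core n r q β' := by
  have hle : ∀ β ∈ Upper n, ∀ ε ∈ UpperIncreasing n r q, (∀ i, 1 ≤ i → i ≤ n → ε i ≤ β i) ↔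
      ∀ i, 1 ≤ i → i ≤ n → ε i ≤ core n r q β i := by
    intro β hβ ε hε
    refine ⟨fun h i h1 h2 => ?_, fun h i h1 h2 => (h i h1 h2).trans (core_le_self E hβ i h1 h2)⟩
    obtain ⟨g, ha, hb, hc, hd⟩ := E.exists_carrel h1 h2
    rw [core_eq_colMax E hβ ha hb hc hd]
    exact le_colMax hd fun x hx hx' =>
      (rIncreasing_add_le hε.2 ha hb hc hx hx').trans (h x (by omega) (hx'.trans (E.le_top hb)))
  constructor
  · intro h
    have key : ∀ β ∈ Upper n, ∀ β' ∈ Upper n, below n r q β = below n r q β' →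
        ∀ i, 1 ≤ i → i ≤ n → core n r q β i ≤ core n r q β' i := by
      intro β hβ β' hβ' h
      have hc := core_mem_upperIncreasing E hβ
      have : core n r q β ∈ below n r q β' := by
        rw [← h]; exact ⟨hc, core_le_self E hβ⟩
      exact (hle β' hβ' _ hc).1 this.2
    exact Tuples.ext (core_mem_upperIncreasing E hβ).1.1 (core_mem_upperIncreasing E hβ').1.1
      fun i h1 h2 => le_antisymm (key β hβ β' hβ' h i h1 h2) (key β' hβ' β hβ h.symm i h1 h2)
  · intro h
    ext ε
    refine and_congr_right fun hε => ?_
    exact (hle β hβ ε hε).trans (by rw [h]; exact (hle β' hβ' ε hε).symm)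

end lists

/-! ### Counting classes and images -/

theorem ncard_classesOf {α : Type*} (U : Set (ℕ → ℕ)) (f : (ℕ → ℕ) → α) :
    (classesOf U f).ncard = (f '' U).ncard := by
  have : classesOf U f = (fun a => {β' | β' ∈ U ∧ f β' = a}) '' (f '' U) := by
    ext c
    constructor
    · rintro ⟨β, hβ, rfl⟩
      exact ⟨f β, ⟨β, hβ, rfl⟩, rfl⟩
    · rintro ⟨_, ⟨β, hβ, rfl⟩, rfl⟩
      exact ⟨β, hβ, rfl⟩
  rw [this]
  refine Set.InjOn.ncard_image ?_
  rintro _ ⟨β, hβ, rfl⟩ _ ⟨β', hβ', rfl⟩ h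
  have : β ∈ {b | b ∈ U ∧ f b = f β'} := by
    rw [← show {b | b ∈ U ∧ f b = f β} = {b | b ∈ U ∧ f b = f β'} from h]; exact ⟨hβ, rfl⟩
  exact this.2

/-- Images under two maps with the same fibres have the same cardinality. -/
theorem ncard_image_eq_of_fibres {α β γ : Type*} {U : Set α} {f : α → β} {g : α → γ}
    (h : ∀ x ∈ U, ∀ y ∈ U, f x = f y ↔ g x = g y) : (f '' U).ncard = (g '' U).ncard := by
  classical
  rcases U.eq_empty_or_nonempty with rfl | ⟨x0, -⟩
  · simp
  have hex : ∀ b, ∃ x, b ∈ f '' U → x ∈ U ∧ f x = b := fun b => by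
    by_cases hb : b ∈ f '' U
    · obtain ⟨x, hx, rfl⟩ := hb
      exact ⟨x, fun _ => ⟨hx, rfl⟩⟩
    · exact ⟨x0, fun h => absurd h hb⟩
  choose s hs using hex
  have : g '' U = (fun b => g (s b)) '' (f '' U) := by
    ext c
    constructor
    · rintro ⟨x, hx, rfl⟩
      have := hs (f x) ⟨x, hx, rfl⟩
      exact ⟨f x, ⟨x, hx, rfl⟩, (h _ this.1 _ hx).1 this.2⟩
    · rintro ⟨b, hb, rfl⟩
      exact ⟨s b, (hs b hb).1, rfl⟩
  rw [this]
  refine (Set.InjOn.ncard_image ?_).symm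
  intro b hb b' hb' he
  rw [← (hs b hb).2, ← (hs b' hb').2]
  exact (h _ (hs b hb).1 _ (hs b' hb').1).2 he

section chains

variable {n r : ℕ} {q : ℕ → ℕ}

/-! ### Permutations, ordered partitions and chains -/

theorem sInf_carrel_eq (E : CarrelEnum n r q) {h i : ℕ} (h1 : 1 ≤ h)
    (h2 : h ≤ r + 1) (hi : q (h - 1) < i) (hi' : i ≤ q h) : sInf {h | i ≤ q h} = h := by
  refine le_antisymm (Nat.sInf_le hi') ?_
  have hm : sInf {h | i ≤ q h} ∈ {h | i ≤ q h} := Nat.sInf_mem ⟨h, hi'⟩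
  exact E.carrel_le h1 hi le_rfl hm h2

/-- The sets of values of a tuple on the carrels. -/
noncomputable def blocksOf (r : ℕ) (q : ℕ → ℕ) (π : ℕ → ℕ) : ℕ → Finset ℕ := fun h =>
  if 1 ≤ h ∧ h ≤ r + 1 then (Finset.Ioc (q (h - 1)) (q h)).image π else ∅

theorem blocksOf_apply (π : ℕ → ℕ) {h : ℕ} (h1 : 1 ≤ h) (h2 : h ≤ r + 1) :
    blocksOf r q π h = (Finset.Ioc (q (h - 1)) (q h)).image π := if_pos ⟨h1, h2⟩

theorem RPerms.image_eq {π : ℕ → ℕ} (hπ : π ∈ RPerms n r q) :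
    (Finset.Icc 1 n).image π = Finset.Icc 1 n := by
  apply Finset.eq_of_subset_of_card_le
  · intro x hx
    rw [Finset.mem_image] at hx
    obtain ⟨i, hi, rfl⟩ := hx
    rw [Finset.mem_Icc] at hi ⊢
    exact hπ.1.1 i hi.1 hi.2
  · rw [Finset.card_image_of_injOn]
    simpa using hπ.2.1

theorem card_blocksOf (E : CarrelEnum n r q) {π : ℕ → ℕ} (hπ : π ∈ RPerms n r q) {h : ℕ}
    (h1 : 1 ≤ h) (h2 : h ≤ r + 1) : (blocksOf r q π h).card = q h - q (h - 1) := by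
  rw [blocksOf_apply π h1 h2, Finset.card_image_of_injOn, Nat.card_Ioc]
  intro a ha b hb
  simp only [Finset.coe_Ioc, Set.mem_Ioc] at ha hb
  have := E.le_top h2
  exact hπ.2.1 ⟨by omega, by omega⟩ ⟨by omega, by omega⟩

theorem RPerms.eq_srt (E : CarrelEnum n r q) {π : ℕ → ℕ} (hπ : π ∈ RPerms n r q) {h i : ℕ}
    (h1 : 1 ≤ h) (h2 : h ≤ r + 1) (hi : q (h - 1) < i) (hi' : i ≤ q h) :
    π i = srt (blocksOf r q π h) (i - q (h - 1)) := by
  have hc := card_blocksOf E hπ h1 h2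
  have := eq_srt_of_strict (B := blocksOf r q π h) (f := fun k => π (q (h - 1) + k))
    (i := i - q (h - 1)) ?_ ?_ (by omega) (by omega)
  · rwa [show q (h - 1) + (i - q (h - 1)) = i by omega] at this
  · intro a b ha hab hb
    exact hπ.2.2 h h1 h2 ⟨by omega, by omega⟩ ⟨by omega, by omega⟩ (by omega)
  · intro a ha hb
    rw [blocksOf_apply π h1 h2]
    exact Finset.mem_image_of_mem _ (Finset.mem_Ioc.2 ⟨by omega, by omega⟩)

/-- An `R`-permutation lists each of its blocks in increasing order, so the blocks determine it and
are arbitrary. -/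
theorem blocksOf_bijOn (E : CarrelEnum n r q) :
    Set.BijOn (blocksOf r q) (RPerms n r q) (OrderedPartitions n r q) := by
  refine ⟨fun π hπ => ⟨fun h h1 h2 => card_blocksOf E hπ h1 h2, fun h hh => if_neg hh,
    fun g h hgh => ?_, ?_⟩, fun π hπ π' hπ' he => ?_, fun C hC => ?_⟩
  · by_cases hg : 1 ≤ g ∧ g ≤ r + 1
    · by_cases hh : 1 ≤ h ∧ h ≤ r + 1
      · rw [blocksOf_apply π hg.1 hg.2, blocksOf_apply π hh.1 hh.2, Finset.disjoint_left]
        intro x hx hx'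
        simp only [Finset.mem_image, Finset.mem_Ioc] at hx hx'
        obtain ⟨i, hi, rfl⟩ := hx
        obtain ⟨j, hj, hij⟩ := hx'
        have := E.le_top hg.2
        have := E.le_top hh.2
        obtain rfl := hπ.2.1 (show j ∈ Set.Icc 1 n from ⟨by omega, by omega⟩)
          (show i ∈ Set.Icc 1 n from ⟨by omega, by omega⟩) hij
        exact hgh (E.carrel_unique hg.1 hg.2 hh.1 hh.2 hi hj)
      · rw [show blocksOf r q π h = ∅ from if_neg hh]; simp
    · rw [show blocksOf r q π g = ∅ from if_neg hg]; simp
  · rw [← RPerms.image_eq hπ]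
    ext x
    simp only [Finset.mem_biUnion, Finset.mem_image, Finset.mem_Icc]
    constructor
    · rintro ⟨h, ⟨h1, h2⟩, hx⟩
      rw [blocksOf_apply π h1 h2, Finset.mem_image] at hx
      obtain ⟨i, hi, rfl⟩ := hx
      rw [Finset.mem_Ioc] at hi
      have := E.le_top h2
      exact ⟨i, ⟨by omega, by omega⟩, rfl⟩
    · rintro ⟨i, ⟨h1, h2⟩, rfl⟩
      obtain ⟨h, ha, hb, hc, hd⟩ := E.exists_carrel h1 h2
      refine ⟨h, ⟨ha, hb⟩, ?_⟩
      rw [blocksOf_apply π ha hb]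
      exact Finset.mem_image_of_mem _ (Finset.mem_Ioc.2 ⟨hc, hd⟩)
  · refine Tuples.ext hπ.1 hπ'.1 fun i h1 h2 => ?_
    obtain ⟨h, ha, hb, hc, hd⟩ := E.exists_carrel h1 h2
    rw [RPerms.eq_srt E hπ ha hb hc hd, RPerms.eq_srt E hπ' ha hb hc hd, he]
  · obtain ⟨hcard, hout, hdisj, hun⟩ := hC
    set π : ℕ → ℕ := fun i => if 1 ≤ i ∧ i ≤ n then
      srt (C (sInf {h | i ≤ q h})) (i - q (sInf {h | i ≤ q h} - 1)) else 0 with hπ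
    have happ : ∀ h i, 1 ≤ h → h ≤ r + 1 → q (h - 1) < i → i ≤ q h →
        π i = srt (C h) (i - q (h - 1)) := by
      intro h i h1 h2 hi hi'
      have := E.le_top h2
      simp only [hπ]
      rw [if_pos ⟨by omega, by omega⟩, sInf_carrel_eq E h1 h2 hi hi']
    have hmem : ∀ h i, 1 ≤ h → h ≤ r + 1 → q (h - 1) < i → i ≤ q h → π i ∈ C h := by
      intro h i h1 h2 hi hi'
      rw [happ h i h1 h2 hi hi']
      exact srt_mem (by omega) (by rw [hcard h h1 h2]; omega)
    have hmono : ∀ h, 1 ≤ h → h ≤ r + 1 → StrictMonoOn π (Set.Ioc (q (h - 1)) (q h)) := by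
      rintro h h1 h2 i ⟨hi, hi'⟩ j ⟨hj, hj'⟩ hij
      rw [happ h i h1 h2 hi hi', happ h j h1 h2 hj hj']
      exact srt_lt (by omega) (by omega) (by rw [hcard h h1 h2]; omega)
    have hR : π ∈ RPerms n r q := by
      refine ⟨⟨fun i h1 h2 => ?_, fun i hi => by simp only [hπ]; rw [if_neg hi]⟩, ?_, hmono⟩
      · obtain ⟨h, ha, hb, hc, hd⟩ := E.exists_carrel h1 h2
        rw [← Finset.mem_Icc, ← hun, Finset.mem_biUnion]
        exact ⟨h, Finset.mem_Icc.2 ⟨ha, hb⟩, hmem h i ha hb hc hd⟩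
      · rintro i ⟨hi, hi'⟩ j ⟨hj, hj'⟩ hij
        obtain ⟨h, ha, hb, hc, hd⟩ := E.exists_carrel hi hi'
        obtain ⟨g, ha', hb', hc', hd'⟩ := E.exists_carrel hj hj'
        have hgh : h = g := by
          by_contra hne
          refine Finset.disjoint_left.1 (hdisj h g hne) (hmem h i ha hb hc hd) ?_
          rw [hij]
          exact hmem g j ha' hb' hc' hd'
        subst hgh
        exact (hmono h ha hb).injOn ⟨hc, hd⟩ ⟨hc', hd'⟩ hij
    refine ⟨π, hR, ?_⟩
    funext h
    by_cases hh : 1 ≤ h ∧ h ≤ r + 1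
    · apply Finset.eq_of_subset_of_card_le
      · rw [blocksOf_apply π hh.1 hh.2]
        intro x hx
        rw [Finset.mem_image] at hx
        obtain ⟨i, hi, rfl⟩ := hx
        rw [Finset.mem_Ioc] at hi
        exact hmem h i hh.1 hh.2 hi.1 hi.2
      · rw [card_blocksOf E hR hh.1 hh.2, hcard h hh.1 hh.2]
    · rw [show blocksOf r q π h = ∅ from if_neg hh, hout h hh]

/-- The sets of values of a tuple on the unions of initial carrels. -/
noncomputable def chainOf (r : ℕ) (q : ℕ → ℕ) (π : ℕ → ℕ) : ℕ → Finset ℕ := fun h =>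
  if h ≤ r + 1 then (Finset.Icc 1 (q h)).image π else ∅

theorem chainOf_apply (π : ℕ → ℕ) {h : ℕ} (h2 : h ≤ r + 1) :
    chainOf r q π h = (Finset.Icc 1 (q h)).image π := if_pos h2

theorem card_chainOf (E : CarrelEnum n r q) {π : ℕ → ℕ} (hπ : π ∈ RPerms n r q) {h : ℕ}
    (h2 : h ≤ r + 1) : (chainOf r q π h).card = q h := by
  rw [chainOf_apply π h2, Finset.card_image_of_injOn, Nat.card_Icc, Nat.add_sub_cancel]
  intro a ha b hb
  simp only [Finset.coe_Icc, Set.mem_Icc] at ha hb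
  have := E.le_top h2
  exact hπ.2.1 ⟨by omega, by omega⟩ ⟨by omega, by omega⟩

/-- Basic properties of chains. -/
theorem RChains.props (E : CarrelEnum n r q) {B : ℕ → Finset ℕ} (hB : B ∈ RChains n r q) :
    (∀ h, h ≤ r + 1 → (B h).card = q h) ∧ (∀ g h, g ≤ h → h ≤ r + 1 → B g ⊆ B h) ∧
      ∀ h, h ≤ r + 1 → B h ⊆ Finset.Icc 1 n := by
  obtain ⟨h0, hn, hs, hc, -⟩ := hB
  have hsub : ∀ g h, g ≤ h → h ≤ r + 1 → B g ⊆ B h := by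
    intro g h hgh
    induction h, hgh using Nat.le_induction with
    | base => exact fun _ => Finset.Subset.refl _
    | succ h hgh ih => exact fun hh => (ih (by omega)).trans (hs h (by omega)).1
  refine ⟨fun h hh => ?_, hsub, fun h hh => hn ▸ hsub h (r + 1) hh le_rfl⟩
  rcases Nat.eq_zero_or_pos h with rfl | hpos
  · rw [h0, E.zero]; rfl
  · rcases hh.eq_or_lt with rfl | hlt
    · rw [hn, E.top]; simp
    · exact hc h hpos (by omega)

/-- The blocks are the successive differences of the chain, which reduces the claim to ordered
partitions. -/
theorem chainOf_bijOn (E : CarrelEnum n r q) :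
    Set.BijOn (chainOf r q) (RPerms n r q) (RChains n r q) := by
  have hdiff : ∀ π ∈ RPerms n r q, ∀ h, 1 ≤ h → h ≤ r + 1 →
      blocksOf r q π h = chainOf r q π h \ chainOf r q π (h - 1) := by
    intro π hπ h h1 h2
    have hlt := E.pred_lt h1 h2
    have hle := E.le_top h2
    rw [blocksOf_apply π h1 h2, chainOf_apply π h2, chainOf_apply π (by omega)]
    ext x
    simp only [Finset.mem_image, Finset.mem_sdiff, Finset.mem_Icc, Finset.mem_Ioc]
    constructor
    · rintro ⟨i, hi, rfl⟩
      refine ⟨⟨i, ⟨by omega, hi.2⟩, rfl⟩, ?_⟩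
      rintro ⟨j, hj, hij⟩
      have := hπ.2.1 (show j ∈ Set.Icc 1 n from ⟨by omega, by omega⟩)
        (show i ∈ Set.Icc 1 n from ⟨by omega, by omega⟩) hij
      omega
    · rintro ⟨⟨i, hi, rfl⟩, hn⟩
      refine ⟨i, ⟨?_, hi.2⟩, rfl⟩
      by_contra hc
      exact hn ⟨i, ⟨hi.1, not_lt.1 hc⟩, rfl⟩
  refine ⟨fun π hπ => ⟨?_, ?_, fun h hh => ?_, fun h h1 h2 => card_chainOf E hπ (by omega),
    fun h hh => if_neg (by omega)⟩, fun π hπ π' hπ' he => ?_, fun B hB => ?_⟩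
  · rw [chainOf_apply π (by omega), E.zero]; simp
  · rw [chainOf_apply π le_rfl, E.top]; exact RPerms.image_eq hπ
  · have hlt := E.lt_succ h hh
    refine (Finset.ssubset_iff_subset_ne).2 ⟨?_, fun he => ?_⟩
    · rw [chainOf_apply π (by omega), chainOf_apply π (by omega)]
      exact Finset.image_subset_image (Finset.Icc_subset_Icc le_rfl hlt.le)
    · have h1 := card_chainOf E hπ (h := h) (by omega)
      rw [he, card_chainOf E hπ (by omega)] at h1
      omega
  · refine (blocksOf_bijOn E).injOn hπ hπ' ?_
    funext h
    by_cases hh : 1 ≤ h ∧ h ≤ r + 1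
    · rw [hdiff π hπ h hh.1 hh.2, hdiff π' hπ' h hh.1 hh.2, he]
    · rw [show blocksOf r q π h = ∅ from if_neg hh, show blocksOf r q π' h = ∅ from if_neg hh]
  · obtain ⟨hcard, hsub, hIcc⟩ := RChains.props E hB
    classical
    set C : ℕ → Finset ℕ := fun h => if 1 ≤ h ∧ h ≤ r + 1 then B h \ B (h - 1) else ∅ with hC
    have hCin : ∀ h, 1 ≤ h → h ≤ r + 1 → C h = B h \ B (h - 1) := fun h h1 h2 => by
      simp only [hC]; rw [if_pos ⟨h1, h2⟩]
    have hCout : ∀ h, ¬ (1 ≤ h ∧ h ≤ r + 1) → C h = ∅ := fun h hh => by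
      simp only [hC]; rw [if_neg hh]
    have hCO : C ∈ OrderedPartitions n r q := by
      refine ⟨fun h h1 h2 => ?_, hCout, fun g h hgh => ?_, ?_⟩
      · rw [hCin h h1 h2, Finset.card_sdiff_of_subset (hsub _ _ (by omega) h2), hcard h h2,
          hcard _ (by omega)]
      · have key : ∀ g h, g < h → Disjoint (C g) (C h) := by
          intro g h hgh
          by_cases hg : 1 ≤ g ∧ g ≤ r + 1
          · by_cases hh : 1 ≤ h ∧ h ≤ r + 1
            · rw [hCin g hg.1 hg.2, hCin h hh.1 hh.2, Finset.disjoint_left]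
              intro x hx hx'
              rw [Finset.mem_sdiff] at hx hx'
              exact hx'.2 (hsub g (h - 1) (by omega) (by omega) hx.1)
            · rw [hCout h hh]; simp
          · rw [hCout g hg]; simp
        rcases lt_or_gt_of_ne hgh with h' | h'
        · exact key g h h'
        · exact (key h g h').symm
      · have hunion : ∀ m, m ≤ r + 1 → (Finset.Icc 1 m).biUnion C = B m := by
          intro m
          induction m with
          | zero => intro _; rw [hB.1]; simp
          | succ m ih =>
            intro hm
            rw [← Finset.insert_Icc_right_eq_Icc_add_one (by omega), Finset.biUnion_insert,
              ih (by omega), hCin (m + 1) (by omega) hm, Nat.add_sub_cancel]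
            exact Finset.sdiff_union_of_subset (hsub _ _ (by omega) hm)
        rw [hunion (r + 1) le_rfl, hB.2.1]
    obtain ⟨π, hπ, hπC⟩ := (blocksOf_bijOn E).surjOn hCO
    refine ⟨π, hπ, ?_⟩
    funext h
    by_cases hh : h ≤ r + 1
    · symm
      apply Finset.eq_of_subset_of_card_le
      · clear hCO
        intro x hx
        -- At the first set that contains `x`, this element belongs to the difference, hence to a
        -- block.
        have hex : ∃ h, x ∈ B h := ⟨h, hx⟩
        have hg := Nat.find_spec hex
        have hgh : Nat.find hex ≤ h := Nat.find_le hx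
        have hmin : ∀ k, k < Nat.find hex → x ∉ B k := fun k hk => Nat.find_min hex hk
        generalize Nat.find hex = g at *
        have hg1 : 1 ≤ g := by
          by_contra hc
          obtain rfl : g = 0 := by omega
          rw [hB.1] at hg
          simp at hg
        have : x ∈ blocksOf r q π g := by
          rw [hπC, hCin g hg1 (by omega), Finset.mem_sdiff]
          exact ⟨hg, hmin _ (by omega)⟩
        rw [hdiff π hπ g hg1 (by omega), Finset.mem_sdiff] at this
        have h1 := this.1
        rw [chainOf_apply π (by omega)] at h1 ⊢
        exact Finset.image_subset_image
          (Finset.Icc_subset_Icc le_rfl (E.mono hgh hh)) h1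
      · rw [card_chainOf E hπ hh, hcard h hh]
    · rw [show chainOf r q π h = ∅ from if_neg hh, hB.2.2.2.2 h (by omega)]

/-! ### Avoiding chains -/

/-- The chains whose `R`-permutation is `R`-312-avoiding. -/
def AvoidChains (n r : ℕ) (q : ℕ → ℕ) : Set (ℕ → Finset ℕ) :=
  {B | B ∈ RChains n r q ∧ ∀ h, 1 ≤ h → h ≤ r → ∀ a ∈ B h, ∀ b ∈ B (h + 1), b ∉ B h →
    ∀ c, b < c → c < a → c ∈ B (h + 1)}

/-- In a pattern `π a > π c > π b`, the value `π a` is in `B h`, the value `π b` is new in `B (h +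
1)`, and `π c` is still missing there. For `h = r` nothing is missing, so including that index
imposes nothing. -/
theorem not_contains312_iff (E : CarrelEnum n r q) {π : ℕ → ℕ} (hπ : π ∈ RPerms n r q) :
    ¬ Contains312 n r q π ↔ chainOf r q π ∈ AvoidChains n r q := by
  have hB := (chainOf_bijOn E).mapsTo hπ
  constructor
  · intro hn
    refine ⟨hB, fun h h1 h2 a ha b hb hb' c hbc hca => ?_⟩
    by_contra hc
    rw [chainOf_apply π (by omega), Finset.mem_image] at ha hb hb' hc
    obtain ⟨i, hi, rfl⟩ := ha
    obtain ⟨j, hj, rfl⟩ := hb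
    rw [Finset.mem_Icc] at hi hj
    have hqn := E.le_top (h := h) (by omega)
    have hπi := hπ.1.1 i hi.1 (by omega)
    have hcn : c ∈ Finset.Icc 1 n := Finset.mem_Icc.2 ⟨by omega, by omega⟩
    rw [← RPerms.image_eq hπ, Finset.mem_image] at hcn
    obtain ⟨k, hk, rfl⟩ := hcn
    rw [Finset.mem_Icc] at hk
    have hkq : q (h + 1) < k := by
      by_contra hcon
      exact hc ⟨k, Finset.mem_Icc.2 ⟨hk.1, not_lt.1 hcon⟩, rfl⟩
    have hjq : q h < j := by
      by_contra hcon
      exact hb' ⟨j, Finset.mem_Icc.2 ⟨hj.1, not_lt.1 hcon⟩, rfl⟩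
    have hhr : h + 1 ≤ r := by
      by_contra hcon
      obtain rfl : h = r := by omega
      rw [E.top] at hkq
      omega
    exact hn ⟨h, h1, hhr, i, j, k, hi.1, hi.2, hjq, hj.2, hkq, hk.2, by omega, by omega, by omega⟩
  · rintro hA ⟨h, h1, h2, i, j, k, hi, hi', hj, hj', hk, hk', h3, h4, h5⟩
    have hqn := E.le_top (h := h + 1) (by omega)
    have hinj : ∀ x y, 1 ≤ x → x ≤ n → 1 ≤ y → y ≤ n → π x = π y → x = y := fun x y a b c d e =>
      hπ.2.1 ⟨a, b⟩ ⟨c, d⟩ e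
    have := hA.2 h h1 (by omega) (π i) ?_ (π j) ?_ ?_ (π k) h4 h5
    · rw [chainOf_apply π (by omega), Finset.mem_image] at this
      obtain ⟨x, hx, hxk⟩ := this
      rw [Finset.mem_Icc] at hx
      have := hinj x k hx.1 (by omega) (by omega) hk' hxk
      omega
    · rw [chainOf_apply π (by omega)]
      exact Finset.mem_image_of_mem _ (Finset.mem_Icc.2 ⟨hi, hi'⟩)
    · rw [chainOf_apply π (by omega)]
      exact Finset.mem_image_of_mem _ (Finset.mem_Icc.2 ⟨by omega, hj'⟩)
    · rw [chainOf_apply π (by omega), Finset.mem_image]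
      rintro ⟨x, hx, hxj⟩
      rw [Finset.mem_Icc] at hx
      have := hinj x j hx.1 (by omega) (by omega) (by omega) hxj
      omega

theorem chainOf_bijOn_avoid (E : CarrelEnum n r q) :
    Set.BijOn (chainOf r q) (Avoid312 n r q) (AvoidChains n r q) := by
  refine ⟨fun π hπ => (not_contains312_iff E hπ.1).1 hπ.2,
    (chainOf_bijOn E).injOn.mono fun π hπ => hπ.1, fun B hB => ?_⟩
  obtain ⟨π, hπ, rfl⟩ := (chainOf_bijOn E).surjOn hB.1
  exact ⟨π, ⟨hπ, (not_contains312_iff E hπ).2 hB⟩, rfl⟩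

/-! ### Clumps and deletion -/

theorem exists_clump {Q : Finset ℕ} {a b : ℕ} (hab : a ≤ b) (h : Finset.Icc a b ⊆ Q) :
    ∃ L, IsClump Q L ∧ Finset.Icc a b ⊆ L := by
  have hfin : {L : Finset ℕ | L ⊆ Q ∧ ∃ a b, a ≤ b ∧ L = Finset.Icc a b}.Finite :=
    Q.powerset.finite_toSet.subset fun L hL => by
      simpa using hL.1
  obtain ⟨L, hL, hmax⟩ := hfin.exists_le_maximal (a := Finset.Icc a b) ⟨h, a, b, hab, rfl⟩
  exact ⟨L, hmax, hL⟩

/-- A clump that meets an interval of `Q` contains it. -/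
theorem IsClump.Icc_subset {Q L : Finset ℕ} (hL : IsClump Q L) {a b : ℕ}
    (h : Finset.Icc a b ⊆ Q) {x : ℕ} (hx : x ∈ L) (hxa : a ≤ x) (hxb : x ≤ b) :
    Finset.Icc a b ⊆ L := by
  obtain ⟨⟨hLQ, c, d, hcd, rfl⟩, hmax⟩ := hL
  rw [Finset.mem_Icc] at hx
  have hsub : Finset.Icc (min a c) (max b d) ⊆ Q := by
    intro y hy
    rw [Finset.mem_Icc] at hy
    by_cases hy' : c ≤ y ∧ y ≤ d
    · exact hLQ (Finset.mem_Icc.2 hy')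
    · exact h (Finset.mem_Icc.2 (by omega))
  have := hmax (y := Finset.Icc (min a c) (max b d)) ⟨hsub, _, _, by omega, rfl⟩
    (Finset.Icc_subset_Icc (min_le_right _ _) (le_max_right _ _))
  exact (Finset.Icc_subset_Icc (min_le_left _ _) (le_max_left _ _)).trans this

/-- A missing value between a removed `b` and a remaining `a` puts them into different clumps, that
of `b` to the left. So avoidance says that no remaining element lies in a clump to the right of one
with a removed element. -/
theorem clumpDeletingChains_eq (E : CarrelEnum n r q) :
    ClumpDeletingChains n r q = AvoidChains n r q := by
  ext B
  refine and_congr_right fun hB => ?_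
  obtain ⟨hcard, hsub, hIcc⟩ := RChains.props E hB
  refine forall_congr' fun h => forall_congr' fun h1 => forall_congr' fun h2 => ?_
  have hBB := hsub h (h + 1) (by omega) (by omega)
  constructor
  · rintro ⟨K, hK, hin, hout⟩ a ha b hb hb' c hbc hca
    by_contra hc
    obtain ⟨L, hL, hKL, hbL⟩ := hin b (Finset.mem_sdiff.2 ⟨hb, hb'⟩)
    obtain ⟨M, hM, haM⟩ := exists_clump (Q := B (h + 1)) (a := a) (b := a) le_rfl
      (by simpa using hBB ha)
    have haM' : a ∈ M := haM (by simp)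
    have hcL : ∀ x ∈ L, x < c := by
      intro x hx
      obtain ⟨⟨hLQ, u, v, huv, rfl⟩, -⟩ := hL
      rw [Finset.mem_Icc] at hx hbL
      by_contra hcx
      exact hc (hLQ (Finset.mem_Icc.2 ⟨by omega, by omega⟩))
    have hcM : ∀ x ∈ M, c < x := by
      intro x hx
      obtain ⟨⟨hMQ, u, v, huv, rfl⟩, -⟩ := hM
      rw [Finset.mem_Icc] at hx haM'
      by_contra hcx
      exact hc (hMQ (Finset.mem_Icc.2 ⟨by omega, by omega⟩))
    -- The clump `K` is weakly left of that of `b`, which lies below `c`, whereas `M` lies above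
    -- `c`. Hence `M` is removed entirely, although `a ∈ M` remains.
    have hKM : Before K M := by
      intro x hx y hy
      have hy' := hcM y hy
      rcases hKL with rfl | hKL
      · exact (hcL x hx).trans hy'
      · exact (hKL x hx b hbL).trans (hbc.trans hy')
    exact (Finset.mem_sdiff.1 (hout M hM hKM haM')).2 ha
  · intro hA
    have hne : (B (h + 1) \ B h).Nonempty := by
      rw [Finset.sdiff_nonempty]
      exact (hB.2.2.1 h h2).2
    -- The clump required is that of the smallest removed element.
    set b := (B (h + 1) \ B h).min' hne with hb
    have hbm := Finset.min'_mem _ hne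
    rw [← hb] at hbm
    have hbmin : ∀ x ∈ B (h + 1) \ B h, b ≤ x := fun x hx => Finset.min'_le _ x hx
    clear_value b
    rw [Finset.mem_sdiff] at hbm
    obtain ⟨K, hK, hbK⟩ := exists_clump (Q := B (h + 1)) (a := b) (b := b) le_rfl
      (by simpa using hbm.1)
    replace hbK : b ∈ K := hbK (by simp)
    refine ⟨K, hK, fun x hx => ?_, fun L hL hKL => ?_⟩
    · have hbx := hbmin x hx
      rw [Finset.mem_sdiff] at hx
      by_cases hI : Finset.Icc b x ⊆ B (h + 1)
      · exact ⟨K, hK, .inl rfl, hK.Icc_subset hI hbK le_rfl hbx (by simp [hbx])⟩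
      · obtain ⟨L, hL, hxL⟩ := exists_clump (Q := B (h + 1)) (a := x) (b := x) le_rfl
          (by simpa using hx.1)
        replace hxL : x ∈ L := hxL (by simp)
        refine ⟨L, hL, .inr fun y hy z hz => ?_, hxL⟩
        rw [Finset.not_subset] at hI
        obtain ⟨c, hc, hcB⟩ := hI
        rw [Finset.mem_Icc] at hc
        obtain ⟨⟨hKQ, u, v, huv, rfl⟩, -⟩ := hK
        obtain ⟨⟨hLQ, u', v', huv', rfl⟩, -⟩ := hL
        rw [Finset.mem_Icc] at hbK hxL hy hz
        have h3 : v < c := by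
          by_contra hcon
          exact hcB (hKQ (Finset.mem_Icc.2 ⟨by omega, by omega⟩))
        have h4 : c < u' := by
          by_contra hcon
          exact hcB (hLQ (Finset.mem_Icc.2 ⟨by omega, by omega⟩))
        omega
    · intro a ha
      have haB : a ∈ B (h + 1) := hL.1.1 ha
      rw [Finset.mem_sdiff]
      refine ⟨haB, fun haB' => ?_⟩
      have hba := hKL b hbK a ha
      have hI : Finset.Icc b a ⊆ B (h + 1) := by
        intro c hc
        rw [Finset.mem_Icc] at hc
        rcases hc.1.eq_or_lt with rfl | hlt
        · exact hbm.1
        · rcases hc.2.eq_or_lt with rfl | hlt'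
          · exact haB
          · exact hA a haB' b hbm.1 hbm.2 c hlt hlt'
      exact absurd (hKL a (hK.Icc_subset hI hbK le_rfl hba.le (by simp [hba.le])) a ha)
        (lt_irrefl a)

/-! ### Gapless tuples and avoiding chains -/

/-- The sets of values of the maximal columns bounded by `β`. -/
noncomputable def colMaxChain (r : ℕ) (q : ℕ → ℕ) (β : ℕ → ℕ) : ℕ → Finset ℕ := fun h =>
  if h ≤ r + 1 then (Finset.Icc 1 (q h)).image (colMax β (q h)) else ∅

theorem colMaxChain_apply (β : ℕ → ℕ) {h : ℕ} (h2 : h ≤ r + 1) :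
    colMaxChain r q β h = (Finset.Icc 1 (q h)).image (colMax β (q h)) := if_pos h2

theorem srt_colMaxChain (E : CarrelEnum n r q) {β : ℕ → ℕ} (hβ : β ∈ Upper n) {h i : ℕ}
    (h2 : h ≤ r + 1) (hi : 1 ≤ i) (hi' : i ≤ q h) :
    srt (colMaxChain r q β h) i = colMax β (q h) i := by
  rw [colMaxChain_apply β h2]
  exact srt_image_eq (fun i j h1 hij hj =>
    colMax_lt (Upper.le hβ (E.le_top h2)) h1 hij hj) hi hi'

theorem card_colMaxChain (E : CarrelEnum n r q) {β : ℕ → ℕ} (hβ : β ∈ Upper n) {h : ℕ}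
    (h2 : h ≤ r + 1) : (colMaxChain r q β h).card = q h := by
  rw [colMaxChain_apply β h2]
  exact card_image_of_strict fun i j h1 hij hj =>
    colMax_lt (Upper.le hβ (E.le_top h2)) h1 hij hj

/-- Lengthening a column leaves an entry alone or lowers it, and in the latter case the new column
rises by single steps from there to position `q h + 1`. By the flag condition the single steps
continue to at least `β (q h)`, a bound for the whole old column. So each value from a lowered or
new entry up to an old one occurs: this gives both the inclusion of the sets and the avoidance. -/
theorem colMaxChain_mem_avoidChains (E : CarrelEnum n r q) {β : ℕ → ℕ} (hβ : β ∈ Upper n)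
    (hF : IsFlagLike r q β) : colMaxChain r q β ∈ AvoidChains n r q := by
  have hmem : ∀ h i, h ≤ r + 1 → 1 ≤ i → i ≤ q h → colMax β (q h) i ∈ colMaxChain r q β h := by
    intro h i h2 hi hi'
    rw [colMaxChain_apply β h2]
    exact Finset.mem_image_of_mem _ (Finset.mem_Icc.2 ⟨hi, hi'⟩)
  have hex : ∀ h a, h ≤ r + 1 → a ∈ colMaxChain r q β h → ∃ i, 1 ≤ i ∧ i ≤ q h ∧
      colMax β (q h) i = a := by
    intro h a h2 ha
    rw [colMaxChain_apply β h2, Finset.mem_image] at ha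
    obtain ⟨i, hi, rfl⟩ := ha
    rw [Finset.mem_Icc] at hi
    exact ⟨i, hi.1, hi.2, rfl⟩
  -- The staircase inside the new carrel, up to the minimiser `x`.
  have L1 : ∀ h, 1 ≤ h → h ≤ r → ∀ v, colMax β (q (h + 1)) (q h + 1) ≤ v → v ≤ β (q h) →
      v ∈ colMaxChain r q β (h + 1) := by
    intro h h1 h2 v hv hv'
    obtain ⟨x, hx1, hx2, hx3, hx4⟩ := hF h h1 h2
    have hu := Upper.le hβ (E.le_top (show h + 1 ≤ r + 1 by omega))
    set t := v - colMax β (q (h + 1)) (q h + 1) with ht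
    have h3 := colMax_add_le_colMax hu (i := q h + 1) (j := q h + 1 + t) (by omega) (by omega)
      (by omega)
    have h4 := colMax_add_le hu (i := q h + 1 + t) (x := x) (by omega) (by omega) hx2
    have : v = colMax β (q (h + 1)) (q h + 1 + t) := by omega
    rw [this]
    exact hmem (h + 1) _ (by omega) (by omega) (by omega)
  -- The staircase from a lowered old entry to the first position of the new carrel.
  have L2 : ∀ h, 1 ≤ h → h ≤ r → ∀ i, 1 ≤ i → i ≤ q h →
      colMax β (q (h + 1)) i ≠ colMax β (q h) i → ∀ v, colMax β (q (h + 1)) i ≤ v →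
      v < colMax β (q (h + 1)) (q h + 1) → v ∈ colMaxChain r q β (h + 1) := by
    intro h h1 h2 i hi hi' hne v hv hv'
    have hu := Upper.le hβ (E.le_top (show h + 1 ≤ r + 1 by omega))
    have hlt := E.lt_succ h h2
    rcases colMax_eq_or hu hi hi' hlt with he | he
    · exact absurd he hne
    · set t := v - colMax β (q (h + 1)) i with ht
      have h3 := colMax_add_le_colMax hu (i := i) (j := i + t) (by omega) (by omega)
        (by omega)
      have h4 := colMax_add_le_colMax hu (i := i + t) (j := q h + 1) (by omega) (by omega)
        (by omega)
      have : v = colMax β (q (h + 1)) (i + t) := by omega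
      rw [this]
      exact hmem (h + 1) _ (by omega) (by omega) (by omega)
  have hmax : ∀ h, 1 ≤ h → h ≤ r → ∀ a ∈ colMaxChain r q β h, a ≤ β (q h) := by
    intro h h1 h2 a ha
    obtain ⟨i, hi, hi', rfl⟩ := hex h a (by omega) ha
    have := colMax_add_le (Upper.le hβ (E.le_top (h := h) (by omega))) hi hi' le_rfl
    omega
  have h0 : colMaxChain r q β 0 = ∅ := by
    rw [colMaxChain_apply β (by omega), E.zero]; simp
  refine ⟨⟨h0, ?_, fun h h2 => ?_, fun h h1 h2 => card_colMaxChain E hβ (by omega),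
    fun h hh => if_neg (by omega)⟩, fun h h1 h2 a ha b hb hb' c hbc hca => ?_⟩
  · apply Finset.eq_of_subset_of_card_le
    · intro a ha
      obtain ⟨i, hi, hi', rfl⟩ := hex (r + 1) a le_rfl ha
      have hu := Upper.le hβ (E.le_top (le_refl (r + 1)))
      have h3 := self_le_colMax hu hi hi'
      have h4 := colMax_le_self (β := β) hi'
      have h5 := (hβ.1.1 i hi (hi'.trans E.top.le)).2
      exact Finset.mem_Icc.2 ⟨by omega, by omega⟩
    · rw [card_colMaxChain E hβ le_rfl, E.top]; simp
  · have hlt := E.lt_succ h h2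
    refine (Finset.ssubset_iff_subset_ne).2 ⟨?_, fun he => ?_⟩
    · rcases Nat.eq_zero_or_pos h with rfl | h1
      · rw [h0]; exact Finset.empty_subset _
      · intro a ha
        have ham := hmax h h1 h2 a ha
        obtain ⟨i, hi, hi', rfl⟩ := hex h a (by omega) ha
        by_cases hge : colMax β (q (h + 1)) (q h + 1) ≤ colMax β (q h) i
        · exact L1 h h1 h2 _ hge ham
        · by_cases he : colMax β (q (h + 1)) i = colMax β (q h) i
          · rw [← he]
            exact hmem (h + 1) i (by omega) hi (by omega)
          · exact L2 h h1 h2 i hi hi' he _ (colMax_le_of_le hi' hlt.le) (not_le.1 hge)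
    · have h1 := card_colMaxChain E hβ (h := h) (by omega)
      rw [he, card_colMaxChain E hβ (by omega)] at h1
      omega
  · have ham := hmax h h1 h2 a ha
    by_cases hge : colMax β (q (h + 1)) (q h + 1) ≤ c
    · exact L1 h h1 h2 c hge (by omega)
    · obtain ⟨i, hi, hi', rfl⟩ := hex (h + 1) b (by omega) hb
      have hiq : i ≤ q h := by
        by_contra hcon
        have := colMax_add_le_colMax (Upper.le hβ (E.le_top (show h + 1 ≤ r + 1 by omega)))
          (i := q h + 1) (j := i) (by omega) (by omega) hi'
        omega
      refine L2 h h1 h2 i hi hiq (fun he => hb' ?_) c (by omega) (by omega)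
      rw [he]
      exact hmem h i (by omega) hi hiq

theorem colMaxChain_core (E : CarrelEnum n r q) {β : ℕ → ℕ} (hβ : β ∈ Upper n) :
    colMaxChain r q (core n r q β) = colMaxChain r q β := by
  funext h
  by_cases h2 : h ≤ r + 1
  · rw [colMaxChain_apply _ h2, colMaxChain_apply _ h2]
    refine Finset.image_congr fun i hi => ?_
    rw [Finset.coe_Icc] at hi
    exact colMax_core E hβ h2 hi.1 hi.2
  · rw [colMaxChain, colMaxChain, if_neg h2, if_neg h2]

/-- An avoiding chain is the chain of maximal columns of the gapless tuple formed by the last entries of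
its sets. -/
theorem avoidChain_eq_colMaxChain (E : CarrelEnum n r q) {B : ℕ → Finset ℕ}
    (hB : B ∈ AvoidChains n r q) : ∃ γ ∈ Gapless n r q, colMaxChain r q γ = B := by
  obtain ⟨hcard, hsub, hIcc⟩ := RChains.props E hB.1
  classical
  -- The infimum is the number of the carrel of `i`.
  set γ : ℕ → ℕ := fun i => if 1 ≤ i ∧ i ≤ n then srt (B (sInf {h | i ≤ q h})) i else 0 with hγ
  have happ : ∀ h i, 1 ≤ h → h ≤ r + 1 → q (h - 1) < i → i ≤ q h → γ i = srt (B h) i := by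
    intro h i h1 h2 hi hi'
    have := E.le_top h2
    simp only [hγ]
    rw [if_pos ⟨by omega, by omega⟩, sInf_carrel_eq E h1 h2 hi hi']
  have hrange : ∀ h i, h ≤ r + 1 → 1 ≤ i → i ≤ q h → 1 ≤ srt (B h) i ∧ srt (B h) i ≤ n := by
    intro h i h2 hi hi'
    exact Finset.mem_Icc.1 (hIcc h h2 (srt_mem hi (by rw [hcard h h2]; exact hi')))
  have hself : ∀ h i, h ≤ r + 1 → 1 ≤ i → i ≤ q h → i ≤ srt (B h) i := by
    intro h i h2 hi hi'
    have h3 := hrange h 1 h2 le_rfl (by omega)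
    have h4 := srt_add_le (B := B h) le_rfl hi (by rw [hcard h h2]; exact hi')
    omega
  have hUI : γ ∈ UpperIncreasing n r q := by
    refine ⟨⟨⟨fun i h1 h2 => ?_, fun i hi => by simp only [hγ]; rw [if_neg hi]⟩,
      fun i h1 h2 => ?_⟩, ?_⟩
    · obtain ⟨h, ha, hb, hc, hd⟩ := E.exists_carrel h1 h2
      rw [happ h i ha hb hc hd]
      exact hrange h i hb h1 hd
    · obtain ⟨h, ha, hb, hc, hd⟩ := E.exists_carrel h1 h2
      rw [happ h i ha hb hc hd]
      exact hself h i hb h1 hd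
    · rintro h h1 h2 i ⟨hi, hi'⟩ j ⟨hj, hj'⟩ hij
      rw [happ h i h1 h2 hi hi', happ h j h1 h2 hj hj']
      exact srt_lt (by omega) hij (by rw [hcard h h2]; exact hj')
  -- If some element up to position `i` is new, avoidance puts all values from the `i`-th element up
  -- to the maximum of `B h` into `B (h + 1)`. They occupy consecutive positions, so the maximum of
  -- `B h` sits at `x = i + (difference of the values)`.
  have J : ∀ h, 1 ≤ h → h ≤ r → ∀ i, 1 ≤ i → i ≤ q h + 1 →
      srt (B (h + 1)) i < srt (B h) (q h) → (∃ k, 1 ≤ k ∧ k ≤ i ∧ srt (B (h + 1)) k ∉ B h) →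
      ∃ x, i ≤ x ∧ q h < x ∧ x ≤ q (h + 1) ∧ srt (B (h + 1)) x = srt (B h) (q h) ∧
        srt (B (h + 1)) i + (x - i) = srt (B h) (q h) := by
    rintro h h1 h2 i hi hi' hlt ⟨k, hk1, hk2, hk3⟩
    have hlts := E.lt_succ h h2
    have hq1 := E.one_le h1 (by omega)
    have hc := hcard h (by omega)
    have hc' := hcard (h + 1) (by omega)
    have hBB := hsub h (h + 1) (by omega) (by omega)
    have haB : srt (B h) (q h) ∈ B h := srt_mem hq1 hc.ge
    have hbB : srt (B (h + 1)) k ∈ B (h + 1) := srt_mem hk1 (by omega)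
    have hbs : srt (B (h + 1)) k ≤ srt (B (h + 1)) i := srt_le hk1 hk2 (by omega)
    have hI : ∀ c, srt (B (h + 1)) i ≤ c → c ≤ srt (B h) (q h) → c ∈ B (h + 1) := by
      intro c hc1 hc2
      rcases hc2.eq_or_lt with rfl | hc2
      · exact hBB haB
      · rcases (hbs.trans hc1).eq_or_lt with he | hlt'
        · rw [← he]; exact hbB
        · exact hB.2 h h1 h2 _ haB _ hbB hk3 c hlt' hc2
    obtain ⟨hx1, hx2⟩ := srt_eq_add_of_Icc_subset hi (by omega) hI
      (t := srt (B h) (q h) - srt (B (h + 1)) i) (by omega)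
    have hx2' : srt (B (h + 1)) (i + (srt (B h) (q h) - srt (B (h + 1)) i)) = srt (B h) (q h) := by
      omega
    refine ⟨_, Nat.le_add_right _ _, ?_, hc' ▸ hx1, hx2', by omega⟩
    by_contra hcon
    -- The position `x` exceeds `q h`: the set `B h` and one new element are `q h + 1` elements of
    -- `B (h + 1)` not above the maximum of `B h`.
    have h3 := srt_le_of_card (B := B (h + 1)) (A := insert (srt (B (h + 1)) k) (B h))
      (v := srt (B h) (q h)) (k := q h + 1) (by omega)
      (Finset.insert_subset hbB hBB) ?_ ?_
    · have h4 := srt_lt (B := B (h + 1)) (i := i + (srt (B h) (q h) - srt (B (h + 1)) i))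
        (j := q h + 1) (by omega) (by omega) (by omega)
      omega
    · intro a ha
      rw [Finset.mem_insert] at ha
      rcases ha with rfl | ha
      · omega
      · obtain ⟨j, hj1, hj2, rfl⟩ := exists_srt_eq ha
        exact srt_le hj1 (by omega) hc.ge
    · rw [Finset.card_insert_of_notMem hk3, hc]
  -- Each element of `B h` is tied by a staircase to some entry of `γ`; thus it is the suffix
  -- minimum and not only a lower bound for it.
  have P : ∀ h, h ≤ r + 1 → ∀ i, 1 ≤ i → i ≤ q h →
      ∃ x, i ≤ x ∧ x ≤ q h ∧ srt (B h) i + (x - i) = γ x := by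
    intro h
    induction h with
    | zero => intro _ i hi hi'; rw [E.zero] at hi'; omega
    | succ h ih =>
      intro hh i hi hi'
      have hlts := E.lt_succ h (by omega)
      by_cases hiq : i ≤ q h
      · have h1 : 1 ≤ h := by
          by_contra hcon
          obtain rfl : h = 0 := by omega
          rw [E.zero] at hiq
          omega
        obtain ⟨x, hx1, hx2, hx3⟩ := ih (by omega) i hi hiq
        have hc := hcard h (by omega)
        have hc' := hcard (h + 1) (by omega)
        have hle : srt (B (h + 1)) i ≤ srt (B h) i :=
          srt_le_srt_of_subset (hsub h (h + 1) (by omega) (by omega)) hi (by omega)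
        rcases hle.eq_or_lt with he | hlt
        · exact ⟨x, hx1, by omega, by omega⟩
        · have hle2 : srt (B h) i ≤ srt (B h) (q h) := srt_le hi hiq hc.ge
          -- Were the first `i` elements of `B (h + 1)` all in `B h`, the `i`-th element could not
          -- have decreased.
          obtain ⟨x, hx0, hx1, hx2, hx3, hx4⟩ := J h h1 (by omega) i hi (by omega) (by omega) (by
            by_contra! hcon
            have := srt_le_of_card (B := B h) (A := (Finset.Icc 1 i).image (srt (B (h + 1))))
              (v := srt (B (h + 1)) i) (k := i) hi ?_ ?_ ?_
            · omega
            · intro y hy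
              rw [Finset.mem_image] at hy
              obtain ⟨k, hk, rfl⟩ := hy
              rw [Finset.mem_Icc] at hk
              exact hcon k hk.1 hk.2
            · intro y hy
              rw [Finset.mem_image] at hy
              obtain ⟨k, hk, rfl⟩ := hy
              rw [Finset.mem_Icc] at hk
              exact srt_le hk.1 hk.2 (by omega)
            · rw [card_image_of_strict]
              intro a b ha hab hb
              exact srt_lt ha hab (by omega))
          refine ⟨x, hx0, hx2, ?_⟩
          rw [happ (h + 1) x (by omega) hh (by simpa using hx1) hx2]
          omega
      · refine ⟨i, le_rfl, hi', ?_⟩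
        rw [happ (h + 1) i (by omega) hh (by simp; omega) hi']
        omega
  have hcol : ∀ h, h ≤ r + 1 → ∀ i, 1 ≤ i → i ≤ q h → colMax γ (q h) i = srt (B h) i := by
    intro h hh i hi hi'
    apply le_antisymm
    · obtain ⟨x, hx1, hx2, hx3⟩ := P h hh i hi hi'
      have := colMax_add_le (Upper.le hUI.1 (E.le_top hh)) hi hx1 hx2
      omega
    · refine le_colMax hi' fun x hx hx' => ?_
      obtain ⟨g, ha, hb, hc, hd⟩ := E.exists_carrel (show 1 ≤ x by omega) (hx'.trans (E.le_top hh))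
      have hgh := E.carrel_le ha hc le_rfl hx' hb
      rw [happ g x ha hb hc hd]
      refine (srt_add_le hi hx (by rw [hcard h hh]; exact hx')).trans ?_
      exact srt_le_srt_of_subset (hsub g h hgh hh) (by omega) (by rw [hcard g hb]; exact hd)
  refine ⟨γ, (mem_gapless_iff E hUI).2 fun h h1 h2 => ?_, ?_⟩
  · have hlts := E.lt_succ h h2
    have hq1 := E.one_le h1 (by omega)
    have hc' := hcard (h + 1) (by omega)
    rw [hcol (h + 1) (by omega) (q h + 1) (by omega) hlts,
      happ h (q h) h1 (by omega) (E.pred_lt h1 (by omega)) le_rfl]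
    by_cases hge : srt (B h) (q h) ≤ srt (B (h + 1)) (q h + 1)
    · refine ⟨q h + 1, by omega, hlts, ?_, ?_⟩ <;>
      rw [happ (h + 1) (q h + 1) (by omega) (by omega) (by simp) hlts]
      · exact hge
      · omega
    -- Of `q h + 1` elements at least one is outside `B h`.
    · obtain ⟨x, hx0, hx1, hx2, hx3, hx4⟩ := J h h1 h2 (q h + 1) (by omega) le_rfl (by omega) (by
        by_contra! hcon
        have : (Finset.Icc 1 (q h + 1)).image (srt (B (h + 1))) ⊆ B h := by
          intro y hy
          rw [Finset.mem_image] at hy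
          obtain ⟨k, hk, rfl⟩ := hy
          rw [Finset.mem_Icc] at hk
          exact hcon k hk.1 hk.2
        have := Finset.card_le_card this
        rw [card_image_of_strict (fun a b ha hab hb => srt_lt ha hab (by omega)),
          hcard h (by omega)] at this
        omega)
      refine ⟨x, hx1, hx2, ?_, ?_⟩ <;>
      rw [happ (h + 1) x (by omega) (by omega) (by simpa using hx1) hx2] <;> omega
  · funext h
    by_cases hh : h ≤ r + 1
    · apply eq_of_srt_eq
      · rw [card_colMaxChain E hUI.1 hh, hcard h hh]
      · intro i hi hi'
        rw [card_colMaxChain E hUI.1 hh] at hi'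
        rw [srt_colMaxChain E hUI.1 hh hi hi', hcol h hh i hi hi']
    · rw [hB.1.2.2.2.2 h (by omega), colMaxChain, if_neg hh]

/-- Injectivity: for `i` in the `h`-th carrel, `γ i` is the `i`-th element of the `h`-th set. -/
theorem colMaxChain_bijOn (E : CarrelEnum n r q) :
    Set.BijOn (colMaxChain r q) (Gapless n r q) (AvoidChains n r q) := by
  refine ⟨fun γ hγ => colMaxChain_mem_avoidChains E hγ.1.1 (gapless_flagLike E hγ),
    fun γ hγ γ' hγ' he => ?_, fun B hB => avoidChain_eq_colMaxChain E hB⟩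
  refine Tuples.ext hγ.1.1.1 hγ'.1.1.1 fun i h1 h2 => ?_
  obtain ⟨h, ha, hb, hc, hd⟩ := E.exists_carrel h1 h2
  rw [← colMax_eq_self hγ.1.2 ha hb hc hd, ← colMax_eq_self hγ'.1.2 ha hb hc hd,
    ← srt_colMaxChain E hγ.1.1 hb h1 hd, ← srt_colMaxChain E hγ'.1.1 hb h1 hd, he]

end chains

/-! ### Words and pattern avoidance -/

/-- The words of length `n` in which each letter `h` occurs `c h` times. -/
def Words (n : ℕ) (c : ℕ → ℕ) : Set (ℕ → ℕ) :=
  {w | (∀ v, ¬ (1 ≤ v ∧ v ≤ n) → w v = 0) ∧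
    ∀ h, ((Finset.Icc 1 n).filter fun v => w v = h).card = c h}

/-- Three letters of `w`, from left to right, satisfy `P`. -/
def WordContains (n : ℕ) (P : ℕ → ℕ → ℕ → Prop) (w : ℕ → ℕ) : Prop :=
  ∃ x y z, 1 ≤ x ∧ x < y ∧ y < z ∧ z ≤ n ∧ P (w x) (w y) (w z)

/-- The words in which no three letters, from left to right, satisfy `P`. -/
def WordsAvoid (n : ℕ) (c : ℕ → ℕ) (P : ℕ → ℕ → ℕ → Prop) : Set (ℕ → ℕ) :=
  {w | w ∈ Words n c ∧ ¬ WordContains n P w}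

section words

variable {n : ℕ} {c : ℕ → ℕ}

open Classical in
/-- The letters that are not preceded by a smaller one, shifted by one; zero at other positions. -/
noncomputable def skeleton (n : ℕ) (w : ℕ → ℕ) : ℕ → ℕ := fun v =>
  if 1 ≤ v ∧ v ≤ n ∧ ¬ ∃ u, 1 ≤ u ∧ u < v ∧ w u < w v then w v + 1 else 0

theorem skeleton_eq_iff {w w' : ℕ → ℕ} : skeleton n w = skeleton n w' ↔
    ∀ v, 1 ≤ v → v ≤ n → ((∃ u, 1 ≤ u ∧ u < v ∧ w u < w v) ↔ ∃ u, 1 ≤ u ∧ u < v ∧ w' u < w' v) ∧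
      ((¬ ∃ u, 1 ≤ u ∧ u < v ∧ w u < w v) → w v = w' v) := by
  rw [funext_iff]
  refine forall_congr' fun v => ?_
  by_cases h1 : 1 ≤ v
  · by_cases h2 : v ≤ n
    · have e0 : ∀ w : ℕ → ℕ, (∃ u, 1 ≤ u ∧ u < v ∧ w u < w v) → skeleton n w v = 0 :=
        fun w hw => if_neg fun h => h.2.2 hw
      have e1 : ∀ w : ℕ → ℕ, (¬ ∃ u, 1 ≤ u ∧ u < v ∧ w u < w v) → skeleton n w v = w v + 1 :=
        fun w hw => if_pos ⟨h1, h2, hw⟩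
      by_cases hp : ∃ u, 1 ≤ u ∧ u < v ∧ w u < w v
      · by_cases hp' : ∃ u, 1 ≤ u ∧ u < v ∧ w' u < w' v
        · rw [e0 w hp, e0 w' hp']
          exact iff_of_true rfl fun _ _ => ⟨iff_of_true hp hp', fun h => absurd hp h⟩
        · rw [e0 w hp, e1 w' hp']
          exact iff_of_false (by omega) fun h => hp' ((h h1 h2).1.1 hp)
      · by_cases hp' : ∃ u, 1 ≤ u ∧ u < v ∧ w' u < w' v
        · rw [e1 w hp, e0 w' hp']
          exact iff_of_false (by omega) fun h => hp ((h h1 h2).1.2 hp')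
        · rw [e1 w hp, e1 w' hp']
          exact ⟨fun h _ _ => ⟨iff_of_false hp hp', fun _ => by omega⟩, fun h => by
            rw [(h h1 h2).2 hp]⟩
    · simp [skeleton, h2]
  · simp [skeleton, h1]

theorem swap_mem_words {w : ℕ → ℕ} (hw : w ∈ Words n c) {j k : ℕ} (hj : 1 ≤ j ∧ j ≤ n)
    (hk : 1 ≤ k ∧ k ≤ n) : (fun v => w (Equiv.swap j k v)) ∈ Words n c := by
  have hmem : ∀ v, 1 ≤ v ∧ v ≤ n ↔ 1 ≤ Equiv.swap j k v ∧ Equiv.swap j k v ≤ n := by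
    intro v
    rw [Equiv.swap_apply_def]
    split_ifs with h1 h2
    · subst h1; simp [hj, hk]
    · subst h2; simp [hj, hk]
    · rfl
  refine ⟨fun v hv => hw.1 _ (by rwa [← hmem]), fun h => ?_⟩
  rw [← hw.2 h]
  refine Finset.card_nbij' (Equiv.swap j k) (Equiv.swap j k) ?_ ?_ ?_ ?_
  · intro v hv
    simp only [Finset.coe_filter, Finset.mem_Icc, Set.mem_ofPred_eq] at hv ⊢
    exact ⟨(hmem v).1 hv.1, hv.2⟩
  · intro v hv
    simp only [Finset.coe_filter, Finset.mem_Icc, Set.mem_ofPred_eq] at hv ⊢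
    exact ⟨(hmem v).1 hv.1, by rw [Equiv.swap_apply_self]; exact hv.2⟩
  · intro v _; simp
  · intro v _; simp

/-- Exchanging two letters that are both larger than an earlier one does not change the skeleton. -/
theorem skeleton_swap {w : ℕ → ℕ} {i j k : ℕ} (hi : 1 ≤ i) (hij : i < j) (hjk : j < k)
    (h1 : w i < w j) (h2 : w i < w k) :
    skeleton n (fun v => w (Equiv.swap j k v)) = skeleton n w := by
  have hne : ∀ v, v ≠ j → v ≠ k → Equiv.swap j k v = v := fun v => Equiv.swap_apply_of_ne_of_ne
  have hsi : Equiv.swap j k i = i := hne i (by omega) (by omega)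
  rw [skeleton_eq_iff]
  intro v hv hvn
  have hjv : v = j ∨ v = k ∨ (v ≠ j ∧ v ≠ k) := by omega
  rcases hjv with rfl | rfl | ⟨hvj, hvk⟩
  · rw [Equiv.swap_apply_left]
    have ha : ∃ u, 1 ≤ u ∧ u < v ∧ w (Equiv.swap v k u) < w k := ⟨i, hi, hij, by rwa [hsi]⟩
    have hb : ∃ u, 1 ≤ u ∧ u < v ∧ w u < w v := ⟨i, hi, hij, h1⟩
    exact ⟨iff_of_true ha hb, fun hc => absurd ha hc⟩
  · rw [Equiv.swap_apply_right]
    have ha : ∃ u, 1 ≤ u ∧ u < v ∧ w (Equiv.swap j v u) < w j := ⟨i, hi, by omega, by rwa [hsi]⟩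
    have hb : ∃ u, 1 ≤ u ∧ u < v ∧ w u < w v := ⟨i, hi, by omega, h2⟩
    exact ⟨iff_of_true ha hb, fun hc => absurd ha hc⟩
  · rw [hne v hvj hvk]
    refine ⟨⟨?_, ?_⟩, fun _ => rfl⟩
    · rintro ⟨u, hu, huv, hlt⟩
      by_cases hu' : u = j ∨ u = k
      · refine ⟨i, hi, by omega, lt_trans ?_ hlt⟩
        rcases hu' with rfl | rfl
        · rwa [Equiv.swap_apply_left]
        · rwa [Equiv.swap_apply_right]
      · exact ⟨u, hu, huv, by rwa [hne u (by omega) (by omega)] at hlt⟩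
    · rintro ⟨u, hu, huv, hlt⟩
      by_cases hu' : u = j ∨ u = k
      · refine ⟨i, hi, by omega, ?_⟩
        rw [hsi]
        refine lt_trans ?_ hlt
        rcases hu' with rfl | rfl
        · exact h1
        · exact h2
      · exact ⟨u, hu, huv, by rwa [hne u (by omega) (by omega)]⟩

theorem sum_swap_lt {g w : ℕ → ℕ} {j k : ℕ} (hj : 1 ≤ j) (hjk : j < k) (hk : k ≤ n)
    (h : g j * w k + g k * w j < g j * w j + g k * w k) :
    ∑ v ∈ Finset.Icc 1 n, g v * w (Equiv.swap j k v) < ∑ v ∈ Finset.Icc 1 n, g v * w v := by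
  have hj' : j ∈ Finset.Icc 1 n := Finset.mem_Icc.2 ⟨hj, by omega⟩
  have hk' : k ∈ (Finset.Icc 1 n).erase j :=
    Finset.mem_erase.2 ⟨by omega, Finset.mem_Icc.2 ⟨by omega, hk⟩⟩
  rw [← Finset.add_sum_erase _ _ hj', ← Finset.add_sum_erase _ _ hk',
    ← Finset.add_sum_erase _ (fun v => g v * w v) hj',
    ← Finset.add_sum_erase _ (fun v => g v * w v) hk', Equiv.swap_apply_left,
    Equiv.swap_apply_right]
  have : ∑ v ∈ ((Finset.Icc 1 n).erase j).erase k, g v * w (Equiv.swap j k v) =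
      ∑ v ∈ ((Finset.Icc 1 n).erase j).erase k, g v * w v := by
    refine Finset.sum_congr rfl fun v hv => ?_
    rw [Finset.mem_erase, Finset.mem_erase] at hv
    rw [Equiv.swap_apply_of_ne_of_ne hv.2.1 hv.1]
  rw [this]
  omega

/-- Each word has the same skeleton as some word that avoids `P`, if each occurrence of `P` can be
improved by an exchange. -/
theorem skeleton_image_eq {P : ℕ → ℕ → ℕ → Prop} {g : ℕ → ℕ}
    (hP : ∀ a b d, P a b d → a < b ∧ a < d)
    (hg : ∀ y z, y < z → z ≤ n → ∀ a b d, P a b d → g y * d + g z * b < g y * b + g z * d) :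
    skeleton n '' WordsAvoid n c P = skeleton n '' Words n c := by
  apply Set.Subset.antisymm (Set.image_mono fun w hw => hw.1)
  rintro _ ⟨w0, hw0, rfl⟩
  -- A word of least weight with the given skeleton avoids `P`: exchanging the last two letters of
  -- an occurrence would keep the skeleton and lower the weight.
  obtain ⟨w, ⟨hw, hs⟩, hmin⟩ := (measure fun w : ℕ → ℕ =>
    ∑ v ∈ Finset.Icc 1 n, g v * w v).wf.has_min
    {w | w ∈ Words n c ∧ skeleton n w = skeleton n w0} ⟨w0, hw0, rfl⟩
  refine ⟨w, ⟨hw, ?_⟩, hs⟩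
  rintro ⟨x, y, z, hx, hxy, hyz, hz, hxyz⟩
  obtain ⟨h1, h2⟩ := hP _ _ _ hxyz
  exact hmin _ ⟨swap_mem_words hw (j := y) (k := z) ⟨by omega, by omega⟩ ⟨by omega, hz⟩,
    (skeleton_swap hx hxy hyz h1 h2).trans hs⟩
    (sum_swap_lt (by omega) hyz hz (hg y z hyz hz _ _ _ hxyz))

/-- Both words use each letter equally often, so the letter that `w` lacks at the first disagreement
must follow later. -/
theorem exists_later_letter {w w' : ℕ → ℕ} (hw : w ∈ Words n c) (hw' : w' ∈ Words n c) {v : ℕ}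
    (h1 : 1 ≤ v) (h2 : v ≤ n) (hagree : ∀ u, u < v → w u = w' u) (hne : w v ≠ w' v) :
    ∃ k, v < k ∧ k ≤ n ∧ w k = w' v := by
  by_contra! hcon
  have hss : ((Finset.Icc 1 n).filter fun u => w u = w' v) ⊂
      ((Finset.Icc 1 n).filter fun u => w' u = w' v) := by
    rw [Finset.ssubset_iff_of_subset]
    · refine ⟨v, by simp [h1, h2], ?_⟩
      simp [hne]
    · intro u hu
      rw [Finset.mem_filter, Finset.mem_Icc] at hu ⊢
      refine ⟨hu.1, ?_⟩
      rcases lt_trichotomy u v with h | rfl | h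
      · rw [← hagree u h]; exact hu.2
      · rfl
      · exact absurd hu.2 (hcon u h hu.1.2)
  have := Finset.card_lt_card hss
  rw [hw.2, hw'.2] at this
  exact lt_irrefl _ this

/-- At the first disagreement both letters have a smaller predecessor, since the skeleton records
all others. The assumption, used for both orders of the two words, then excludes either inequality.
-/
theorem skeleton_injOn {P : ℕ → ℕ → ℕ → Prop}
    (hP : ∀ w ∈ WordsAvoid n c P, ∀ w' ∈ WordsAvoid n c P, ∀ v, 1 ≤ v → v ≤ n →
      (∀ u, u < v → w u = w' u) → (∃ u, 1 ≤ u ∧ u < v ∧ w u < w v) → ¬ w v < w' v) :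
    Set.InjOn (skeleton n) (WordsAvoid n c P) := by
  intro w hw w' hw' he
  by_contra hne
  have hex : ∃ v, w v ≠ w' v := by
    by_contra! h
    exact hne (funext h)
  have hv := Nat.find_spec hex
  have hagree : ∀ u, u < Nat.find hex → w u = w' u := fun u hu => by
    by_contra h
    exact Nat.find_min hex hu h
  generalize Nat.find hex = v at hv hagree
  have hvn : 1 ≤ v ∧ v ≤ n := by
    by_contra h
    exact hv (by rw [hw.1.1 v h, hw'.1.1 v h])
  obtain ⟨h1, h2⟩ := skeleton_eq_iff.1 he v hvn.1 hvn.2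
  have h3 : ∃ u, 1 ≤ u ∧ u < v ∧ w u < w v := by
    by_contra h
    exact hv (h2 h)
  rcases lt_or_gt_of_ne hv with h | h
  · exact hP w hw w' hw' v hvn.1 hvn.2 hagree h3 h
  · exact hP w' hw' w hw v hvn.1 hvn.2 (fun u hu => (hagree u hu).symm) (h1.1 h3) h

/-- Each family contains exactly one word for each skeleton. -/
theorem ncard_wordsAvoid_123_eq_132 (n : ℕ) (c : ℕ → ℕ) :
    (WordsAvoid n c fun x y z => x < y ∧ y < z).ncard =
      (WordsAvoid n c fun x y z => x < z ∧ z < y).ncard := by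
  have e1 : skeleton n '' (WordsAvoid n c fun x y z => x < y ∧ y < z) = skeleton n '' Words n c := by
    -- With increasing weights, moving the larger letter forward lowers the weighted sum; for 132
    -- the weights must decrease instead.
    refine skeleton_image_eq (g := fun v => v) (fun a b d h => ⟨h.1, h.1.trans h.2⟩) ?_
    rintro y z hyz - a b d ⟨-, hbd⟩
    obtain ⟨s, rfl⟩ := Nat.exists_eq_add_of_lt hyz
    obtain ⟨t, rfl⟩ := Nat.exists_eq_add_of_lt hbd
    nlinarith
  have e2 : skeleton n '' (WordsAvoid n c fun x y z => x < z ∧ z < y) = skeleton n '' Words n c := by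
    refine skeleton_image_eq (g := fun v => n - v) (fun a b d h => ⟨h.1.trans h.2, h.1⟩) ?_
    rintro y z hyz hz a b d ⟨-, hbd⟩
    obtain ⟨s, hs⟩ := Nat.exists_eq_add_of_lt (show n - z < n - y by omega)
    obtain ⟨t, rfl⟩ := Nat.exists_eq_add_of_lt hbd
    rw [hs]
    nlinarith
  have i1 : Set.InjOn (skeleton n) (WordsAvoid n c fun x y z => x < y ∧ y < z) := by
    refine skeleton_injOn fun w hw w' hw' v h1 h2 hagree ⟨u, hu, huv, hlt⟩ hvv => ?_
    -- The larger letter `w' v` comes later in `w` and completes a 123 with `w u < w v`.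
    obtain ⟨k, hk, hkn, hk'⟩ := exists_later_letter hw.1 hw'.1 h1 h2 hagree hvv.ne
    exact hw.2 ⟨u, v, k, hu, huv, hk, hkn, hlt, by omega⟩
  have i2 : Set.InjOn (skeleton n) (WordsAvoid n c fun x y z => x < z ∧ z < y) := by
    refine skeleton_injOn fun w hw w' hw' v h1 h2 hagree ⟨u, hu, huv, hlt⟩ hvv => ?_
    -- Here the smaller letter `w v` comes later in `w'` and completes a 132 there.
    obtain ⟨k, hk, hkn, hk'⟩ := exists_later_letter hw'.1 hw.1 h1 h2
      (fun u hu => (hagree u hu).symm) hvv.ne'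
    refine hw'.2 ⟨u, v, k, hu, huv, hk, hkn, ?_, by omega⟩
    rw [← hagree u huv, hk']
    exact hlt
  rw [← i1.ncard_image, ← i2.ncard_image, e1, e2]

/-- Reading words backwards. -/
theorem ncard_wordsAvoid_reverse (n : ℕ) (c : ℕ → ℕ) (P : ℕ → ℕ → ℕ → Prop) :
    (WordsAvoid n c P).ncard = (WordsAvoid n c fun x y z => P z y x).ncard := by
  classical
  set rev : (ℕ → ℕ) → ℕ → ℕ := fun w v => if 1 ≤ v ∧ v ≤ n then w (n + 1 - v) else 0 with hrev
  have hin : ∀ w v, 1 ≤ v → v ≤ n → rev w v = w (n + 1 - v) := fun w v h1 h2 => by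
    simp only [hrev]; rw [if_pos ⟨h1, h2⟩]
  have hmaps : ∀ P : ℕ → ℕ → ℕ → Prop, ∀ w ∈ WordsAvoid n c P,
      rev w ∈ WordsAvoid n c fun x y z => P z y x := by
    rintro P w ⟨hw, hP⟩
    refine ⟨⟨fun v hv => by simp only [hrev]; rw [if_neg hv], fun h => ?_⟩, ?_⟩
    · rw [← hw.2 h]
      refine Finset.card_nbij' (fun v => n + 1 - v) (fun v => n + 1 - v) ?_ ?_ ?_ ?_
      · intro v hv
        simp only [Finset.coe_filter, Finset.mem_Icc, Set.mem_ofPred_eq] at hv ⊢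
        rw [hin w v hv.1.1 hv.1.2] at hv
        exact ⟨by omega, hv.2⟩
      · intro v hv
        simp only [Finset.coe_filter, Finset.mem_Icc, Set.mem_ofPred_eq] at hv ⊢
        rw [hin w _ (by omega) (by omega), show n + 1 - (n + 1 - v) = v by omega]
        exact ⟨by omega, hv.2⟩
      · intro v hv
        simp only [Finset.coe_filter, Finset.mem_Icc, Set.mem_ofPred_eq] at hv
        simp only
        omega
      · intro v hv
        simp only [Finset.coe_filter, Finset.mem_Icc, Set.mem_ofPred_eq] at hv
        simp only
        omega
    · rintro ⟨x, y, z, hx, hxy, hyz, hz, h⟩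
      rw [hin w x hx (by omega), hin w y (by omega) (by omega), hin w z (by omega) hz] at h
      exact hP ⟨n + 1 - z, n + 1 - y, n + 1 - x, by omega, by omega, by omega, by omega, h⟩
  have hinv : ∀ P : ℕ → ℕ → ℕ → Prop, ∀ w ∈ WordsAvoid n c P, rev (rev w) = w := by
    intro P w hw
    funext v
    by_cases hv : 1 ≤ v ∧ v ≤ n
    · rw [hin _ v hv.1 hv.2, hin _ _ (by omega) (by omega), show n + 1 - (n + 1 - v) = v by omega]
    · rw [hw.1.1 v hv]
      simp only [hrev]
      rw [if_neg hv]
  exact (bijOn_of_leftInverse rev rev (hmaps P) (hmaps _) (hinv P) (hinv _)).ncard_eq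

/-- Complementing the letters of words with letters between `1` and `m`. -/
theorem ncard_wordsAvoid_complement (n m : ℕ) (c : ℕ → ℕ) (P P' : ℕ → ℕ → ℕ → Prop)
    (hc : ∀ h, ¬ (1 ≤ h ∧ h ≤ m) → c h = 0)
    (hP : ∀ x y z, x ≤ m → y ≤ m → z ≤ m → (P x y z ↔ P' (m + 1 - x) (m + 1 - y) (m + 1 - z))) :
    (WordsAvoid n c P).ncard =
      (WordsAvoid n (fun h => if 1 ≤ h ∧ h ≤ m then c (m + 1 - h) else 0) P').ncard := by
  classical
  set rev : (ℕ → ℕ) → ℕ → ℕ := fun w v => if 1 ≤ v ∧ v ≤ n then m + 1 - w v else 0 with hrev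
  have hin : ∀ w v, 1 ≤ v → v ≤ n → rev w v = m + 1 - w v := fun w v h1 h2 => by
    simp only [hrev]; rw [if_pos ⟨h1, h2⟩]
  have hlet : ∀ c : ℕ → ℕ, (∀ h, ¬ (1 ≤ h ∧ h ≤ m) → c h = 0) → ∀ w ∈ Words n c,
      ∀ v, 1 ≤ v → v ≤ n → 1 ≤ w v ∧ w v ≤ m := by
    intro c hc w hw v h1 h2
    by_contra h
    have := hw.2 (w v)
    rw [hc _ h, Finset.card_eq_zero] at this
    have hv : v ∈ (Finset.Icc 1 n).filter fun u => w u = w v := by simp [h1, h2]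
    rw [this] at hv
    simp at hv
  have hmaps : ∀ c : ℕ → ℕ, (∀ h, ¬ (1 ≤ h ∧ h ≤ m) → c h = 0) → ∀ P P' : ℕ → ℕ → ℕ → Prop,
      (∀ x y z, x ≤ m → y ≤ m → z ≤ m → (P x y z ↔ P' (m + 1 - x) (m + 1 - y) (m + 1 - z))) →
      ∀ w ∈ WordsAvoid n c P,
      rev w ∈ WordsAvoid n (fun h => if 1 ≤ h ∧ h ≤ m then c (m + 1 - h) else 0) P' := by
    rintro c hc P P' hP w ⟨hw, hwP⟩
    have hl := hlet c hc w hw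
    refine ⟨⟨fun v hv => by simp only [hrev]; rw [if_neg hv], fun h => ?_⟩, ?_⟩
    · dsimp only
      split_ifs with hh
      · rw [← hw.2]
        congr 1
        refine Finset.filter_congr fun v hv => ?_
        rw [Finset.mem_Icc] at hv
        rw [hin w v hv.1 hv.2]
        have := hl v hv.1 hv.2
        omega
      · rw [Finset.card_eq_zero, Finset.filter_eq_empty_iff]
        intro v hv
        rw [Finset.mem_Icc] at hv
        rw [hin w v hv.1 hv.2]
        have := hl v hv.1 hv.2
        omega
    · rintro ⟨x, y, z, hx, hxy, hyz, hz, h⟩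
      rw [hin w x hx (by omega), hin w y (by omega) (by omega), hin w z (by omega) hz,
        ← hP _ _ _ (hl x hx (by omega)).2 (hl y (by omega) (by omega)).2
          (hl z (by omega) hz).2] at h
      exact hwP ⟨x, y, z, hx, hxy, hyz, hz, h⟩
  have hinv : ∀ c : ℕ → ℕ, (∀ h, ¬ (1 ≤ h ∧ h ≤ m) → c h = 0) → ∀ w ∈ Words n c,
      rev (rev w) = w := by
    intro c hc w hw
    funext v
    by_cases hv : 1 ≤ v ∧ v ≤ n
    · rw [hin _ v hv.1 hv.2, hin _ _ hv.1 hv.2]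
      have := hlet c hc w hw v hv.1 hv.2
      omega
    · rw [hw.1 v hv]
      simp only [hrev]
      rw [if_neg hv]
  set c' : ℕ → ℕ := fun h => if 1 ≤ h ∧ h ≤ m then c (m + 1 - h) else 0 with hc'
  have hc'0 : ∀ h, ¬ (1 ≤ h ∧ h ≤ m) → c' h = 0 := fun h hh => by
    simp only [hc']; rw [if_neg hh]
  have hcc : (fun h => if 1 ≤ h ∧ h ≤ m then c' (m + 1 - h) else 0) = c := by
    funext h
    split_ifs with hh
    · simp only [hc']
      rw [if_pos ⟨by omega, by omega⟩, show m + 1 - (m + 1 - h) = h by omega]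
    · exact (hc h hh).symm
  -- Since `P` and `P'` correspond only on letters up to `m`, the way back uses the relation that
  -- three letters are the complements of letters satisfying `P'`.
  have hback := hmaps c' hc'0 P' (fun x y z => ∃ a b d, a ≤ m ∧ b ≤ m ∧ d ≤ m ∧ x = m + 1 - a ∧
    y = m + 1 - b ∧ z = m + 1 - d ∧ P' a b d) ?_
  · rw [hcc] at hback
    refine (bijOn_of_leftInverse rev rev (hmaps c hc P P' hP) (fun w hw => ?_)
      (fun w hw => hinv c hc w hw.1) (fun w hw => hinv c' hc'0 w hw.1)).ncard_eq
    obtain ⟨h1, h2⟩ := hback w hw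
    refine ⟨h1, ?_⟩
    rintro ⟨x, y, z, hx, hxy, hyz, hz, h⟩
    have hl := hlet c hc _ h1
    have hlx := hl x hx (by omega)
    have hly := hl y (by omega) (by omega)
    have hlz := hl z (by omega) hz
    exact h2 ⟨x, y, z, hx, hxy, hyz, hz, _, _, _, by omega, by omega, by omega, by omega,
      by omega, by omega, (hP _ _ _ hlx.2 hly.2 hlz.2).1 h⟩
  · intro x y z hx hy hz
    constructor
    · intro h
      exact ⟨x, y, z, hx, hy, hz, rfl, rfl, rfl, h⟩
    · rintro ⟨a, b, d, ha, hb, hd, h1, h2, h3, h⟩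
      obtain rfl : x = a := by omega
      obtain rfl : y = b := by omega
      obtain rfl : z = d := by omega
      exact h

/-- All six patterns of length three are avoided by the same number of words of a given content. -/
theorem ncard_wordsAvoid_eq (n m : ℕ) (c : ℕ → ℕ) (hc : ∀ h, ¬ (1 ≤ h ∧ h ≤ m) → c h = 0) :
    (WordsAvoid n c fun x y z => x < z ∧ z < y).ncard =
      (WordsAvoid n c fun x y z => x < y ∧ y < z).ncard ∧
    (WordsAvoid n c fun x y z => y < x ∧ x < z).ncard =
      (WordsAvoid n c fun x y z => x < y ∧ y < z).ncard ∧
    (WordsAvoid n c fun x y z => y < z ∧ z < x).ncard =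
      (WordsAvoid n c fun x y z => x < y ∧ y < z).ncard ∧
    (WordsAvoid n c fun x y z => z < x ∧ x < y).ncard =
      (WordsAvoid n c fun x y z => x < y ∧ y < z).ncard ∧
    (WordsAvoid n c fun x y z => z < y ∧ y < x).ncard =
      (WordsAvoid n c fun x y z => x < y ∧ y < z).ncard := by
  have s132 := (ncard_wordsAvoid_123_eq_132 n c).symm
  have s231 := (ncard_wordsAvoid_reverse n c fun x y z => z < x ∧ x < y)
  have s321 := (ncard_wordsAvoid_reverse n c fun x y z => z < y ∧ y < x)
  have s312 := (ncard_wordsAvoid_reverse n c fun x y z => y < z ∧ z < x)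
  have c213 := ncard_wordsAvoid_complement n m c (fun x y z => y < x ∧ x < z)
    (fun x y z => z < x ∧ x < y) hc (fun x y z hx hy hz => by omega)
  have c321 := ncard_wordsAvoid_complement n m c (fun x y z => z < y ∧ y < x)
    (fun x y z => x < y ∧ y < z) hc (fun x y z hx hy hz => by omega)
  have t231 := (ncard_wordsAvoid_reverse n
    (fun h => if 1 ≤ h ∧ h ≤ m then c (m + 1 - h) else 0) fun x y z => z < x ∧ x < y)
  have t132 := (ncard_wordsAvoid_123_eq_132 n
    (fun h => if 1 ≤ h ∧ h ≤ m then c (m + 1 - h) else 0)).symm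
  refine ⟨s132, ?_, ?_, s231.trans s132, s321⟩
  -- Complementing alters the content. The route therefore passes to the complementary content with
  -- 213, reaches 123 there, and returns with 321.
  · rw [c213, t231, t132, ← c321, s321]
  · rw [s312, c213, t231, t132, ← c321, s321]

end words

/-! ### Pattern avoidance for ordered partitions and permutations -/

section patterns

variable {n r : ℕ} {q : ℕ → ℕ}

/-- The content of the words that encode ordered partitions. -/
def blockSizes (r : ℕ) (q : ℕ → ℕ) : ℕ → ℕ := fun h =>
  if 1 ≤ h ∧ h ≤ r + 1 then q h - q (h - 1) else 0

/-- The positions of the letters of a word. -/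
def wordBlocks (n : ℕ) (w : ℕ → ℕ) : ℕ → Finset ℕ := fun h =>
  (Finset.Icc 1 n).filter fun v => w v = h

theorem words_letter_range {w : ℕ → ℕ} (hw : w ∈ Words n (blockSizes r q)) {v : ℕ} (h1 : 1 ≤ v)
    (h2 : v ≤ n) : 1 ≤ w v ∧ w v ≤ r + 1 := by
  by_contra h
  have := hw.2 (w v)
  rw [blockSizes, if_neg h, Finset.card_eq_zero] at this
  have hv : v ∈ (Finset.Icc 1 n).filter fun u => w u = w v := by simp [h1, h2]
  rw [this] at hv
  simp at hv

theorem wordBlocks_bijOn : Set.BijOn (wordBlocks n) (Words n (blockSizes r q))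
    (OrderedPartitions n r q) := by
  classical
  refine ⟨fun w hw => ⟨fun h h1 h2 => ?_, fun h hh => ?_, fun g h hgh => ?_, ?_⟩,
    fun w hw w' hw' he => ?_, fun B hB => ?_⟩
  · rw [wordBlocks, hw.2, blockSizes, if_pos ⟨h1, h2⟩]
  · rw [← Finset.card_eq_zero, wordBlocks, hw.2, blockSizes, if_neg hh]
  · rw [Finset.disjoint_left]
    intro v hv hv'
    rw [wordBlocks, Finset.mem_filter] at hv hv'
    exact hgh (hv.2.symm.trans hv'.2)
  · ext v
    simp only [Finset.mem_biUnion, wordBlocks, Finset.mem_filter, Finset.mem_Icc]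
    constructor
    · rintro ⟨h, -, hv, -⟩; exact hv
    · intro hv
      exact ⟨w v, words_letter_range hw hv.1 hv.2, hv, rfl⟩
  · funext v
    by_cases hv : 1 ≤ v ∧ v ≤ n
    · have : v ∈ wordBlocks n w' (w v) := by
        rw [← he]; simp [wordBlocks, hv]
      exact (Finset.mem_filter.1 this).2.symm
    · rw [hw.1 v hv, hw'.1 v hv]
  · obtain ⟨hcard, hout, hdisj, hun⟩ := hB
    have hex : ∀ v, ∃ h, (1 ≤ v ∧ v ≤ n) → 1 ≤ h ∧ h ≤ r + 1 ∧ v ∈ B h := by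
      intro v
      by_cases hv : 1 ≤ v ∧ v ≤ n
      · rw [← Finset.mem_Icc, ← hun, Finset.mem_biUnion] at hv
        obtain ⟨h, hh, hv⟩ := hv
        rw [Finset.mem_Icc] at hh
        exact ⟨h, fun _ => ⟨hh.1, hh.2, hv⟩⟩
      · exact ⟨0, fun h => absurd h hv⟩
    choose l hl using hex
    set w : ℕ → ℕ := fun v => if 1 ≤ v ∧ v ≤ n then l v else 0 with hw
    have hBn : ∀ h v, v ∈ B h → 1 ≤ v ∧ v ≤ n := by
      intro h v hv
      by_cases hh : 1 ≤ h ∧ h ≤ r + 1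
      · rw [← Finset.mem_Icc, ← hun, Finset.mem_biUnion]
        exact ⟨h, Finset.mem_Icc.2 hh, hv⟩
      · rw [hout h hh] at hv; simp at hv
    have hwB : wordBlocks n w = B := by
      funext h
      ext v
      simp only [wordBlocks, Finset.mem_filter, Finset.mem_Icc]
      constructor
      · rintro ⟨hv, rfl⟩
        simp only [hw]
        rw [if_pos hv]
        exact (hl v hv).2.2
      · intro hv
        have hvn := hBn h v hv
        refine ⟨hvn, ?_⟩
        simp only [hw]
        rw [if_pos hvn]
        by_contra hne
        exact Finset.disjoint_left.1 (hdisj _ _ hne) (hl v hvn).2.2 hv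
    refine ⟨w, ⟨fun v hv => by simp only [hw]; rw [if_neg hv], fun h => ?_⟩, hwB⟩
    change (wordBlocks n w h).card = _
    rw [hwB, blockSizes]
    split_ifs with hh
    · exact hcard h hh.1 hh.2
    · rw [hout h hh]; rfl

/-- Elements and block labels exchange roles, so a pattern in the partition becomes the inverse
pattern in the word; only 231 and 312 are interchanged. -/
theorem blocks_contain_iff {w : ℕ → ℕ} (hw : w ∈ Words n (blockSizes r q)) (σ : Fin 3 → ℕ) :
    (∃ h b : Fin 3 → ℕ, StrictMono h ∧
      (∀ s, 1 ≤ h s ∧ h s ≤ r + 1 ∧ b s ∈ wordBlocks n w (h s)) ∧ OrderIso3 b σ) ↔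
    ∃ b : Fin 3 → ℕ, (∀ s, 1 ≤ b s ∧ b s ≤ n) ∧ w (b 0) < w (b 1) ∧ w (b 1) < w (b 2) ∧
      OrderIso3 b σ := by
  constructor
  · rintro ⟨h, b, hh, hb, ho⟩
    have hb' : ∀ s, (1 ≤ b s ∧ b s ≤ n) ∧ w (b s) = h s := fun s => by
      have := (hb s).2.2
      rwa [wordBlocks, Finset.mem_filter, Finset.mem_Icc] at this
    refine ⟨b, fun s => (hb' s).1, ?_, ?_, ho⟩
    · rw [(hb' 0).2, (hb' 1).2]; exact hh (by decide)
    · rw [(hb' 1).2, (hb' 2).2]; exact hh (by decide)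
  · rintro ⟨b, hb, h1, h2, ho⟩
    refine ⟨fun s => w (b s), b, ?_, fun s => ?_, ho⟩
    · intro s t hst
      fin_cases s <;> fin_cases t <;> simp at hst ⊢ <;> omega
    · have := words_letter_range hw (hb s).1 (hb s).2
      exact ⟨this.1, this.2, by simp [wordBlocks, hb s]⟩

theorem orderIso3_iff (b σ : Fin 3 → ℕ) : OrderIso3 b σ ↔
    ((b 0 < b 1 ↔ σ 0 < σ 1) ∧ (b 1 < b 0 ↔ σ 1 < σ 0)) ∧
    ((b 1 < b 2 ↔ σ 1 < σ 2) ∧ (b 2 < b 1 ↔ σ 2 < σ 1)) ∧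
    ((b 0 < b 2 ↔ σ 0 < σ 2) ∧ (b 2 < b 0 ↔ σ 2 < σ 0)) := by
  constructor
  · intro h
    exact ⟨⟨h 0 1, h 1 0⟩, ⟨h 1 2, h 2 1⟩, ⟨h 0 2, h 2 0⟩⟩
  · rintro ⟨⟨h1, h2⟩, ⟨h3, h4⟩, ⟨h5, h6⟩⟩ s t
    fin_cases s <;> fin_cases t <;> simp_all

theorem ncard_orderedPartitionsAvoid (σ : Fin 3 → ℕ) (P : ℕ → ℕ → ℕ → Prop)
    (hP : ∀ w ∈ Words n (blockSizes r q), (∃ b : Fin 3 → ℕ, (∀ s, 1 ≤ b s ∧ b s ≤ n) ∧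
      w (b 0) < w (b 1) ∧ w (b 1) < w (b 2) ∧ OrderIso3 b σ) ↔ WordContains n P w) :
    (OrderedPartitionsAvoid n r q σ).ncard = (WordsAvoid n (blockSizes r q) P).ncard := by
  symm
  refine Set.BijOn.ncard_eq (f := wordBlocks n) ⟨fun w hw => ⟨wordBlocks_bijOn.mapsTo hw.1, ?_⟩,
    wordBlocks_bijOn.injOn.mono fun w hw => hw.1, fun B hB => ?_⟩
  · rw [blocks_contain_iff hw.1, hP w hw.1]
    exact hw.2
  · obtain ⟨w, hw, rfl⟩ := wordBlocks_bijOn.surjOn hB.1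
    refine ⟨w, ⟨hw, ?_⟩, rfl⟩
    rw [← hP w hw, ← blocks_contain_iff hw]
    exact hB.2

theorem ncard_avoidPattern (E : CarrelEnum n r q) (σ : Fin 3 → ℕ) :
    (AvoidPattern n r q σ).ncard = (OrderedPartitionsAvoid n r q σ).ncard := by
  have key : ∀ π ∈ RPerms n r q, (∃ h i : Fin 3 → ℕ, StrictMono h ∧
      (∀ s, 1 ≤ h s ∧ h s ≤ r + 1 ∧ q (h s - 1) < i s ∧ i s ≤ q (h s)) ∧
      OrderIso3 (fun s => π (i s)) σ) ↔ ∃ h b : Fin 3 → ℕ, StrictMono h ∧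
      (∀ s, 1 ≤ h s ∧ h s ≤ r + 1 ∧ b s ∈ blocksOf r q π (h s)) ∧ OrderIso3 b σ := by
    intro π hπ
    constructor
    · rintro ⟨h, i, hh, hi, ho⟩
      refine ⟨h, fun s => π (i s), hh, fun s => ⟨(hi s).1, (hi s).2.1, ?_⟩, ho⟩
      rw [blocksOf_apply π (hi s).1 (hi s).2.1]
      exact Finset.mem_image_of_mem _ (Finset.mem_Ioc.2 (hi s).2.2)
    · rintro ⟨h, b, hh, hb, ho⟩
      have : ∀ s, ∃ i, (q (h s - 1) < i ∧ i ≤ q (h s)) ∧ π i = b s := fun s => by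
        have := (hb s).2.2
        rw [blocksOf_apply π (hb s).1 (hb s).2.1, Finset.mem_image] at this
        obtain ⟨i, hi, hi'⟩ := this
        exact ⟨i, Finset.mem_Ioc.1 hi, hi'⟩
      choose i hi hib using this
      refine ⟨h, i, hh, fun s => ⟨(hb s).1, (hb s).2.1, hi s⟩, ?_⟩
      rwa [show (fun s => π (i s)) = b from funext hib]
  refine Set.BijOn.ncard_eq (f := blocksOf r q) ⟨fun π hπ => ⟨(blocksOf_bijOn E).mapsTo hπ.1, ?_⟩,
    (blocksOf_bijOn E).injOn.mono fun π hπ => hπ.1, fun B hB => ?_⟩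
  · rw [← key π hπ.1]; exact hπ.2
  · obtain ⟨π, hπ, rfl⟩ := (blocksOf_bijOn E).surjOn hB.1
    refine ⟨π, ⟨hπ, ?_⟩, rfl⟩
    rw [key π hπ]; exact hB.2

/-- The restriction that `b` lie in the carrel right after `q h` costs nothing: let `h + 1` be the
carrel of the middle entry. -/
theorem avoid312_eq (E : CarrelEnum n r q) : Avoid312 n r q = AvoidPattern n r q ![3, 1, 2] := by
  ext π
  refine and_congr_right fun hπ => not_congr ?_
  constructor
  · rintro ⟨h, h1, h2, i, j, k, hi, hi', hj, hj', hk, hk', h3, h4, h5⟩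
    obtain ⟨g, ga, gb, gc, gd⟩ := E.exists_carrel hi (hi'.trans (E.le_top (by omega)))
    obtain ⟨l, la, lb, lc, ld⟩ := E.exists_carrel (show 1 ≤ k by omega) hk'
    have hgh : g ≤ h := E.carrel_le ga gc le_rfl (hi') gb
    have hhl : h + 1 < l := E.lt_of_lt (by omega) (by omega)
    refine ⟨![g, h + 1, l], ![i, j, k], ?_, ?_, ?_⟩
    · intro s t hst
      fin_cases s <;> fin_cases t <;> simp at hst ⊢ <;> omega
    · intro s
      fin_cases s <;> simp <;> omega
    · rw [orderIso3_iff]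
      simp
      omega
  · rintro ⟨h, i, hh, hi, ho⟩
    rw [orderIso3_iff] at ho
    simp at ho
    have h01 : h 0 < h 1 := hh (by decide)
    have h12 : h 1 < h 2 := hh (by decide)
    have i0 := hi 0
    have i1 := hi 1
    have i2 := hi 2
    have e1 := E.mono (show h 0 ≤ h 1 - 1 by omega) (by omega)
    have e2 := E.mono (show h 1 ≤ h 2 - 1 by omega) (by omega)
    have e3 := E.le_top i2.2.1
    have e4 : h 1 - 1 + 1 = h 1 := by omega
    refine ⟨h 1 - 1, by omega, by omega, i 0, i 1, i 2, by omega, by omega, by omega, ?_, ?_,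
      by omega, by omega, by omega, by omega⟩
    · rw [e4]; omega
    · rw [e4]; omega

/-- All patterns of length three are avoided by the same number of `R`-permutations. -/
theorem ncard_avoidPattern_eq (E : CarrelEnum n r q) :
    (OrderedPartitionsAvoid n r q ![3, 1, 2]).ncard = parabolicCatalan n r q ∧
      ∀ σ ∈ ({![1, 2, 3], ![1, 3, 2], ![2, 1, 3], ![2, 3, 1], ![3, 2, 1]} : Set (Fin 3 → ℕ)),
        (AvoidPattern n r q σ).ncard = parabolicCatalan n r q := by
  obtain ⟨c132, c213, c312, c231, c321⟩ := ncard_wordsAvoid_eq n (r + 1) (blockSizes r q)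
    fun h hh => if_neg hh
  have p123 := ncard_orderedPartitionsAvoid (n := n) (r := r) (q := q) ![1, 2, 3]
    (fun x y z => x < y ∧ y < z) fun w _ => by
      simp only [orderIso3_iff]
      constructor
      · rintro ⟨b, hb, h1, h2, ho⟩
        simp at ho
        exact ⟨b 0, b 1, b 2, (hb 0).1, by omega, by omega, (hb 2).2, by omega⟩
      · rintro ⟨x, y, z, h1, h2, h3, h4, h5⟩
        refine ⟨![x, y, z], fun s => ?_, ?_⟩
        · fin_cases s <;> simp <;> omega
        · simp; omega
  have p132 := ncard_orderedPartitionsAvoid (n := n) (r := r) (q := q) ![1, 3, 2]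
    (fun x y z => x < z ∧ z < y) fun w _ => by
      simp only [orderIso3_iff]
      constructor
      · rintro ⟨b, hb, h1, h2, ho⟩
        simp at ho
        exact ⟨b 0, b 2, b 1, (hb 0).1, by omega, by omega, (hb 1).2, by omega⟩
      · rintro ⟨x, y, z, h1, h2, h3, h4, h5⟩
        refine ⟨![x, z, y], fun s => ?_, ?_⟩
        · fin_cases s <;> simp <;> omega
        · simp; omega
  have p213 := ncard_orderedPartitionsAvoid (n := n) (r := r) (q := q) ![2, 1, 3]
    (fun x y z => y < x ∧ x < z) fun w _ => by
      simp only [orderIso3_iff]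
      constructor
      · rintro ⟨b, hb, h1, h2, ho⟩
        simp at ho
        exact ⟨b 1, b 0, b 2, (hb 1).1, by omega, by omega, (hb 2).2, by omega⟩
      · rintro ⟨x, y, z, h1, h2, h3, h4, h5⟩
        refine ⟨![y, x, z], fun s => ?_, ?_⟩
        · fin_cases s <;> simp <;> omega
        · simp; omega
  have p231 := ncard_orderedPartitionsAvoid (n := n) (r := r) (q := q) ![2, 3, 1]
    (fun x y z => y < z ∧ z < x) fun w _ => by
      simp only [orderIso3_iff]
      constructor
      · rintro ⟨b, hb, h1, h2, ho⟩
        simp at ho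
        exact ⟨b 2, b 0, b 1, (hb 2).1, by omega, by omega, (hb 1).2, by omega⟩
      · rintro ⟨x, y, z, h1, h2, h3, h4, h5⟩
        refine ⟨![y, z, x], fun s => ?_, ?_⟩
        · fin_cases s <;> simp <;> omega
        · simp; omega
  have p312 := ncard_orderedPartitionsAvoid (n := n) (r := r) (q := q) ![3, 1, 2]
    (fun x y z => z < x ∧ x < y) fun w _ => by
      simp only [orderIso3_iff]
      constructor
      · rintro ⟨b, hb, h1, h2, ho⟩
        simp at ho
        exact ⟨b 1, b 2, b 0, (hb 1).1, by omega, by omega, (hb 0).2, by omega⟩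
      · rintro ⟨x, y, z, h1, h2, h3, h4, h5⟩
        refine ⟨![z, x, y], fun s => ?_, ?_⟩
        · fin_cases s <;> simp <;> omega
        · simp; omega
  have p321 := ncard_orderedPartitionsAvoid (n := n) (r := r) (q := q) ![3, 2, 1]
    (fun x y z => z < y ∧ y < x) fun w _ => by
      simp only [orderIso3_iff]
      constructor
      · rintro ⟨b, hb, h1, h2, ho⟩
        simp at ho
        exact ⟨b 2, b 1, b 0, (hb 2).1, by omega, by omega, (hb 0).2, by omega⟩
      · rintro ⟨x, y, z, h1, h2, h3, h4, h5⟩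
        refine ⟨![z, y, x], fun s => ?_, ?_⟩
        · fin_cases s <;> simp <;> omega
        · simp; omega
  have hC : parabolicCatalan n r q =
      (WordsAvoid n (blockSizes r q) fun x y z => x < y ∧ y < z).ncard := by
    rw [parabolicCatalan, avoid312_eq E, ncard_avoidPattern E, p312, c231]
  rw [hC]
  refine ⟨p312.trans c231, fun σ hσ => ?_⟩
  rw [ncard_avoidPattern E]
  simp only [Set.mem_insert_iff, Set.mem_singleton_iff] at hσ
  rcases hσ with rfl | rfl | rfl | rfl | rfl
  · exact p123
  · exact p132.trans c132
  · exact p213.trans c213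
  · exact p231.trans c312
  · exact p321.trans c321

end patterns

/-! ### Tableaux in terms of rows and columns -/

section tableaux

variable {lam : YoungDiagram}

theorem mem_lam_iff {i j : ℕ} (hi : 1 ≤ i) : (i - 1, j - 1) ∈ lam ↔ i ≤ col lam j := by
  rw [YoungDiagram.mem_iff_lt_colLen, col]; omega

theorem col_anti {j l : ℕ} (h : j ≤ l) : col lam l ≤ col lam j :=
  lam.colLen_anti _ _ (by omega)

theorem val_row (T : SemistandardYoungTableau lam) {i j l : ℕ} (hi : 1 ≤ i) (hjl : j ≤ l)
    (h : i ≤ col lam l) : val T j i ≤ val T l i :=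
  T.row_weak_of_le (by omega) ((mem_lam_iff hi).2 h)

theorem val_col (T : SemistandardYoungTableau lam) {i k j : ℕ} (hi : 1 ≤ i) (hik : i < k)
    (h : k ≤ col lam j) : val T j i < val T j k :=
  T.col_strict (by omega) ((mem_lam_iff (by omega)).2 h)

theorem val_col_le (T : SemistandardYoungTableau lam) {i k j : ℕ} (hi : 1 ≤ i) (hik : i ≤ k)
    (h : k ≤ col lam j) : val T j i ≤ val T j k :=
  T.col_weak (by omega) ((mem_lam_iff (by omega)).2 h)

theorem lt_of_val_lt (T : SemistandardYoungTableau lam) {i k j : ℕ} (hk : 1 ≤ k)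
    (hi : i ≤ col lam j) (h : val T j i < val T j k) : i < k := by
  by_contra hc
  exact absurd (val_col_le T hk (not_lt.1 hc) hi) (not_le.2 h)

theorem val_add_le (T : SemistandardYoungTableau lam) {i k j : ℕ} (hi : 1 ≤ i) (hik : i ≤ k)
    (h : k ≤ col lam j) : val T j i + (k - i) ≤ val T j k := by
  induction k, hik using Nat.le_induction with
  | base => simp
  | succ k hik ih =>
    have := ih (by omega)
    have := val_col T (i := k) (k := k + 1) (by omega) (by omega) h
    omega

theorem mem_lam_succ {a b : ℕ} : (a, b) ∈ lam ↔ a + 1 ≤ col lam (b + 1) := by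
  rw [← mem_lam_iff (by omega)]; simp

theorem tableau_ext {T T' : SemistandardYoungTableau lam}
    (h : ∀ j i, 1 ≤ j → 1 ≤ i → i ≤ col lam j → val T j i = val T' j i) : T = T' := by
  ext a b
  by_cases hab : (a, b) ∈ lam
  · exact h (b + 1) (a + 1) (by omega) (by omega) (mem_lam_succ.1 hab)
  · rw [T.zeros hab, T'.zeros hab]

theorem mem_tableaux_iff {n : ℕ} {T : SemistandardYoungTableau lam} : T ∈ Tableaux n lam ↔
    ∀ j i, 1 ≤ j → 1 ≤ i → i ≤ col lam j → 1 ≤ val T j i ∧ val T j i ≤ n := by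
  constructor
  · intro h j i hj hi hij
    exact h (i - 1, j - 1) ((mem_lam_iff hi).2 hij)
  · rintro h ⟨a, b⟩ hab
    exact h (b + 1) (a + 1) (by omega) (by omega) (mem_lam_succ.1 hab)

/-- The tableau with given values in column `j` and row `i`. -/
noncomputable def tabOf (lam : YoungDiagram) (f : ℕ → ℕ → ℕ)
    (hr : ∀ i j l, 1 ≤ i → 1 ≤ j → j ≤ l → i ≤ col lam l → f j i ≤ f l i)
    (hc : ∀ j i k, 1 ≤ j → 1 ≤ i → i < k → k ≤ col lam j → f j i < f j k) :
    SemistandardYoungTableau lam := by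
  classical
  exact
  { entry := fun a b => if (a, b) ∈ lam then f (b + 1) (a + 1) else 0
    row_weak' := fun {i j1 j2} h hm => by
      rw [if_pos hm, if_pos (lam.up_left_mem le_rfl h.le hm)]
      exact hr _ _ _ (by omega) (by omega) (by omega) (mem_lam_succ.1 hm)
    col_strict' := fun {i1 i2 j} h hm => by
      rw [if_pos hm, if_pos (lam.up_left_mem h.le le_rfl hm)]
      exact hc _ _ _ (by omega) (by omega) (by omega) (mem_lam_succ.1 hm)
    zeros' := fun h => if_neg h }

theorem val_tabOf {f : ℕ → ℕ → ℕ}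
    {hr : ∀ i j l, 1 ≤ i → 1 ≤ j → j ≤ l → i ≤ col lam l → f j i ≤ f l i}
    {hc : ∀ j i k, 1 ≤ j → 1 ≤ i → i < k → k ≤ col lam j → f j i < f j k} {j i : ℕ} (hj : 1 ≤ j)
    (hi : 1 ≤ i) (h : i ≤ col lam j) : val (tabOf lam f hr hc) j i = f j i := by
  change (if (i - 1, j - 1) ∈ lam then f (j - 1 + 1) (i - 1 + 1) else 0) = f j i
  rw [if_pos ((mem_lam_iff hi).2 h), Nat.sub_add_cancel hj, Nat.sub_add_cancel hi]

/-! ### Row bounds -/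

/-- The largest tableau bounded by `β`. -/
theorem exists_maxTab {n : ℕ} (hlam : lam.colLen 0 ≤ n) {β : ℕ → ℕ} (hβ : β ∈ Upper n) :
    ∃ Q : SemistandardYoungTableau lam, Q ∈ Tableaux n lam ∧
      ∀ j i, 1 ≤ j → 1 ≤ i → i ≤ col lam j → val Q j i = colMax β (col lam j) i := by
  have hcn : ∀ j, col lam j ≤ n := fun j => (lam.colLen_anti 0 _ (by omega)).trans hlam
  refine ⟨tabOf lam (fun j i => colMax β (col lam j) i)
    (fun i j l hi hj hjl h => colMax_le_of_le h (col_anti hjl))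
    (fun j i k hj hi hik h => colMax_lt (Upper.le hβ (hcn j)) hi hik h), ?_,
    fun j i hj hi h => val_tabOf hj hi h⟩
  rw [mem_tableaux_iff]
  intro j i hj hi h
  rw [val_tabOf hj hi h]
  have h1 := self_le_colMax (Upper.le hβ (hcn j)) hi h
  have h2 := colMax_le_self (β := β) h
  have h3 := (hβ.1.1 i hi (h.trans (hcn j))).2
  omega

/-- Columns increase strictly, so a bound at `x` limits the entry at `i` by `β x - (x - i)`. -/
theorem mem_rowBound_iff {n : ℕ} {β : ℕ → ℕ} (hβ : β ∈ Upper n)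
    {T : SemistandardYoungTableau lam} : T ∈ RowBound n lam β ↔ T ∈ Tableaux n lam ∧
      ∀ j i, 1 ≤ j → 1 ≤ i → i ≤ col lam j → val T j i ≤ colMax β (col lam j) i := by
  refine and_congr_right fun hT => ⟨fun ⟨_, h⟩ j i hj hi hij => ?_, fun h =>
    ⟨hβ.2, fun j i hj hi hij => (h j i hj hi hij).trans (colMax_le_self hij)⟩⟩
  exact le_colMax hij fun x hx hx' =>
    (val_add_le T hi hx hx').trans (h j x hj (by omega) hx')

/-! ### Scanning -/

theorem le_ewisLast (x : ℕ → ℕ) (j d : ℕ) : x (j + d) ≤ ewisLast x j d := by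
  cases d with
  | zero => exact le_rfl
  | succ d =>
    rw [ewisLast]
    split_ifs with h
    · rfl
    · exact (not_le.1 h).le

theorem ewisLast_mono (x : ℕ → ℕ) (j : ℕ) {d d' : ℕ} (h : d ≤ d') :
    ewisLast x j d ≤ ewisLast x j d' := by
  induction d', h using Nat.le_induction with
  | base => exact le_rfl
  | succ d' h ih =>
    refine ih.trans ?_
    rw [ewisLast]
    split_ifs with h'
    · exact h'
    · exact le_rfl

theorem ewisMem_succ (x : ℕ → ℕ) (j d : ℕ) :
    EwisMem x j (j + d + 1) ↔ ewisLast x j d ≤ x (j + d + 1) := by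
  rw [EwisMem, show j + d + 1 - 1 - j = d by omega]
  constructor
  · rintro (h | h)
    · omega
    · exact h.2
  · intro h
    exact .inr ⟨by omega, h⟩

theorem ewisMem_self (x : ℕ → ℕ) (j : ℕ) : EwisMem x j j := .inl rfl

theorem ewisLast_of_mem {x : ℕ → ℕ} {j d : ℕ} (h : EwisMem x j (j + d)) :
    ewisLast x j d = x (j + d) := by
  cases d with
  | zero => rfl
  | succ d => rw [← add_assoc, ewisMem_succ] at h; rw [ewisLast, if_pos h, add_assoc]

theorem exists_ewisLast_eq (x : ℕ → ℕ) (j d : ℕ) :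
    ∃ l, j ≤ l ∧ l ≤ j + d ∧ ewisLast x j d = x l := by
  induction d with
  | zero => exact ⟨j, le_rfl, le_rfl, rfl⟩
  | succ d ih =>
    rw [ewisLast]
    split_ifs with h
    · exact ⟨j + d + 1, by omega, by omega, rfl⟩
    · obtain ⟨l, h1, h2, h3⟩ := ih
      exact ⟨l, h1, by omega, h3⟩

/-! ### Heights and values of scanning paths -/

section scan

variable (T : SemistandardYoungTableau lam) (j : ℕ)

theorem scanHeights_zero (l : ℕ) :
    scanHeights T j 0 l = if j ≤ l then col lam l else 0 := rfl

theorem scanHeights_succ (k l : ℕ) : scanHeights T j (k + 1) l =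
    if EwisMem (bottom T (scanHeights T j k)) j l then scanHeights T j k l - 1
    else scanHeights T j k l := rfl

theorem scanHeights_self (k : ℕ) : scanHeights T j k j = col lam j - k := by
  induction k with
  | zero => simp [scanHeights]
  | succ k ih =>
    rw [scanHeights_succ, if_pos (ewisMem_self _ _), ih]
    omega

theorem scanHeights_le (k l : ℕ) : scanHeights T j k l ≤ col lam l := by
  induction k with
  | zero => rw [scanHeights_zero]; split_ifs <;> omega
  | succ k ih => rw [scanHeights_succ]; split_ifs <;> omega

/-- The unmarked boxes always form a shape: if a path takes the bottom box of one column and the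
next column is equally high, its bottom value in the same row is at least as large, so the path
takes that too. -/
theorem scanHeights_anti (k l : ℕ) (hl : j ≤ l) :
    scanHeights T j k (l + 1) ≤ scanHeights T j k l := by
  induction k with
  | zero =>
    rw [scanHeights_zero, scanHeights_zero, if_pos hl, if_pos (by omega)]
    exact col_anti (by omega)
  | succ k ih =>
    obtain ⟨d, rfl⟩ : ∃ d, l = j + d := ⟨l - j, by omega⟩
    rw [scanHeights_succ, scanHeights_succ]
    by_cases h : EwisMem (bottom T (scanHeights T j k)) j (j + d)
    · rw [if_pos h]
      rcases ih.eq_or_lt with he | hlt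
      · rcases Nat.eq_zero_or_pos (scanHeights T j k (j + d)) with h0 | hpos
        · rw [he, h0]; split_ifs <;> omega
        · have h' : EwisMem (bottom T (scanHeights T j k)) j (j + d + 1) := by
            rw [ewisMem_succ, ewisLast_of_mem h, bottom, bottom, he, if_neg (by omega),
              if_neg (by omega)]
            exact val_row T hpos (by omega) (he ▸ scanHeights_le T j k _)
          rw [if_pos h', he]
      · split_ifs <;> omega
    · rw [if_neg h]
      split_ifs <;> omega

theorem scanHeights_le_self (k l : ℕ) (hl : j ≤ l) :
    scanHeights T j k l ≤ col lam j - k := by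
  induction l, hl using Nat.le_induction with
  | base => exact (scanHeights_self T j k).le
  | succ l hl ih => exact (scanHeights_anti T j k l hl).trans ih

variable {T j}

theorem bottom_self {k i : ℕ} (hi : 1 ≤ i) (hk : i + k = col lam j) :
    bottom T (scanHeights T j k) j = val T j i := by
  rw [bottom, scanHeights_self, show col lam j - k = i by omega, if_neg (by omega)]

theorem val_le_scanVal {i : ℕ} (hi : 1 ≤ i) (h : i ≤ col lam j) :
    val T j i ≤ scanVal T j i := by
  rw [scanVal, ← bottom_self (T := T) hi (show i + (col lam j - i) = col lam j by omega)]
  exact ewisLast_mono (bottom T (scanHeights T j (col lam j - i))) j (Nat.zero_le _)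

/-- Scanning paths do not go down. -/
theorem exists_scanVal_eq {n : ℕ} (hT : T ∈ Tableaux n lam) (hj : 1 ≤ j) {i : ℕ} (hi : 1 ≤ i)
    (h : i ≤ col lam j) : ∃ l k, 1 ≤ l ∧ j ≤ l ∧ 1 ≤ k ∧ k ≤ i ∧ k ≤ col lam l ∧
      scanVal T j i = val T l k := by
  have hpos := ((mem_tableaux_iff.1 hT) j i hj hi h).1.trans (val_le_scanVal (T := T) hi h)
  obtain ⟨l, hl1, -, hl3⟩ :=
    exists_ewisLast_eq (bottom T (scanHeights T j (col lam j - i))) j (row lam 1 - j)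
  rw [scanVal, hl3, bottom] at hpos
  rw [scanVal, hl3, bottom]
  split_ifs at hpos ⊢ with h0
  · omega
  · have := scanHeights_le_self T j (col lam j - i) l hl1
    exact ⟨l, _, by omega, hl1, by omega, by omega, scanHeights_le _ _ _ _, rfl⟩

/-- Successive scanning paths do not meet. -/
theorem scanVal_lt_succ {n : ℕ} (hT : T ∈ Tableaux n lam) (hj : 1 ≤ j) {i : ℕ} (hi : 1 ≤ i)
    (h : i + 1 ≤ col lam j) : scanVal T j i < scanVal T j (i + 1) := by
  obtain ⟨k, hk⟩ : ∃ k, i + 1 + k = col lam j := ⟨col lam j - (i + 1), by omega⟩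
  rw [scanVal, scanVal, show col lam j - i = k + 1 by omega,
    show col lam j - (i + 1) = k by omega]
  -- Compare the two paths column by column. Where the earlier path takes a box, the later one finds
  -- a smaller bottom value above it; where it does not, both see the same bottom value, which is
  -- below the last value of the earlier path.
  have key : ∀ d, 1 ≤ ewisLast (bottom T (scanHeights T j k)) j d ∧
      ewisLast (bottom T (scanHeights T j (k + 1))) j d <
        ewisLast (bottom T (scanHeights T j k)) j d := by
    intro d
    induction d with
    | zero =>
      rw [ewisLast, ewisLast, bottom_self (k := k + 1) hi (by omega),
        bottom_self (k := k) (i := i + 1) (by omega) hk]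
      exact ⟨((mem_tableaux_iff.1 hT) j (i + 1) hj (by omega) h).1,
        val_col T hi (by omega) h⟩
    | succ d ih =>
      obtain ⟨ih1, ih2⟩ := ih
      have hx' : ∀ c l, c = scanHeights T j (k + 1) l →
          bottom T (scanHeights T j (k + 1)) l = if c = 0 then 0 else val T l c := by
        rintro _ l rfl; rfl
      have hpos := ih1.trans (ewisLast_mono (bottom T (scanHeights T j k)) j (Nat.le_succ d))
      refine ⟨hpos, ?_⟩
      rw [ewisLast, ewisLast]
      by_cases hs : ewisLast (bottom T (scanHeights T j k)) j d ≤
          bottom T (scanHeights T j k) (j + d + 1)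
      · rw [if_pos hs]
        have hb : bottom T (scanHeights T j (k + 1)) (j + d + 1) <
            bottom T (scanHeights T j k) (j + d + 1) := by
          have hc : scanHeights T j (k + 1) (j + d + 1) = scanHeights T j k (j + d + 1) - 1 := by
            rw [scanHeights_succ, if_pos ((ewisMem_succ _ _ _).2 hs)]
          have hle := scanHeights_le T j k (j + d + 1)
          have hp : 1 ≤ bottom T (scanHeights T j k) (j + d + 1) := ih1.trans hs
          rw [hx' _ _ hc.symm]
          split_ifs with h0
          · exact hp
          · rw [bottom, if_neg (by omega)]
            exact val_col T (by omega) (by omega) hle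
        split_ifs
        · exact hb
        · exact ih2.trans_le hs
      · rw [if_neg hs]
        have hc : scanHeights T j (k + 1) (j + d + 1) = scanHeights T j k (j + d + 1) := by
          rw [scanHeights_succ, if_neg (fun h => hs ((ewisMem_succ _ _ _).1 h))]
        have hb : bottom T (scanHeights T j (k + 1)) (j + d + 1) =
            bottom T (scanHeights T j k) (j + d + 1) := by
          rw [hx' _ _ hc.symm, bottom]
        rw [hb]
        split_ifs
        · exact not_le.1 hs
        · exact ih2
  exact (key _).2

/-- A column that contains all the later columns is not changed by scanning. -/
theorem scanVal_eq_of_subset (hs : ∀ l, j ≤ l → ∀ t, 1 ≤ t → t ≤ col lam l →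
    ∃ s, 1 ≤ s ∧ s ≤ col lam j ∧ val T l t = val T j s) {i : ℕ} (hi : 1 ≤ i)
    (h : i ≤ col lam j) : scanVal T j i = val T j i := by
  -- A path that starts with the largest bottom value never leaves that value.
  have hlast : ∀ k, k < col lam j →
      (∀ l, j ≤ l → 1 ≤ scanHeights T j k l →
        val T l (scanHeights T j k l) ≤ val T j (col lam j - k)) →
      ∀ d, ewisLast (bottom T (scanHeights T j k)) j d = val T j (col lam j - k) := by
    intro k hk hb d
    have hle : ∀ l, j ≤ l → bottom T (scanHeights T j k) l ≤ val T j (col lam j - k) := by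
      intro l hl
      rw [bottom]
      split_ifs with h0
      · exact Nat.zero_le _
      · exact hb l hl (by omega)
    induction d with
    | zero => rw [ewisLast, bottom_self (i := col lam j - k) (by omega) (by omega)]
    | succ d ih =>
      rw [ewisLast, ih]
      split_ifs with h'
      · exact le_antisymm (hle _ (by omega)) h'
      · rfl
  -- Each path removes every bottom box with its value. The remaining bottom values are smaller and
  -- occur in column `j`, so they are at most the entry there with which the next path starts.
  have key : ∀ k, k < col lam j → ∀ l, j ≤ l → 1 ≤ scanHeights T j k l →
      val T l (scanHeights T j k l) ≤ val T j (col lam j - k) := by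
    intro k
    induction k with
    | zero =>
      intro hk l hl h1
      have hle := scanHeights_le T j 0 l
      obtain ⟨s, hs1, hs2, hs3⟩ := hs l hl _ h1 hle
      rw [hs3, Nat.sub_zero]
      exact val_col_le T hs1 hs2 le_rfl
    | succ k ih =>
      intro hk l hl h1
      have hL := hlast k (by omega) (ih (by omega))
      have hlt : val T l (scanHeights T j (k + 1) l) < val T j (col lam j - k) := by
        obtain ⟨d, rfl⟩ : ∃ d, l = j + d := ⟨l - j, by omega⟩
        have hle := scanHeights_le T j k (j + d)
        rw [scanHeights_succ] at h1 ⊢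
        split_ifs at h1 ⊢ with hm
        · have he := ewisLast_of_mem hm
          rw [hL, bottom, if_neg (by omega)] at he
          rw [he]
          exact val_col T h1 (by omega) hle
        · refine lt_of_le_of_ne (ih (by omega) _ hl h1) fun he => hm ?_
          cases d with
          | zero => exact ewisMem_self _ _
          | succ d =>
            rw [← add_assoc, ewisMem_succ, hL, ← he, bottom, if_neg (by
              rw [← add_assoc] at h1; omega), add_assoc]
      obtain ⟨s, hs1, hs2, hs3⟩ := hs l hl _ h1 (scanHeights_le T j (k + 1) l)
      rw [hs3] at hlt ⊢
      have := lt_of_val_lt T (by omega) hs2 hlt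
      exact val_col_le T hs1 (by omega) (by omega)
  rw [scanVal, hlast _ (by omega) (key _ (by omega)), show col lam j - (col lam j - i) = i by omega]

/-- If a later column contains a value `c` that is not in column `j`, then the scanning path from
each smaller value of column `j`, after all larger values, ends at `c` or beyond. -/
theorem le_scanVal_of_later {i l t c : ℕ}
    (hi : 1 ≤ i) (h : i ≤ col lam j) (hjl : j ≤ l) (ht : 1 ≤ t) (htl : t ≤ col lam l)
    (hval : val T l t = c) (hbig : ∀ k, i < k → k ≤ col lam j → c < val T j k) :
    c ≤ scanVal T j i := by
  have hlr : l ≤ row lam 1 := by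
    have : (t - 1, l - 1) ∈ lam := (mem_lam_iff ht).2 htl
    have h0 : (0, l - 1) ∈ lam := lam.up_left_mem (Nat.zero_le _) le_rfl this
    rw [YoungDiagram.mem_iff_lt_rowLen] at h0
    rw [row]
    simp only [Nat.sub_self]
    omega
  obtain ⟨d, rfl⟩ : ∃ d, l = j + d := ⟨l - j, by omega⟩
  -- A path that took box `t` of column `l` would have last value `c` there, although it started
  -- above `c`. So the box is still unmarked when the path from row `i` begins.
  have key : ∀ k, k ≤ col lam j - i → t ≤ scanHeights T j k (j + d) := by
    intro k
    induction k with
    | zero => intro _; rw [scanHeights_zero, if_pos hjl]; exact htl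
    | succ k ih =>
      intro hk
      have ih' := ih (by omega)
      rw [scanHeights_succ]
      split_ifs with hm
      · rcases ih'.eq_or_lt with he | hlt
        · exfalso
          have h1 := ewisLast_of_mem hm
          rw [bottom, if_neg (by omega), ← he, hval] at h1
          have h2 := ewisLast_mono (bottom T (scanHeights T j k)) j (Nat.zero_le d)
          rw [ewisLast, bottom_self (i := col lam j - k) (by omega) (by omega)] at h2
          have := hbig (col lam j - k) (by omega) (by omega)
          omega
        · omega
      · exact ih'
  have hk := key _ le_rfl
  rw [scanVal]
  refine le_trans ?_ ((le_ewisLast _ j d).trans (ewisLast_mono _ j (show d ≤ row lam 1 - j by omega)))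
  rw [bottom, if_neg (by omega), ← hval]
  exact val_col_le T ht hk (scanHeights_le _ _ _ _)

end scan

end tableaux

/-! ### Keys, Demazure tableaux and row bound tableaux -/

/-- The column lengths of `lam` are the `q h` with `1 ≤ h ≤ r`, and possibly `n = q (r + 1)`. -/
structure HasColumns (n r : ℕ) (q : ℕ → ℕ) (lam : YoungDiagram) : Prop where
  le_top : lam.colLen 0 ≤ n
  col_eq : ∀ j, 1 ≤ j → j ≤ row lam 1 → ∃ h, 1 ≤ h ∧ h ≤ r + 1 ∧ col lam j = q h
  exists_col : ∀ h, 1 ≤ h → h ≤ r → ∃ j, 1 ≤ j ∧ col lam j = q h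

section keys

variable {n r : ℕ} {q : ℕ → ℕ} {lam : YoungDiagram}

theorem le_row_one {i j : ℕ} (hj : 1 ≤ j) (hi : 1 ≤ i) (h : i ≤ col lam j) : j ≤ row lam 1 := by
  have h0 : (0, j - 1) ∈ lam := lam.up_left_mem (Nat.zero_le _) le_rfl ((mem_lam_iff hi).2 h)
  rw [YoungDiagram.mem_iff_lt_rowLen] at h0
  rw [row]
  simp only [Nat.sub_self]
  omega

theorem HasColumns.exists_eq (S : HasColumns n r q lam) {i j : ℕ} (hj : 1 ≤ j) (hi : 1 ≤ i)
    (h : i ≤ col lam j) : ∃ h, 1 ≤ h ∧ h ≤ r + 1 ∧ col lam j = q h :=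
  S.col_eq j hj (le_row_one hj hi h)

theorem HasColumns.col_le (S : HasColumns n r q lam) (j : ℕ) : col lam j ≤ n :=
  (lam.colLen_anti 0 _ (by omega)).trans S.le_top

theorem keyVal_eq_srt (π : ℕ → ℕ) (j i : ℕ) :
    keyVal lam π j i = srt ((Finset.Icc 1 (col lam j)).image π) i := by
  rw [keyVal, srt]
  congr 1
  funext v
  simp only [Finset.mem_image, Finset.mem_Icc, eq_iff_iff]
  constructor
  · rintro ⟨k, h1, h2, rfl⟩; exact ⟨k, ⟨h1, h2⟩, rfl⟩
  · rintro ⟨k, ⟨h1, h2⟩, rfl⟩; exact ⟨k, h1, h2, rfl⟩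

theorem keyVal_eq_srt_chainOf (π : ℕ → ℕ) {j h : ℕ} (i : ℕ) (hh : h ≤ r + 1)
    (hc : col lam j = q h) : keyVal lam π j i = srt (chainOf r q π h) i := by
  rw [keyVal_eq_srt, chainOf_apply π hh, hc]

theorem card_image_le_col (S : HasColumns n r q lam) {π : ℕ → ℕ} (hπ : π ∈ RPerms n r q) (j : ℕ) :
    ((Finset.Icc 1 (col lam j)).image π).card = col lam j := by
  rw [Finset.card_image_of_injOn, Nat.card_Icc, Nat.add_sub_cancel]
  have := S.col_le j
  exact hπ.2.1.mono fun k hk => by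
    simp only [Finset.coe_Icc, Set.mem_Icc] at hk ⊢; omega

/-- The `λ`-key of `π`. -/
noncomputable def keyTab (lam : YoungDiagram) (π : ℕ → ℕ) : SemistandardYoungTableau lam :=
  Classical.epsilon fun Y => ∀ j i, 1 ≤ j → 1 ≤ i → i ≤ col lam j → val Y j i = keyVal lam π j i

theorem val_keyTab (S : HasColumns n r q lam) {π : ℕ → ℕ} (hπ : π ∈ RPerms n r q) {j i : ℕ}
    (hj : 1 ≤ j) (hi : 1 ≤ i) (h : i ≤ col lam j) : val (keyTab lam π) j i = keyVal lam π j i := by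
  have hex : ∃ Y : SemistandardYoungTableau lam,
      ∀ j i, 1 ≤ j → 1 ≤ i → i ≤ col lam j → val Y j i = keyVal lam π j i := by
    refine ⟨tabOf lam (fun j i => keyVal lam π j i) (fun i j l hi hj hjl h => ?_)
      (fun j i k hj hi hik h => ?_), fun j i hj hi h => val_tabOf hj hi h⟩
    · rw [keyVal_eq_srt, keyVal_eq_srt]
      refine srt_le_srt_of_subset (Finset.image_subset_image
        (Finset.Icc_subset_Icc le_rfl (col_anti hjl))) hi ?_
      rwa [card_image_le_col S hπ]
    · rw [keyVal_eq_srt, keyVal_eq_srt]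
      refine srt_lt hi hik ?_
      rwa [card_image_le_col S hπ]
  exact Classical.epsilon_spec hex j i hj hi h

theorem keyVal_mem (S : HasColumns n r q lam) {π : ℕ → ℕ} (hπ : π ∈ RPerms n r q) {j i : ℕ}
    (hi : 1 ≤ i) (h : i ≤ col lam j) :
    keyVal lam π j i ∈ (Finset.Icc 1 (col lam j)).image π := by
  rw [keyVal_eq_srt]
  exact srt_mem hi (by rwa [card_image_le_col S hπ])

theorem exists_keyVal_eq (S : HasColumns n r q lam) {π : ℕ → ℕ} (hπ : π ∈ RPerms n r q) {j v : ℕ}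
    (hv : v ∈ (Finset.Icc 1 (col lam j)).image π) :
    ∃ i, 1 ≤ i ∧ i ≤ col lam j ∧ keyVal lam π j i = v := by
  obtain ⟨i, h1, h2, h3⟩ := exists_srt_eq hv
  rw [card_image_le_col S hπ] at h2
  exact ⟨i, h1, h2, by rw [keyVal_eq_srt, h3]⟩

theorem keyTab_mem_tableaux (S : HasColumns n r q lam) {π : ℕ → ℕ} (hπ : π ∈ RPerms n r q) :
    keyTab lam π ∈ Tableaux n lam := by
  rw [mem_tableaux_iff]
  intro j i hj hi h
  rw [val_keyTab S hπ hj hi h]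
  obtain ⟨k, hk, hk'⟩ := Finset.mem_image.1 (keyVal_mem S hπ hi h)
  rw [Finset.mem_Icc] at hk
  have := S.col_le j
  rw [← hk']
  exact hπ.1.1 k (by omega) (by omega)

theorem mem_colSet_keyTab (S : HasColumns n r q lam) {π : ℕ → ℕ} (hπ : π ∈ RPerms n r q) {j v : ℕ}
    (hj : 1 ≤ j) :
    v ∈ colSet (keyTab lam π) j ↔ v ∈ (Finset.Icc 1 (col lam j)).image π := by
  constructor
  · rintro ⟨i, hi, h, rfl⟩
    rw [val_keyTab S hπ hj hi h]
    exact keyVal_mem S hπ hi h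
  · intro hv
    obtain ⟨i, hi, h, rfl⟩ := exists_keyVal_eq S hπ hv
    exact ⟨i, hi, h, (val_keyTab S hπ hj hi h).symm⟩

theorem scanVal_keyTab (S : HasColumns n r q lam) {π : ℕ → ℕ} (hπ : π ∈ RPerms n r q) {j i : ℕ}
    (hj : 1 ≤ j) (hi : 1 ≤ i) (h : i ≤ col lam j) :
    scanVal (keyTab lam π) j i = keyVal lam π j i := by
  rw [scanVal_eq_of_subset _ hi h, val_keyTab S hπ hj hi h]
  intro l hl t ht htl
  have hm := keyVal_mem S hπ ht htl
  have hm' := Finset.image_subset_image (f := π) (Finset.Icc_subset_Icc (le_refl 1) (col_anti hl)) hm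
  obtain ⟨s, h1, h2, h3⟩ := exists_keyVal_eq S hπ hm'
  exact ⟨s, h1, h2, by rw [val_keyTab S hπ (by omega) ht htl, val_keyTab S hπ hj h1 h2, h3]⟩

/-- Keys are fixed by scanning, so membership of a key compares two keys; this makes the Demazure
sets of distinct permutations distinct. -/
theorem keyTab_mem_demazure_iff (S : HasColumns n r q lam) {π π' : ℕ → ℕ} (hπ : π ∈ RPerms n r q) :
    keyTab lam π ∈ Demazure n lam π' ↔ ∀ j i, 1 ≤ j → 1 ≤ i → i ≤ col lam j →
      keyVal lam π j i ≤ keyVal lam π' j i := by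
  constructor
  · rintro ⟨-, h⟩ j i hj hi hij
    rw [← scanVal_keyTab S hπ hj hi hij]
    exact h j i hj hi hij
  · intro h
    refine ⟨keyTab_mem_tableaux S hπ, fun j i hj hi hij => ?_⟩
    rw [scanVal_keyTab S hπ hj hi hij]
    exact h j i hj hi hij

theorem keyTab_mem_demazure (S : HasColumns n r q lam) {π : ℕ → ℕ} (hπ : π ∈ RPerms n r q) :
    keyTab lam π ∈ Demazure n lam π :=
  (keyTab_mem_demazure_iff S hπ).2 fun _ _ _ _ _ => le_rfl

theorem val_le_keyVal_of_mem_demazure {π : ℕ → ℕ} {T : SemistandardYoungTableau lam}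
    (hT : T ∈ Demazure n lam π) {j i : ℕ} (hj : 1 ≤ j) (hi : 1 ≤ i) (h : i ≤ col lam j) :
    val T j i ≤ keyVal lam π j i :=
  (val_le_scanVal hi h).trans (hT.2 j i hj hi h)

/-- Each length `q h` with `1 ≤ h ≤ r` occurs among the columns, so the key shows all sets of the
chain except its two fixed ends. -/
theorem chainOf_eq_of_keyVal_eq (E : CarrelEnum n r q) (S : HasColumns n r q lam) {π : ℕ → ℕ}
    {B : ℕ → Finset ℕ} (hπ : π ∈ RPerms n r q) (hB : B ∈ RChains n r q)
    (h : ∀ j h, 1 ≤ j → 1 ≤ h → h ≤ r → col lam j = q h → ∀ i, 1 ≤ i → i ≤ col lam j →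
      keyVal lam π j i = srt (B h) i) : chainOf r q π = B := by
  have hC := (chainOf_bijOn E).mapsTo hπ
  funext g
  rcases Nat.eq_zero_or_pos g with rfl | hg
  · rw [hC.1, hB.1]
  rcases lt_trichotomy g (r + 1) with hlt | rfl | hgt
  · obtain ⟨j, hj, hc⟩ := S.exists_col g hg (by omega)
    have hcard := hC.2.2.2.1 g hg (by omega)
    refine eq_of_srt_eq (hcard.trans (hB.2.2.2.1 g hg (by omega)).symm) fun i h1 h2 => ?_
    rw [← keyVal_eq_srt_chainOf π i (by omega) hc]
    exact h j g hj hg (by omega) hc i h1 (by omega)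
  · rw [hC.2.1, hB.2.1]
  · rw [hC.2.2.2.2 g hgt, hB.2.2.2.2 g hgt]

theorem eq_of_keyVal_eq (E : CarrelEnum n r q) (S : HasColumns n r q lam) {π π' : ℕ → ℕ}
    (hπ : π ∈ RPerms n r q) (hπ' : π' ∈ RPerms n r q)
    (h : ∀ j i, 1 ≤ j → 1 ≤ i → i ≤ col lam j → keyVal lam π j i = keyVal lam π' j i) :
    π = π' := by
  refine (chainOf_bijOn E).injOn hπ hπ' (chainOf_eq_of_keyVal_eq E S hπ
    ((chainOf_bijOn E).mapsTo hπ') fun j g hj _ hg hc i hi hij => ?_)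
  rw [h j i hj hi hij, keyVal_eq_srt_chainOf (r := r) π' i (by omega) hc]

theorem demazure_injOn (E : CarrelEnum n r q) (S : HasColumns n r q lam) :
    Set.InjOn (Demazure n lam) (RPerms n r q) := by
  intro π hπ π' hπ' he
  have h1 := (keyTab_mem_demazure_iff (π' := π') S hπ).1 (he ▸ keyTab_mem_demazure S hπ)
  have h2 := (keyTab_mem_demazure_iff (π' := π) S hπ').1 (he ▸ keyTab_mem_demazure S hπ')
  exact eq_of_keyVal_eq E S hπ hπ' fun j i hj hi h =>
    le_antisymm (h1 j i hj hi h) (h2 j i hj hi h)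

/-! ### Row bound sets and cores -/

theorem colMax_eq_of_core_eq (E : CarrelEnum n r q) (S : HasColumns n r q lam) {β β' : ℕ → ℕ}
    (hβ : β ∈ Upper n) (hβ' : β' ∈ Upper n) (he : core n r q β = core n r q β') {j i : ℕ}
    (hj : 1 ≤ j) (hi : 1 ≤ i) (h : i ≤ col lam j) :
    colMax β (col lam j) i = colMax β' (col lam j) i := by
  obtain ⟨g, -, hg, hc⟩ := S.exists_eq hj hi h
  rw [hc] at h ⊢
  rw [← colMax_core E hβ hg hi h, ← colMax_core E hβ' hg hi h, he]

theorem core_eq_of_colMax_eq (E : CarrelEnum n r q) (S : HasColumns n r q lam) {β β' : ℕ → ℕ}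
    (hβ : β ∈ Upper n) (hβ' : β' ∈ Upper n)
    (he : ∀ j i, 1 ≤ j → 1 ≤ i → i ≤ col lam j → colMax β (col lam j) i = colMax β' (col lam j) i) :
    core n r q β = core n r q β' := by
  have h1 := core_mem_upperIncreasing E hβ
  have h2 := core_mem_upperIncreasing E hβ'
  refine Tuples.ext h1.1.1 h2.1.1 fun i hi hin => ?_
  obtain ⟨g, hg1, hg2, hg3, hg4⟩ := E.exists_carrel hi hin
  rcases hg2.eq_or_lt with rfl | hlt
  · rw [Nat.add_sub_cancel] at hg3
    rw [upperIncreasing_last E h1 hg3 hin, upperIncreasing_last E h2 hg3 hin]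
  · obtain ⟨j, hj, hc⟩ := S.exists_col g hg1 (by omega)
    rw [core_eq_colMax E hβ hg1 hg2 hg3 hg4, core_eq_colMax E hβ' hg1 hg2 hg3 hg4, ← hc]
    exact he j i hj hi (by omega)

/-- Compare the largest tableaux of the two sets: their columns are `colMax`, from which the core
can be read off, except on the last carrel, where it is the identity. -/
theorem rowBound_eq_iff (E : CarrelEnum n r q) (S : HasColumns n r q lam) {β β' : ℕ → ℕ}
    (hβ : β ∈ Upper n) (hβ' : β' ∈ Upper n) :
    RowBound n lam β = RowBound n lam β' ↔ core n r q β = core n r q β' := by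
  constructor
  · intro h
    obtain ⟨Q, hQ, hQv⟩ := exists_maxTab S.le_top hβ
    obtain ⟨Q', hQ', hQv'⟩ := exists_maxTab S.le_top hβ'
    have h1 : Q ∈ RowBound n lam β' := h ▸ (mem_rowBound_iff hβ).2
      ⟨hQ, fun j i hj hi hij => (hQv j i hj hi hij).le⟩
    have h2 : Q' ∈ RowBound n lam β := h ▸ (mem_rowBound_iff hβ').2
      ⟨hQ', fun j i hj hi hij => (hQv' j i hj hi hij).le⟩
    refine core_eq_of_colMax_eq E S hβ hβ' fun j i hj hi hij => le_antisymm ?_ ?_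
    · rw [← hQv j i hj hi hij]; exact ((mem_rowBound_iff hβ').1 h1).2 j i hj hi hij
    · rw [← hQv' j i hj hi hij]; exact ((mem_rowBound_iff hβ).1 h2).2 j i hj hi hij
  · intro he
    ext T
    rw [mem_rowBound_iff hβ, mem_rowBound_iff hβ']
    refine and_congr_right fun _ => forall_congr' fun j => forall_congr' fun i => ?_
    refine forall_congr' fun hj => forall_congr' fun hi => forall_congr' fun hij => ?_
    rw [colMax_eq_of_core_eq E S hβ hβ' he hj hi hij]

theorem keyVal_eq_colMax (E : CarrelEnum n r q) (S : HasColumns n r q lam) {β π : ℕ → ℕ}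
    (hβ : β ∈ Upper n) (h : colMaxChain r q β = chainOf r q π) {j i : ℕ} (hj : 1 ≤ j) (hi : 1 ≤ i)
    (hij : i ≤ col lam j) : keyVal lam π j i = colMax β (col lam j) i := by
  obtain ⟨g, hg1, hg2, hc⟩ := S.exists_eq hj hi hij
  rw [keyVal_eq_srt_chainOf π i hg2 hc, ← h, hc, srt_colMaxChain E hβ hg2 hi (hc ▸ hij)]

/-- For a flag, the scanning tableau satisfies the row bounds as soon as `T` does. Its columns are
strict, so it lies under `colMax`, the key. The converse inclusion holds because `T` lies under its
scanning tableau. -/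
theorem rowBound_upperFlag_eq_demazure (E : CarrelEnum n r q) (S : HasColumns n r q lam)
    {φ π : ℕ → ℕ} (hφ : φ ∈ UpperFlags n) (h : colMaxChain r q φ = chainOf r q π) :
    RowBound n lam φ = Demazure n lam π := by
  ext T
  rw [mem_rowBound_iff hφ.1]
  refine and_congr_right fun hT => ⟨fun hv j i hj hi hij => ?_, fun hv j i hj hi hij => ?_⟩
  · rw [keyVal_eq_colMax E S hφ.1 h hj hi hij]
    -- The value in row `x` originates in some row `k ≤ x`, and `φ k ≤ φ x`.
    have hb : ∀ x, 1 ≤ x → x ≤ col lam j → scanVal T j x ≤ φ x := by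
      intro x hx hxj
      obtain ⟨l, k, hl, -, hk, hkx, hkl, he⟩ := exists_scanVal_eq hT hj hx hxj
      rw [he]
      exact ((hv l k hl hk hkl).trans (colMax_le_self hkl)).trans
        (hφ.2 k x hk hkx (hxj.trans (S.col_le j)))
    refine le_colMax hij fun x hx hxj => le_trans ?_ (hb x (by omega) hxj)
    induction x, hx using Nat.le_induction with
    | base => simp
    | succ x hx ih =>
      have := ih (by omega)
      have := scanVal_lt_succ hT hj (i := x) (by omega) hxj
      omega
  · rw [← keyVal_eq_colMax E S hφ.1 h hj hi hij]
    exact (val_le_scanVal hi hij).trans (hv j i hj hi hij)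

/-- Both sides depend only on the core, which is also the core of a flag. -/
theorem rowBound_eq_demazure (E : CarrelEnum n r q) (S : HasColumns n r q lam) {β π : ℕ → ℕ}
    (hβ : β ∈ Upper n) (hF : core n r q β ∈ Gapless n r q)
    (h : colMaxChain r q β = chainOf r q π) : RowBound n lam β = Demazure n lam π := by
  obtain ⟨φ, hφ, he⟩ := exists_upperFlag_core_eq E hF
  rw [(rowBound_eq_iff E S hβ hφ.1).2 he.symm]
  refine rowBound_upperFlag_eq_demazure E S hφ ?_
  rw [← h, ← colMaxChain_core E hφ.1, he, colMaxChain_core E hβ]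

/-- For each gapless core there is a `312`-avoiding permutation with the same tableau set. -/
theorem exists_avoid312_demazure_eq (E : CarrelEnum n r q) (S : HasColumns n r q lam) {β : ℕ → ℕ}
    (hβ : β ∈ Upper n) (hF : core n r q β ∈ Gapless n r q) :
    ∃ π ∈ Avoid312 n r q, RowBound n lam β = Demazure n lam π := by
  have hm := (colMaxChain_bijOn E).mapsTo hF
  rw [colMaxChain_core E hβ] at hm
  obtain ⟨π, hπ, he⟩ := (chainOf_bijOn_avoid E).surjOn hm
  exact ⟨π, hπ, rowBound_eq_demazure E S hβ hF he.symm⟩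

theorem exists_gapless_rowBound_eq (E : CarrelEnum n r q) (S : HasColumns n r q lam) {π : ℕ → ℕ}
    (hπ : π ∈ Avoid312 n r q) : ∃ γ ∈ Gapless n r q, RowBound n lam γ = Demazure n lam π := by
  obtain ⟨γ, hγ, he⟩ := (colMaxChain_bijOn E).surjOn ((chainOf_bijOn_avoid E).mapsTo hπ)
  exact ⟨γ, hγ, rowBound_eq_demazure E S hγ.1.1 (by rwa [core_eq_self E hγ.1]) he⟩

theorem rowBound_image_eq (E : CarrelEnum n r q) (S : HasColumns n r q lam) {U : Set (ℕ → ℕ)}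
    (hU : U ⊆ Upper n) (hc : core n r q '' U = Gapless n r q) :
    RowBound n lam '' U = Demazure n lam '' Avoid312 n r q := by
  ext D
  constructor
  · rintro ⟨β, hβ, rfl⟩
    obtain ⟨π, hπ, he⟩ := exists_avoid312_demazure_eq (lam := lam) E S (hU hβ)
      (hc ▸ Set.mem_image_of_mem _ hβ)
    exact ⟨π, hπ, he.symm⟩
  · rintro ⟨π, hπ, rfl⟩
    obtain ⟨γ, hγ, he⟩ := exists_gapless_rowBound_eq E S hπ
    have hγ' := hγ
    rw [← hc] at hγ'
    obtain ⟨β, hβ, hβγ⟩ := hγ'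
    exact ⟨β, hβ, by rw [← he, rowBound_eq_iff E S (hU hβ) hγ.1.1, hβγ, core_eq_self E hγ.1]⟩

/-! ### Gapless keys -/

theorem keyTab_mem_keys (S : HasColumns n r q lam) {π : ℕ → ℕ} (hπ : π ∈ RPerms n r q) :
    keyTab lam π ∈ Keys n lam := by
  refine ⟨keyTab_mem_tableaux S hπ, fun l j hl hlj _ v hv => ?_⟩
  rw [mem_colSet_keyTab S hπ (by omega)] at hv ⊢
  exact Finset.image_subset_image (Finset.Icc_subset_Icc le_rfl (col_anti hlj)) hv

/-- The values in the `j`-th column. -/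
def colFinset (T : SemistandardYoungTableau lam) (j : ℕ) : Finset ℕ :=
  (Finset.Icc 1 (col lam j)).image (val T j)

theorem coe_colFinset (T : SemistandardYoungTableau lam) (j : ℕ) :
    (colFinset T j : Set ℕ) = colSet T j := by
  ext v
  simp only [colFinset, Finset.coe_image, Set.mem_image, Finset.coe_Icc, Set.mem_Icc]
  constructor
  · rintro ⟨k, ⟨h1, h2⟩, rfl⟩; exact ⟨k, h1, h2, rfl⟩
  · rintro ⟨k, h1, h2, rfl⟩; exact ⟨k, ⟨h1, h2⟩, rfl⟩

theorem card_colFinset (T : SemistandardYoungTableau lam) (j : ℕ) :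
    (colFinset T j).card = col lam j :=
  card_image_of_strict fun _ _ hi hij h => val_col T hi hij h

theorem srt_colFinset (T : SemistandardYoungTableau lam) {j i : ℕ} (hi : 1 ≤ i)
    (h : i ≤ col lam j) : srt (colFinset T j) i = val T j i :=
  srt_image_eq (fun _ _ hi hij h => val_col T hi hij h) hi h

theorem colFinset_subset {T : SemistandardYoungTableau lam} (hT : T ∈ Keys n lam) {l j : ℕ}
    (hl : 1 ≤ l) (hj : 1 ≤ j) (h : col lam j ≤ col lam l) : colFinset T j ⊆ colFinset T l := by
  rcases Nat.eq_zero_or_pos (col lam j) with h0 | hpos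
  · rw [colFinset, h0]; simp
  have hjr := le_row_one hj hpos le_rfl
  have hlr := le_row_one hl (le_trans hpos h) le_rfl
  rcases le_total l j with hlj | hjl
  · rw [← Finset.coe_subset, coe_colFinset, coe_colFinset]
    exact hT.2 l j hl hlj hjr
  · have hsub : colFinset T l ⊆ colFinset T j := by
      rw [← Finset.coe_subset, coe_colFinset, coe_colFinset]
      exact hT.2 j l hj hjl hlr
    exact (Finset.eq_of_subset_of_card_le hsub (by
      rw [card_colFinset, card_colFinset]; exact h)).ge

/-- Columns of equal length in a key coincide, and nested columns form a chain once the ends `∅` and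
`{1, …, n}` are added. -/
theorem exists_keyTab_eq (E : CarrelEnum n r q) (S : HasColumns n r q lam)
    {T : SemistandardYoungTableau lam} (hT : T ∈ Keys n lam) :
    ∃ π ∈ RPerms n r q, keyTab lam π = T := by
  choose! J hJ1 hJ2 using S.exists_col
  let B : ℕ → Finset ℕ := fun h => if h = 0 then ∅ else if h ≤ r then colFinset T (J h) else
    if h = r + 1 then Finset.Icc 1 n else ∅
  have hB : ∀ h, 1 ≤ h → h ≤ r → B h = colFinset T (J h) := fun h h1 h2 => by
    simp only [B]; rw [if_neg (by omega), if_pos h2]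
  have hBtop : B (r + 1) = Finset.Icc 1 n := by
    simp only [B]; simp
  have hcard : ∀ h, h ≤ r + 1 → (B h).card = q h := by
    intro h hh
    rcases Nat.eq_zero_or_pos h with rfl | h1
    · rw [E.zero]; rfl
    rcases hh.eq_or_lt with rfl | hlt
    · rw [hBtop, E.top, Nat.card_Icc, Nat.add_sub_cancel]
    · rw [hB h h1 (by omega), card_colFinset, hJ2 h h1 (by omega)]
  have hsub : ∀ h, h ≤ r → B h ⊆ B (h + 1) := by
    intro h hh
    rcases Nat.eq_zero_or_pos h with rfl | h1
    · exact Finset.empty_subset _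
    rw [hB h h1 hh]
    rcases hh.eq_or_lt with rfl | hlt
    · rw [hBtop]
      intro v hv
      obtain ⟨i, hi, rfl⟩ := Finset.mem_image.1 hv
      rw [Finset.mem_Icc] at hi ⊢
      exact mem_tableaux_iff.1 hT.1 _ i (hJ1 _ h1 hh) hi.1 hi.2
    · rw [hB (h + 1) (by omega) hlt]
      refine colFinset_subset hT (hJ1 _ (by omega) hlt) (hJ1 _ h1 hh) ?_
      rw [hJ2 _ h1 hh, hJ2 _ (by omega) hlt]
      exact (E.lt_succ h hh).le
  have hBc : B ∈ RChains n r q := by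
    refine ⟨rfl, hBtop, fun h hh => ?_, fun h h1 hh => hcard h (by omega), fun h hh => ?_⟩
    · refine (hsub h hh).ssubset_of_ne fun he => ?_
      have := E.lt_succ h hh
      have h1 := hcard h (by omega)
      rw [he, hcard (h + 1) (by omega)] at h1
      omega
    · simp only [B]; rw [if_neg (by omega), if_neg (by omega), if_neg (by omega)]
  obtain ⟨π, hπ, he⟩ := (chainOf_bijOn E).surjOn hBc
  refine ⟨π, hπ, tableau_ext fun j i hj hi hij => ?_⟩
  obtain ⟨g, hg1, hg2, hc⟩ := S.exists_eq hj hi hij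
  rw [val_keyTab S hπ hj hi hij, keyVal_eq_srt_chainOf π i hg2 hc, he, ← srt_colFinset T hi hij]
  congr 1
  rcases hg2.eq_or_lt with rfl | hlt
  · rw [hBtop]
    refine (Finset.eq_of_subset_of_card_le (fun v hv => ?_) ?_).symm
    · obtain ⟨k, hk, rfl⟩ := Finset.mem_image.1 hv
      rw [Finset.mem_Icc] at hk ⊢
      exact mem_tableaux_iff.1 hT.1 _ k hj hk.1 hk.2
    · rw [card_colFinset, hc, E.top, Nat.card_Icc, Nat.add_sub_cancel]
  · rw [hB g hg1 (by omega)]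
    have := hJ2 g hg1 (by omega)
    exact subset_antisymm (colFinset_subset hT hj (hJ1 g hg1 (by omega)) (by omega))
      (colFinset_subset hT (hJ1 g hg1 (by omega)) hj (by omega))

theorem keyTab_injOn (E : CarrelEnum n r q) (S : HasColumns n r q lam) :
    Set.InjOn (keyTab lam) (RPerms n r q) := by
  intro π hπ π' hπ' he
  refine eq_of_keyVal_eq E S hπ hπ' fun j i hj hi h => ?_
  rw [← val_keyTab S hπ hj hi h, he, val_keyTab S hπ' hj hi h]

/-- The key condition is chain avoidance for the extreme pair, the smallest new element and the
largest old one; it implies the condition for all other pairs. -/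
theorem keyTab_mem_gaplessKeys_iff (E : CarrelEnum n r q) (S : HasColumns n r q lam) {π : ℕ → ℕ}
    (hπ : π ∈ RPerms n r q) : keyTab lam π ∈ GaplessKeys n r q lam ↔ π ∈ Avoid312 n r q := by
  have hC := (chainOf_bijOn E).mapsTo hπ
  have hset : ∀ j h, 1 ≤ j → h ≤ r + 1 → col lam j = q h → ∀ v,
      v ∈ colSet (keyTab lam π) j ↔ v ∈ chainOf r q π h := by
    intro j h hj hh hc v
    rw [mem_colSet_keyTab S hπ hj, chainOf_apply π hh, hc]
  rw [Avoid312, Set.mem_ofPred_eq, not_contains312_iff E hπ, GaplessKeys, Set.mem_ofPred_eq]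
  constructor
  · rintro ⟨-, hg⟩
    refine ⟨hπ, hC, fun h h1 h2 a ha b hb hb' c hbc hca => ?_⟩
    have hBn : ∀ v ∈ chainOf r q π (h + 1), 1 ≤ v ∧ v ≤ n := fun v hv =>
      Finset.mem_Icc.1 ((RChains.props E hC).2.2 (h + 1) (by omega) hv)
    have hBsub := (RChains.props E hC).2.1 h (h + 1) (by omega) (by omega)
    rcases h2.eq_or_lt with rfl | hlt
    · rw [hC.2.1, Finset.mem_Icc]
      have := hBn a (hBsub ha)
      have := hBn b hb
      omega
    obtain ⟨j, hj, hcj⟩ := S.exists_col (h + 1) (by omega) hlt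
    obtain ⟨l, hl, hcl⟩ := S.exists_col h h1 h2
    have hj' := hset j (h + 1) hj (by omega) hcj
    have hl' := hset l h hl (by omega) hcl
    obtain ⟨b₀, hb₀, hb₀'⟩ := Finset.exists_min_image (chainOf r q π (h + 1) \ chainOf r q π h) id
      ⟨b, Finset.mem_sdiff.2 ⟨hb, hb'⟩⟩
    obtain ⟨m, hm, hm'⟩ := Finset.exists_max_image (chainOf r q π h) id ⟨a, ha⟩
    rw [Finset.mem_sdiff] at hb₀
    have hb₀b := hb₀' b (Finset.mem_sdiff.2 ⟨hb, hb'⟩)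
    have ham := hm' a ha
    simp only [id] at hb₀b ham
    obtain ⟨i, hi1, hi2, hi3⟩ := (hj' b₀).2 hb₀.1
    obtain ⟨k, hk1, hk2, hk3⟩ := (hj' m).2 (hBsub hm)
    have hik : i < k := lt_of_val_lt (keyTab lam π) hk1 hi2 (by omega)
    have hrun := hg h h1 hlt j l hj hl hcj hcl b₀ m
      ⟨⟨(hj' b₀).2 hb₀.1, fun hx => hb₀.2 ((hl' b₀).1 hx)⟩, fun v hv =>
        hb₀' v (Finset.mem_sdiff.2 ⟨(hj' v).1 hv.1, fun hx => hv.2 ((hl' v).2 hx)⟩)⟩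
      ⟨(hl' m).2 hm, fun v hv => hm' v ((hl' v).1 hv)⟩ (by omega) i k hi1 hi2 hk1 hk2 hi3.symm
      hk3.symm
    have hkv := hrun k hik.le le_rfl
    have hcv := hrun (i + (c - b₀)) (by omega) (by omega)
    rw [← hj' c]
    exact ⟨i + (c - b₀), by omega, by omega, by omega⟩
  · rintro ⟨-, -, hav⟩
    refine ⟨keyTab_mem_keys S hπ, fun h h1 h2 j l hj hl hcj hcl b m hb hm hbm i k hi1 hi2 hk1 hk2
      hib hkm t hit htk => ?_⟩
    have hj' := hset j (h + 1) hj (by omega) hcj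
    have hl' := hset l h hl (by omega) hcl
    have hcard := (RChains.props E hC).1 (h + 1) (by omega)
    have hBsub := (RChains.props E hC).2.1 h (h + 1) (by omega) (by omega)
    have hsrt : ∀ x, 1 ≤ x → x ≤ col lam j →
        val (keyTab lam π) j x = srt (chainOf r q π (h + 1)) x := fun x hx hxj => by
      rw [val_keyTab S hπ hj hx hxj, keyVal_eq_srt_chainOf (r := r) π x (by omega) hcj]
    have h3 := val_add_le (keyTab lam π) hi1 hit (htk.trans hk2)
    have h4 := val_col_le (keyTab lam π) (hi1.trans hit) htk hk2
    have hmB := (hl' m).1 hm.1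
    have := (srt_eq_add_of_Icc_subset (B := chainOf r q π (h + 1)) (a := m) hi1 (by omega) (fun c hc1 hc2 => ?_)
      (t := t - i) (by rw [← hsrt i hi1 hi2]; omega)).2
    · rw [← hsrt i hi1 hi2, show i + (t - i) = t by omega, ← hsrt t (by omega) (by omega)] at this
      omega
    · rw [← hsrt i hi1 hi2, hib] at hc1
      rcases hc1.eq_or_lt with rfl | hc1
      · exact (hj' _).1 hb.1.1
      rcases hc2.eq_or_lt with rfl | hc2
      · exact hBsub hmB
      exact hav h h1 (by omega) m hmB b ((hj' b).1 hb.1.1) (fun hx => hb.1.2 ((hl' b).2 hx)) c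
        hc1 hc2

theorem keyTab_bijOn (E : CarrelEnum n r q) (S : HasColumns n r q lam) :
    Set.BijOn (keyTab lam) (Avoid312 n r q) (GaplessKeys n r q lam) := by
  refine ⟨fun π hπ => (keyTab_mem_gaplessKeys_iff E S hπ.1).2 hπ,
    (keyTab_injOn E S).mono fun π hπ => hπ.1, fun T hT => ?_⟩
  obtain ⟨π, hπ, rfl⟩ := exists_keyTab_eq E S hT.1
  exact ⟨π, (keyTab_mem_gaplessKeys_iff E S hπ).1 hT, rfl⟩

end keys

/-! ### Convexity -/

section convex

variable {n r : ℕ} {q : ℕ → ℕ} {lam : YoungDiagram}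

theorem isConvexPolytope_of_fintype {ι κ : Type*} [Fintype ι] [Fintype κ] (A : κ → ι → ℝ)
    (b : κ → ℝ) : IsConvexPolytope {x : ι → ℤ | ∀ k, ∑ i, A k i * (x i : ℝ) ≤ b k} := by
  refine ⟨Fintype.card κ, fun m => A ((Fintype.equivFin κ).symm m),
    fun m => b ((Fintype.equivFin κ).symm m), ?_⟩
  ext x
  exact ⟨fun h m => h _, fun h k => by simpa using h (Fintype.equivFin κ k)⟩

/-- Lattice points on segments are the only obstruction to convexity that is needed. -/
theorem IsConvexPolytope.mem_of_segment {ι : Type*} [Fintype ι] {D : Set (ι → ℤ)}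
    (hD : IsConvexPolytope D) {x y z : ι → ℤ} (hx : x ∈ D) (hy : y ∈ D) {θ : ℝ} (h0 : 0 ≤ θ)
    (h1 : θ ≤ 1) (hz : ∀ i, (z i : ℝ) = θ * x i + (1 - θ) * y i) : z ∈ D := by
  obtain ⟨m, A, b, rfl⟩ := hD
  intro k
  have he : ∑ i, A k i * (z i : ℝ) =
      θ * ∑ i, A k i * (x i : ℝ) + (1 - θ) * ∑ i, A k i * (y i : ℝ) := by
    rw [Finset.mul_sum, Finset.mul_sum, ← Finset.sum_add_distrib]
    refine Finset.sum_congr rfl fun i _ => ?_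
    rw [hz i]; ring
  rw [he]
  have h2 := mul_le_mul_of_nonneg_left (hx k) h0
  have h3 := mul_le_mul_of_nonneg_left (hy k) (sub_nonneg.2 h1)
  linarith

/-- Semistandardness and the bounds are linear inequalities; over the integers the strict ones
become `≤ -1`. -/
theorem isConvexPolytope_rowBound {β : ℕ → ℕ} (hβ : β ∈ Upper n) :
    IsConvexPolytope (toPoint '' RowBound n lam β) := by
  classical
  let e : lam.cells → lam.cells → ℝ := fun c => Pi.single c 1
  have he : ∀ (c : lam.cells) (x : lam.cells → ℤ), ∑ i, e c i * (x i : ℝ) = x c := by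
    intro c x
    simp only [e, Pi.single_apply, ite_mul, one_mul, zero_mul, Finset.sum_ite_eq',
      Finset.mem_univ, if_true]
  let P := {p : lam.cells × lam.cells // p.1.1.1 = p.2.1.1 ∧ p.1.1.2 < p.2.1.2}
  let Q := {p : lam.cells × lam.cells // p.1.1.2 = p.2.1.2 ∧ p.1.1.1 < p.2.1.1}
  let A : lam.cells ⊕ lam.cells ⊕ P ⊕ Q → lam.cells → ℝ :=
    Sum.elim (fun c => e c) (Sum.elim (fun c => -e c) (Sum.elim (fun p => e p.1.1 - e p.1.2)
      (fun p => e p.1.1 - e p.1.2)))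
  let b : lam.cells ⊕ lam.cells ⊕ P ⊕ Q → ℝ :=
    Sum.elim (fun c => ((min n (β (c.1.1 + 1)) : ℕ) : ℝ)) (Sum.elim (fun _ => -1)
      (Sum.elim (fun _ => 0) (fun _ => -1)))
  have key : toPoint '' RowBound n lam β = {x | ∀ k, ∑ i, A k i * (x i : ℝ) ≤ b k} := by
    ext x
    have hx : x ∈ {x : lam.cells → ℤ | ∀ k, ∑ i, A k i * (x i : ℝ) ≤ b k} ↔
        (∀ c : lam.cells, x c ≤ (min n (β (c.1.1 + 1)) : ℕ)) ∧ (∀ c, 1 ≤ x c) ∧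
        (∀ c c' : lam.cells, c.1.1 = c'.1.1 → c.1.2 < c'.1.2 → x c ≤ x c') ∧
        ∀ c c' : lam.cells, c.1.2 = c'.1.2 → c.1.1 < c'.1.1 → x c < x c' := by
      have hA₂ : ∀ c, ∑ i, A (.inr (.inl c)) i * (x i : ℝ) = -x c := fun c => by
        rw [← he c x, ← Finset.sum_neg_distrib]
        exact Finset.sum_congr rfl fun i _ => neg_mul _ _
      have hd : ∀ c c', ∑ i, (e c - e c') i * (x i : ℝ) = x c - x c' := fun c c' => by
        rw [← he c x, ← he c' x, ← Finset.sum_sub_distrib]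
        exact Finset.sum_congr rfl fun i _ => sub_mul _ _ _
      rw [Set.mem_ofPred_eq, Sum.forall, Sum.forall, Sum.forall]
      refine and_congr (forall_congr' fun c => ?_) (and_congr (forall_congr' fun c => ?_)
        (and_congr ⟨fun h c c' h1 h2 => ?_, fun h p => ?_⟩ ⟨fun h c c' h1 h2 => ?_, fun h p => ?_⟩))
      · change ∑ i, e c i * (x i : ℝ) ≤ ((min n (β (c.1.1 + 1)) : ℕ) : ℝ) ↔ _
        rw [he]; norm_cast
      · change _ ≤ (-1 : ℝ) ↔ _
        rw [hA₂, neg_le_neg_iff]; norm_cast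
      · have h3 : ∑ i, (e c - e c') i * (x i : ℝ) ≤ 0 := h ⟨(c, c'), h1, h2⟩
        rw [hd] at h3
        exact_mod_cast sub_nonpos.1 h3
      · change ∑ i, (e p.1.1 - e p.1.2) i * (x i : ℝ) ≤ 0
        rw [hd, sub_nonpos]
        exact_mod_cast h _ _ p.2.1 p.2.2
      · have h3 : ∑ i, (e c - e c') i * (x i : ℝ) ≤ -1 := h ⟨(c, c'), h1, h2⟩
        rw [hd] at h3
        have h4 : (x c : ℝ) + 1 ≤ x c' := by linarith
        exact_mod_cast h4
      · change ∑ i, (e p.1.1 - e p.1.2) i * (x i : ℝ) ≤ -1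
        rw [hd]
        have h4 : (x p.1.1 : ℝ) + 1 ≤ x p.1.2 := by exact_mod_cast h _ _ p.2.1 p.2.2
        linarith
    rw [hx]
    constructor
    · rintro ⟨T, ⟨hT, -, hb⟩, rfl⟩
      refine ⟨fun c => ?_, fun c => ?_, fun c c' h1 h2 => ?_, fun c c' h1 h2 => ?_⟩
      · have h1 := (hT c.1 c.2).2
        have h2 := hb (c.1.2 + 1) (c.1.1 + 1) (by omega) (by omega) (mem_lam_succ.1 c.2)
        exact Nat.cast_le.2 (le_min h1 h2)
      · exact Nat.one_le_cast.2 (hT c.1 c.2).1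
      · refine Nat.cast_le.2 ?_
        rw [h1]
        exact T.row_weak h2 c'.2
      · refine Nat.cast_lt.2 ?_
        rw [h1]
        exact T.col_strict h2 c'.2
    · rintro ⟨h1, h2, h3, h4⟩
      let T : SemistandardYoungTableau lam :=
        { entry := fun a b => if h : (a, b) ∈ lam then (x ⟨(a, b), h⟩).toNat else 0
          row_weak' := fun {i j1 j2} h hm => by
            have hm' := lam.up_left_mem le_rfl h.le hm
            rw [dif_pos hm, dif_pos hm']
            exact Int.toNat_le_toNat (h3 ⟨(i, j1), hm'⟩ ⟨(i, j2), hm⟩ rfl h)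
          col_strict' := fun {i1 i2 j} h hm => by
            have hm' := lam.up_left_mem h.le le_rfl hm
            rw [dif_pos hm, dif_pos hm']
            have := h4 ⟨(i1, j), hm'⟩ ⟨(i2, j), hm⟩ rfl h
            have := h2 ⟨(i1, j), hm'⟩
            omega
          zeros' := fun h => dif_neg h }
      have hTe : ∀ c : lam.cells, T c.1.1 c.1.2 = (x c).toNat := fun c => dif_pos c.2
      refine ⟨T, ⟨fun c hc => ?_, hβ.2, fun j i hj hi hij => ?_⟩, ?_⟩
      · have := hTe ⟨c, hc⟩
        have h5 := h1 ⟨c, hc⟩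
        have h6 := h2 ⟨c, hc⟩
        simp only at this h5
        omega
      · have hc := (mem_lam_iff (j := j) hi).2 hij
        have := hTe ⟨_, hc⟩
        have h5 := h1 ⟨_, hc⟩
        simp only at this h5
        rw [Nat.sub_add_cancel hi] at h5
        rw [val]
        omega
      · funext c
        rw [toPoint, hTe]
        have := h2 c
        omega
  rw [key]
  exact isConvexPolytope_of_fintype A b

/-! ### Failure of convexity for permutations that contain 312 -/

theorem image_swap_mem_rChains {B : ℕ → Finset ℕ} (hB : B ∈ RChains n r q) {x y : ℕ}
    (hx : x ∈ Finset.Icc 1 n) (hy : y ∈ Finset.Icc 1 n) :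
    (fun h => (B h).image (Equiv.swap x y)) ∈ RChains n r q := by
  have hinj := (Equiv.swap x y).injective
  refine ⟨by simp [hB.1], ?_, fun h hh => ?_, fun h h1 h2 => ?_, fun h hh => ?_⟩
  · simp only [hB.2.1]
    refine Finset.eq_of_subset_of_card_le (fun v hv => ?_)
      (by rw [Finset.card_image_of_injective _ hinj])
    obtain ⟨u, hu, rfl⟩ := Finset.mem_image.1 hv
    rw [Equiv.swap_apply_def]
    split_ifs
    · exact hy
    · exact hx
    · exact hu
  · exact (Finset.image_ssubset_image hinj).2 (hB.2.2.1 h hh)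
  · rw [Finset.card_image_of_injective _ hinj, hB.2.2.2.1 h h1 h2]
  · simp [hB.2.2.2.2 h hh]

theorem image_swap_eq_self {B : Finset ℕ} {x y : ℕ} (hx : x ∈ B) (hy : y ∈ B) :
    B.image (Equiv.swap x y) = B := by
  refine Finset.eq_of_subset_of_card_le (fun v hv => ?_)
    (by rw [Finset.card_image_of_injective _ (Equiv.swap x y).injective])
  obtain ⟨u, hu, rfl⟩ := Finset.mem_image.1 hv
  rw [Equiv.swap_apply_def]
  split_ifs <;> assumption

/-- A chain with a `312` pattern dominates two chains that differ only by the exchange of a value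
`a` for a smaller value `s`, where `s` but not `s + 1` belongs to the next term. -/
theorem exists_swapped_chains (E : CarrelEnum n r q) {B : ℕ → Finset ℕ} (hB : B ∈ RChains n r q)
    (hn : B ∉ AvoidChains n r q) : ∃ h s a, ∃ B' ∈ RChains n r q, ∃ B'' ∈ RChains n r q,
      1 ≤ h ∧ h + 1 ≤ r ∧ s + 1 < a ∧ a ∈ B' h ∧ s ∈ B (h + 1) ∧ s + 1 ∉ B (h + 1) ∧
      (∀ g, h + 1 ≤ g → g ≤ r + 1 → B' g = B g ∧ B'' g = B g) ∧
      (∀ g, g ≤ r + 1 → ∀ i, 1 ≤ i → i ≤ q g → srt (B' g) i ≤ srt (B g) i) ∧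
      ∀ g, g ≤ h → ∀ i, 1 ≤ i → i ≤ q g →
        srt (B'' g) i = if srt (B' g) i = a then s else srt (B' g) i := by
  obtain ⟨hcard, hsub, hle⟩ := RChains.props E hB
  simp only [AvoidChains, Set.mem_ofPred_eq, not_and, not_forall] at hn
  obtain ⟨h, h1, h2, a₀, ha₀, hn⟩ := hn hB
  obtain ⟨b₀, hb₀, hb₀', c₀, hbc₀, hca₀, hc₀⟩ := hn
  have hlt : h + 1 ≤ r := by
    by_contra hc
    obtain rfl : h = r := by omega
    have h3 := Finset.mem_Icc.1 (hle h (by omega) ha₀)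
    exact hc₀ (by rw [hB.2.1, Finset.mem_Icc]; omega)
  -- the closest pair
  have hex : ∃ d b, b ∈ B (h + 1) ∧ b ∉ B h ∧ b + d + 1 ∉ B (h + 1) ∧ b + d + 1 < a₀ :=
    ⟨c₀ - b₀ - 1, b₀, hb₀, hb₀', by rwa [show b₀ + (c₀ - b₀ - 1) + 1 = c₀ by omega], by omega⟩
  classical
  obtain ⟨b, hb, hb', hc, hca⟩ := Nat.find_spec hex
  have hmin := fun m => Nat.find_min hex (m := m)
  generalize Nat.find hex = d at hb hb' hc hca hmin
  -- Any value in between outside `B h` could replace `b` or the missing value, and so reduce `d`.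
  have hbetween : ∀ v, b < v → v < b + d + 1 → v ∈ B h := by
    intro v hbv hvc
    by_contra hv
    by_cases hv' : v ∈ B (h + 1)
    · refine hmin (b + d - v) (by omega) ⟨v, hv', hv, ?_, ?_⟩ <;>
        rw [show v + (b + d - v) + 1 = b + d + 1 by omega] <;> assumption
    · refine hmin (v - b - 1) (by omega) ⟨b, hb, hb', ?_, ?_⟩ <;>
        rw [show b + (v - b - 1) + 1 = v by omega]
      · exact hv'
      · omega
  obtain ⟨a, ha, hamin⟩ := Finset.exists_min_image ((B h).filter (b + d + 1 < ·)) id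
    ⟨a₀, Finset.mem_filter.2 ⟨ha₀, hca⟩⟩
  rw [Finset.mem_filter] at ha
  obtain ⟨ha, hca'⟩ := ha
  set s := b + d with hs
  have hsub1 : B h ⊆ B (h + 1) := hsub h (h + 1) (by omega) (by omega)
  have hsB : s ∈ B (h + 1) := by
    rcases Nat.eq_zero_or_pos d with hd | hd
    · rw [hs, hd]; exact hb
    · exact hsub1 (hbetween s (by omega) (by omega))
  have hIcc : ∀ v ∈ B (h + 1), v ∈ Finset.Icc 1 n := fun v hv => hle (h + 1) (by omega) hv
  -- The first exchange moves `s` down to `b` in the sets up to `B h`, to make room for replacing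
  -- `a` by `s` in the second. For `d = 0` it is the identity.
  have hB' := image_swap_mem_rChains hB (hIcc b hb) (hIcc s hsB)
  have hB'' := image_swap_mem_rChains hB' (hIcc a (hsub1 ha)) (hIcc s hsB)
  have hbg : ∀ g, g ≤ h → b ∉ B g := fun g hg hbg => hb' (hsub g h hg (by omega) hbg)
  have htop : ∀ g, h + 1 ≤ g → g ≤ r + 1 → (B g).image (Equiv.swap b s) = B g := fun g hg hg' =>
    image_swap_eq_self (hsub _ g hg hg' hb) (hsub _ g hg hg' hsB)
  refine ⟨h, s, a, _, hB', _, hB'', h1, hlt, hca', ?_, hsB, hc, fun g hg hg' => ?_,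
    fun g hg i hi hiq => ?_, fun g hg i hi hiq => ?_⟩
  · refine Finset.mem_image.2 ⟨a, ha, Equiv.swap_apply_of_ne_of_ne ?_ ?_⟩ <;> omega
  · refine ⟨htop g hg hg', ?_⟩
    simp only [htop g hg hg']
    exact image_swap_eq_self (hsub _ g hg hg' (hsub1 ha)) (hsub _ g hg hg' hsB)
  · rcases Nat.lt_or_ge h g with hgh | hgh
    · simp only [htop g hgh hg, le_refl]
    · refine srt_le_srt_of_inj (Equiv.swap b s) (Equiv.swap b s).injective.injOn
        (fun v hv => ⟨Finset.mem_image_of_mem _ hv, ?_⟩) hi (by rw [hcard g hg]; exact hiq)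
      rw [Equiv.swap_apply_def]
      split_ifs with h3 h4
      · exact absurd (h3 ▸ hv) (hbg g hgh)
      · omega
      · exact le_rfl
  · have hcard' := (RChains.props E hB').1 g (by omega)
    have hcard'' := (RChains.props E hB'').1 g (by omega)
    set C := (B g).image (Equiv.swap b s) with hC
    -- After the first exchange no element of these sets lies in `[s, a)`, so replacing `a` by `s`
    -- keeps all ranks.
    have hCmem : ∀ v ∈ C, v < s ∨ a ≤ v := by
      intro v hv
      obtain ⟨u, hu, rfl⟩ := Finset.mem_image.1 hv
      have hub : u ≠ b := fun he => hbg g (by omega) (he ▸ hu)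
      have huh := hsub g h hg (by omega) hu
      rw [Equiv.swap_apply_def, if_neg hub]
      split_ifs with hus
      · rcases Nat.eq_zero_or_pos d with hd | hd <;> omega
      · have hcu : u ≠ s + 1 := fun he => hc (he ▸ hsub1 huh)
        by_contra hcon
        have := hamin u (Finset.mem_filter.2 ⟨huh, by omega⟩)
        simp only [id] at this
        omega
    have hstr := eq_srt_of_strict (B := C.image (Equiv.swap a s))
      (f := fun i => if srt C i = a then s else srt C i) (fun x y hx hxy hy => ?_)
      (fun x hx hx' => ?_) hi (by omega)
    · exact hstr.symm
    · have hlt := srt_lt hx hxy (B := C) (by omega)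
      have h3 := hCmem _ (srt_mem hx (B := C) (by omega))
      have h4 := hCmem _ (srt_mem (i := y) (by omega) (B := C) (by omega))
      split_ifs <;> omega
    · refine Finset.mem_image.2 ⟨srt C x, srt_mem hx (by omega), ?_⟩
      have h3 := hCmem _ (srt_mem hx (B := C) (by omega))
      rw [Equiv.swap_apply_def]
      split_ifs <;> omega

/-- Two keys below that of `π` differ only by `a` versus `s` in the columns of length at most `q h`.
The lattice point between them that has `s + 1` there would be a Demazure tableau by convexity. But
its columns of length `q (h + 1)` contain `s` and not `s + 1`, and scanning from `s` then ends too
high. -/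
theorem not_isConvexPolytope_demazure (E : CarrelEnum n r q) (S : HasColumns n r q lam)
    {π : ℕ → ℕ} (hπ : π ∈ RPerms n r q) (hc : π ∉ Avoid312 n r q) :
    ¬ IsConvexPolytope (toPoint '' Demazure n lam π) := by
  intro hconv
  have hB := (chainOf_bijOn E).mapsTo hπ
  obtain ⟨h, s, a, B', hB', B'', hB'', h1, h2, hsa, ha, hs, hs', htop, hle, hlow⟩ :=
    exists_swapped_chains E hB fun hav => hc ⟨hπ, (not_contains312_iff E hπ).2 hav⟩
  obtain ⟨π', hπ', rfl⟩ := (chainOf_bijOn E).surjOn hB'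
  obtain ⟨π'', hπ'', rfl⟩ := (chainOf_bijOn E).surjOn hB''
  have hgle : ∀ {j g : ℕ}, 1 ≤ g → g ≤ r + 1 → col lam j = q g → (g ≤ h ↔ col lam j ≤ q h) := by
    intro j g _ hg he
    rw [he]
    refine ⟨fun hgh => E.mono hgh (by omega), fun hgh => ?_⟩
    by_contra hcon
    have := E.strict (not_le.1 hcon) hg
    omega
  have hkey : ∀ j i, 1 ≤ j → 1 ≤ i → i ≤ col lam j → keyVal lam π' j i ≤ keyVal lam π j i ∧
      keyVal lam π'' j i = if col lam j ≤ q h ∧ keyVal lam π' j i = a then s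
        else keyVal lam π' j i := by
    intro j i hj hi hij
    obtain ⟨g, hg1, hg2, hcg⟩ := S.exists_eq hj hi hij
    simp only [← hgle hg1 hg2 hcg]
    rw [keyVal_eq_srt_chainOf π i hg2 hcg, keyVal_eq_srt_chainOf π' i hg2 hcg,
      keyVal_eq_srt_chainOf π'' i hg2 hcg]
    refine ⟨hle g hg2 i hi (hcg ▸ hij), ?_⟩
    by_cases hgh : g ≤ h
    · rw [hlow g hgh i hi (hcg ▸ hij)]
      simp only [hgh, true_and]
    · rw [if_neg (fun h => hgh h.1), (htop g (by omega) hg2).1, (htop g (by omega) hg2).2]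
  have hm' : keyTab lam π' ∈ Demazure n lam π := (keyTab_mem_demazure_iff S hπ').2
    fun j i hj hi hij => (hkey j i hj hi hij).1
  have hm'' : keyTab lam π'' ∈ Demazure n lam π := (keyTab_mem_demazure_iff S hπ'').2
    fun j i hj hi hij => by
      have := hkey j i hj hi hij
      rw [this.2]
      split_ifs <;> omega
  classical
  let z : lam.cells → ℤ := fun c =>
    if col lam (c.1.2 + 1) ≤ q h ∧ keyVal lam π' (c.1.2 + 1) (c.1.1 + 1) = a then s + 1
    else keyVal lam π' (c.1.2 + 1) (c.1.1 + 1)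
  have hpos : (0 : ℝ) < (a : ℝ) - s := by
    have : (s : ℝ) + 1 < a := by exact_mod_cast hsa
    linarith
  have hz : z ∈ toPoint '' Demazure n lam π := by
    -- The weight `1 / (a - s)` on the first key turns the pair `a`, `s` into `s + 1`.
    refine hconv.mem_of_segment (Set.mem_image_of_mem _ hm') (Set.mem_image_of_mem _ hm'')
      (θ := 1 / ((a : ℝ) - s)) (by positivity) ?_ fun c => ?_
    · rw [div_le_one hpos]
      have : (s : ℝ) + 1 < a := by exact_mod_cast hsa
      linarith
    · have hcol := mem_lam_succ.1 c.2
      have e1 : toPoint (keyTab lam π') c = (keyVal lam π' (c.1.2 + 1) (c.1.1 + 1) : ℤ) := by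
        rw [← val_keyTab S hπ' (by omega) (by omega) hcol]; rfl
      have e2 : toPoint (keyTab lam π'') c = (keyVal lam π'' (c.1.2 + 1) (c.1.1 + 1) : ℤ) := by
        rw [← val_keyTab S hπ'' (by omega) (by omega) hcol]; rfl
      rw [e1, e2, (hkey _ _ (by omega) (by omega) hcol).2]
      simp only [z]
      split_ifs with hcond
      · rw [hcond.2]
        push_cast
        field_simp
        ring
      · push_cast
        ring
  obtain ⟨T, hT, hTz⟩ := hz
  have hval : ∀ j i, 1 ≤ j → 1 ≤ i → i ≤ col lam j → val T j i =
      if col lam j ≤ q h ∧ keyVal lam π' j i = a then s + 1 else keyVal lam π' j i := by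
    intro j i hj hi hij
    have := congrFun hTz ⟨_, (mem_lam_iff (j := j) hi).2 hij⟩
    simp only [z, toPoint, Nat.sub_add_cancel hi, Nat.sub_add_cancel hj] at this
    rw [val]
    split_ifs at this ⊢ <;> exact_mod_cast this
  obtain ⟨j, hj, hcj⟩ := S.exists_col (h + 1) (by omega) h2
  obtain ⟨l, hl, hcl⟩ := S.exists_col h h1 (by omega)
  have hqlt := E.lt_succ h (by omega)
  have hjl : j ≤ l := by
    by_contra hcon
    have := col_anti (lam := lam) (not_le.1 hcon).le
    omega
  have hjv : ∀ k, 1 ≤ k → k ≤ col lam j → val T j k = keyVal lam π j k := by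
    intro k hk hkj
    rw [hval j k hj hk hkj, if_neg (by omega), keyVal_eq_srt_chainOf (r := r) π' k (by omega) hcj,
      keyVal_eq_srt_chainOf (r := r) π k (by omega) hcj, (htop (h + 1) le_rfl (by omega)).1]
  rw [chainOf_apply π (by omega), ← hcj] at hs hs'
  rw [chainOf_apply π' (by omega), ← hcl] at ha
  obtain ⟨i, hi1, hi2, hi3⟩ := exists_keyVal_eq S hπ hs
  obtain ⟨t, ht1, ht2, ht3⟩ := exists_keyVal_eq S hπ' ha
  -- In column `j` the entries after `s` exceed `s + 1`. So the path from `s` reaches at least the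
  -- later value `s + 1`, whereas the key has `s` in that box.
  have hlast := le_scanVal_of_later (T := T) (c := s + 1) hi1 hi2 hjl ht1 ht2
    (by rw [hval l t hl ht1 ht2, if_pos ⟨hcl.le, ht3⟩]) fun k hik hkj => by
      have h3 := val_col T hi1 hik hkj
      rw [hjv i hi1 hi2, hi3] at h3
      have h4 := keyVal_mem S hπ (j := j) (i := k) (by omega) hkj
      have h5 : keyVal lam π j k ≠ s + 1 := fun he => hs' (he ▸ h4)
      rw [hjv k (by omega) hkj] at h3 ⊢
      omega
  have := hT.2 j i hj hi1 hi2
  omega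

theorem isConvexPolytope_demazure_iff (E : CarrelEnum n r q) (S : HasColumns n r q lam)
    {π : ℕ → ℕ} (hπ : π ∈ RPerms n r q) :
    IsConvexPolytope (toPoint '' Demazure n lam π) ↔ π ∈ Avoid312 n r q := by
  refine ⟨fun h => by_contra fun hc => not_isConvexPolytope_demazure E S hπ hc h, fun h => ?_⟩
  obtain ⟨γ, hγ, he⟩ := exists_gapless_rowBound_eq E S h
  rw [← he]
  exact isConvexPolytope_rowBound hγ.1.1

end convex

/-! ### Tableau polynomials -/

section polynomials

variable {n r : ℕ} {q : ℕ → ℕ} {lam : YoungDiagram}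

theorem finite_tableaux (n : ℕ) (lam : YoungDiagram) : (Tableaux n lam).Finite := by
  let f : SemistandardYoungTableau lam → lam.cells → ℕ := fun T c => T c.1.1 c.1.2
  have hf : Set.InjOn f (Tableaux n lam) := by
    intro T _ T' _ he
    ext a b
    by_cases hab : (a, b) ∈ lam
    · exact congrFun he ⟨(a, b), hab⟩
    · rw [T.zeros hab, T'.zeros hab]
  refine Set.Finite.of_finite_image (Set.Finite.subset (Set.finite_Iic (fun _ => n)) ?_) hf
  rintro _ ⟨T, hT, rfl⟩
  exact fun c => (hT c.1 c.2).2

/-- The exponent vector of `monomialOf n T`. -/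
noncomputable def exponent (n : ℕ) (T : SemistandardYoungTableau lam) : ℕ →₀ ℕ :=
  ∑ k ∈ Finset.Icc 1 n, Finsupp.single k (content T k)

theorem exponent_apply (T : SemistandardYoungTableau lam) {k : ℕ} (h1 : 1 ≤ k) (h2 : k ≤ n) :
    exponent n T k = content T k := by
  rw [exponent, Finsupp.finsetSum_apply]
  simp only [Finsupp.single_apply, Finset.sum_ite_eq', Finset.mem_Icc, h1, h2, and_self, if_true]

theorem monomialOf_eq (T : SemistandardYoungTableau lam) :
    monomialOf n T = MvPolynomial.monomial (exponent n T) 1 := by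
  rw [monomialOf, exponent, MvPolynomial.monomial_sum_one]
  simp only [MvPolynomial.X_pow_eq_monomial]

theorem coeff_genFun {D : Set (SemistandardYoungTableau lam)} (hD : D ⊆ Tableaux n lam)
    (e : ℕ →₀ ℕ) : MvPolynomial.coeff e (genFun n D) =
      ({T | T ∈ D ∧ exponent n T = e}.ncard : ℤ) := by
  classical
  have hfin := (finite_tableaux n lam).subset hD
  have he : {T | T ∈ D ∧ exponent n T = e} =
      ((hfin.toFinset.filter fun T => exponent n T = e : Finset _) : Set _) := by
    ext T; simp
  rw [genFun, finsum_mem_eq_finite_toFinset_sum _ hfin, MvPolynomial.coeff_sum, he,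
    Set.ncard_coe_finset, Finset.card_filter]
  push_cast
  refine Finset.sum_congr rfl fun T _ => ?_
  rw [monomialOf_eq, MvPolynomial.coeff_monomial]

theorem eval_one_genFun {D : Set (SemistandardYoungTableau lam)} (hD : D ⊆ Tableaux n lam) :
    MvPolynomial.eval (fun _ => 1) (genFun n D) = (D.ncard : ℤ) := by
  have hfin := (finite_tableaux n lam).subset hD
  rw [genFun, finsum_mem_eq_finite_toFinset_sum _ hfin, map_sum,
    Set.ncard_eq_toFinset_card _ hfin, Finset.card_eq_sum_ones]
  push_cast
  refine Finset.sum_congr rfl fun T _ => ?_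
  rw [monomialOf, map_prod]
  exact Finset.prod_eq_one fun k _ => by rw [map_pow, MvPolynomial.eval_X, one_pow]

/-- Coefficients count tableaux, so nothing cancels. -/
theorem exists_content_eq {D D' : Set (SemistandardYoungTableau lam)} (hD : D ⊆ Tableaux n lam)
    (hD' : D' ⊆ Tableaux n lam) (h : genFun n D = genFun n D') {Y : SemistandardYoungTableau lam}
    (hY : Y ∈ D) : ∃ T ∈ D', ∀ k, 1 ≤ k → k ≤ n → content T k = content Y k := by
  have h1 := coeff_genFun hD (exponent n Y)
  rw [h, coeff_genFun hD', Nat.cast_inj] at h1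
  have hpos : 0 < {T | T ∈ D ∧ exponent n T = exponent n Y}.ncard :=
    (Set.ncard_pos ((finite_tableaux n lam).subset fun T hT => hD hT.1)).2 ⟨Y, hY, rfl⟩
  rw [← h1] at hpos
  obtain ⟨T, hT, he⟩ := Set.nonempty_of_ncard_ne_zero hpos.ne'
  refine ⟨T, hT, fun k hk1 hk2 => ?_⟩
  rw [← exponent_apply T hk1 hk2, he, exponent_apply Y hk1 hk2]

theorem sum_content (T : SemistandardYoungTableau lam) (C : Finset ℕ) :
    ∑ k ∈ C, content T k = (lam.cells.filter fun c => T c.1 c.2 ∈ C).card := by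
  rw [Finset.card_eq_sum_card_fiberwise (s := lam.cells.filter fun c => T c.1 c.2 ∈ C)
    (f := fun c : ℕ × ℕ => T c.1 c.2) (t := C) (fun c hc => (Finset.mem_filter.1 hc).2)]
  refine Finset.sum_congr rfl fun k hk => ?_
  rw [content, Finset.filter_filter]
  congr 1
  refine Finset.filter_congr fun c _ => ?_
  exact ⟨fun h => ⟨h ▸ hk, h⟩, fun h => h.2⟩

theorem card_filter_eq_sum_columns (T : SemistandardYoungTableau lam) (C : Finset ℕ) :
    (lam.cells.filter fun c => T c.1 c.2 ∈ C).card =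
      ∑ j ∈ Finset.Icc 1 (row lam 1), (colFinset T j ∩ C).card := by
  rw [Finset.card_eq_sum_card_fiberwise (f := fun c => c.2 + 1) (t := Finset.Icc 1 (row lam 1))]
  · refine Finset.sum_congr rfl fun j hj => ?_
    rw [Finset.mem_Icc] at hj
    refine Finset.card_bij (fun c _ => T c.1 c.2) (fun c hc => ?_) (fun c hc c' hc' he => ?_)
      fun v hv => ?_
    · simp only [Finset.mem_filter, YoungDiagram.mem_cells] at hc
      obtain ⟨⟨hc1, hc2⟩, rfl⟩ := hc
      refine Finset.mem_inter.2 ⟨Finset.mem_image.2 ⟨c.1 + 1, ?_, rfl⟩, hc2⟩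
      rw [Finset.mem_Icc]
      exact ⟨by omega, mem_lam_succ.1 hc1⟩
    · simp only [Finset.mem_filter, YoungDiagram.mem_cells] at hc hc'
      obtain ⟨⟨hc1, -⟩, hc2⟩ := hc
      obtain ⟨⟨hc1', -⟩, hc2'⟩ := hc'
      obtain ⟨a, b⟩ := c
      obtain ⟨a', b'⟩ := c'
      simp only at *
      obtain rfl : b = b' := by omega
      rcases lt_trichotomy a a' with h | rfl | h
      · exact absurd he (T.col_strict h hc1').ne
      · rfl
      · exact absurd he (T.col_strict h hc1).ne'
    · rw [Finset.mem_inter] at hv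
      obtain ⟨i, hi, rfl⟩ := Finset.mem_image.1 hv.1
      rw [Finset.mem_Icc] at hi
      refine ⟨(i - 1, j - 1), ?_, rfl⟩
      simp only [Finset.mem_filter, YoungDiagram.mem_cells]
      exact ⟨⟨(mem_lam_iff hi.1).2 hi.2, hv.2⟩, by omega⟩
  · intro c hc
    have hc' := (YoungDiagram.mem_cells _).1 (Finset.mem_filter.1 hc).1
    have := mem_lam_succ.1 (show (c.1, c.2) ∈ lam from hc')
    simp only [Finset.coe_Icc, Set.mem_Icc]
    exact ⟨by omega, le_row_one (by omega) (by omega) this⟩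

/-- A key is the only tableau with its content. -/
theorem eq_keyTab_of_content_eq (E : CarrelEnum n r q) (S : HasColumns n r q lam) {π : ℕ → ℕ}
    (hπ : π ∈ RPerms n r q) {T : SemistandardYoungTableau lam}
    (h : ∀ k, 1 ≤ k → k ≤ n → content T k = content (keyTab lam π) k) : T = keyTab lam π := by
  have hC := (chainOf_bijOn E).mapsTo hπ
  have hcol : ∀ j, 1 ≤ j → colFinset (keyTab lam π) j = (Finset.Icc 1 (col lam j)).image π := by
    intro j hj
    ext v
    rw [← Finset.mem_coe, coe_colFinset, mem_colSet_keyTab S hπ hj]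
  refine tableau_ext fun j i hj hi hij => ?_
  obtain ⟨g, hg1, hg2, hcj⟩ := S.exists_eq hj hi hij
  have hjr := le_row_one hj hi hij
  set C := (Finset.Icc 1 (col lam j)).image π with hCdef
  have hCn : ∀ k ∈ C, 1 ≤ k ∧ k ≤ n := fun k hk => by
    rw [hCdef, hcj, ← chainOf_apply (r := r) π hg2] at hk
    exact Finset.mem_Icc.1 ((RChains.props E hC).2.2 g hg2 hk)
  have hCcard : C.card = col lam j := card_image_le_col S hπ j
  have hsum : ∑ l ∈ Finset.Icc 1 (row lam 1), (colFinset T l ∩ C).card =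
      ∑ l ∈ Finset.Icc 1 (row lam 1), (colFinset (keyTab lam π) l ∩ C).card := by
    rw [← card_filter_eq_sum_columns, ← card_filter_eq_sum_columns, ← sum_content, ← sum_content]
    exact Finset.sum_congr rfl fun k hk => h k (hCn k hk).1 (hCn k hk).2
  -- With `C` the `j`-th column of the key, no column of length `m` has more than `min m C.card`
  -- values in `C`, and every column of the key attains this. Equal totals force equality in column
  -- `j`.
  have hle : ∀ l ∈ Finset.Icc 1 (row lam 1),
      (colFinset T l ∩ C).card ≤ (colFinset (keyTab lam π) l ∩ C).card := by
    intro l hl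
    rw [hcol l (Finset.mem_Icc.1 hl).1]
    rcases le_total (col lam l) (col lam j) with hlj | hjl
    · rw [Finset.inter_eq_left.2 (Finset.image_subset_image (Finset.Icc_subset_Icc le_rfl hlj)),
        card_image_le_col S hπ, ← card_colFinset T l]
      exact Finset.card_le_card Finset.inter_subset_left
    · rw [Finset.inter_eq_right.2 (Finset.image_subset_image (Finset.Icc_subset_Icc le_rfl hjl))]
      exact Finset.card_le_card Finset.inter_subset_right
  have heq := (Finset.sum_eq_sum_iff_of_le hle).1 hsum j (Finset.mem_Icc.2 ⟨hj, hjr⟩)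
  rw [hcol j hj, Finset.inter_self] at heq
  have h1 : colFinset T j ∩ C = colFinset T j :=
    Finset.eq_of_subset_of_card_le Finset.inter_subset_left (by rw [heq, card_colFinset, hCcard])
  have h2 : colFinset T j ∩ C = C :=
    Finset.eq_of_subset_of_card_le Finset.inter_subset_right heq.ge
  rw [val_keyTab S hπ hj hi hij, keyVal_eq_srt, ← srt_colFinset T hi hij, ← h1, h2]

/-! ### From polynomials back to tableau sets -/

theorem keyTab_mem_of_genFun_eq (E : CarrelEnum n r q) (S : HasColumns n r q lam) {π : ℕ → ℕ}
    (hπ : π ∈ RPerms n r q) {D D' : Set (SemistandardYoungTableau lam)} (hD : D ⊆ Tableaux n lam)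
    (hD' : D' ⊆ Tableaux n lam) (h : genFun n D = genFun n D') (hY : keyTab lam π ∈ D) :
    keyTab lam π ∈ D' := by
  obtain ⟨T, hT, hc⟩ := exists_content_eq hD hD' h hY
  rwa [← eq_keyTab_of_content_eq E S hπ hc]

theorem demazurePoly_injOn (E : CarrelEnum n r q) (S : HasColumns n r q lam) :
    Set.InjOn (demazurePoly n lam) (RPerms n r q) := by
  intro π hπ π' hπ' he
  have h1 := (keyTab_mem_demazure_iff S hπ).1 (keyTab_mem_of_genFun_eq E S hπ (fun T hT => hT.1)
    (fun T hT => hT.1) he (keyTab_mem_demazure S hπ))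
  have h2 := (keyTab_mem_demazure_iff S hπ').1 (keyTab_mem_of_genFun_eq E S hπ' (fun T hT => hT.1)
    (fun T hT => hT.1) he.symm (keyTab_mem_demazure S hπ'))
  exact eq_of_keyVal_eq E S hπ hπ' fun j i hj hi h =>
    le_antisymm (h1 j i hj hi h) (h2 j i hj hi h)

/-- The key lies in the row bound set and dominates all Demazure tableaux, so these satisfy the row
bounds. Evaluation at ones gives equal cardinalities. -/
theorem rowBound_eq_demazure_of_poly_eq (E : CarrelEnum n r q) (S : HasColumns n r q lam)
    {β π : ℕ → ℕ} (hπ : π ∈ RPerms n r q) (h : rowBoundSum n lam β = demazurePoly n lam π) :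
    RowBound n lam β = Demazure n lam π := by
  have hR : RowBound n lam β ⊆ Tableaux n lam := fun T hT => hT.1
  have hD : Demazure n lam π ⊆ Tableaux n lam := fun T hT => hT.1
  have hY := keyTab_mem_of_genFun_eq E S hπ hD hR h.symm (keyTab_mem_demazure S hπ)
  have hsub : Demazure n lam π ⊆ RowBound n lam β := by
    refine fun T hT => ⟨hT.1, hY.2.1, fun j i hj hi hij => ?_⟩
    refine (val_le_keyVal_of_mem_demazure hT hj hi hij).trans ?_
    rw [← val_keyTab S hπ hj hi hij]
    exact hY.2.2 j i hj hi hij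
  have h1 := eval_one_genFun hR
  rw [show genFun n (RowBound n lam β) = genFun n (Demazure n lam π) from h,
    eval_one_genFun hD, Nat.cast_inj] at h1
  exact (Set.eq_of_subset_of_ncard_le hsub h1.ge ((finite_tableaux n lam).subset hR)).symm

/-- Row bound sets are convex, for every upper bound. -/
theorem mem_avoid312_of_rowBound_eq (E : CarrelEnum n r q) (S : HasColumns n r q lam)
    {β π : ℕ → ℕ} (hβ : β ∈ Upper n) (hπ : π ∈ RPerms n r q)
    (h : RowBound n lam β = Demazure n lam π) : π ∈ Avoid312 n r q :=
  (isConvexPolytope_demazure_iff E S hπ).1 (h ▸ isConvexPolytope_rowBound hβ)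

/-- The polynomials of upper flags determine the row bound sets. -/
theorem rowBound_eq_of_sum_eq (E : CarrelEnum n r q) (S : HasColumns n r q lam) {β φ : ℕ → ℕ}
    (hφ : φ ∈ UpperFlags n) (h : rowBoundSum n lam β = rowBoundSum n lam φ) :
    RowBound n lam β = RowBound n lam φ := by
  obtain ⟨π, hπ, he⟩ := exists_avoid312_demazure_eq (lam := lam) E S hφ.1
    (core_upperFlag_mem_gapless E hφ)
  rw [he]
  exact rowBound_eq_demazure_of_poly_eq E S hπ.1 (by rw [h, rowBoundSum, he, demazurePoly])

end polynomials

/-! ### Gessel-Viennot determinants -/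

section gesselViennot

variable {n r : ℕ} {q : ℕ → ℕ} {lam : YoungDiagram}

theorem prod_map_X_eq (m : Multiset ℕ) :
    (m.map (MvPolynomial.X : ℕ → MvPolynomial ℕ ℤ)).prod =
      MvPolynomial.monomial (Multiset.toFinsupp m) 1 := by
  induction m using Multiset.induction with
  | empty => simp
  | cons a m ih =>
    rw [Multiset.map_cons, Multiset.prod_cons, ih, ← Multiset.singleton_add,
      Multiset.toFinsupp_add, Multiset.toFinsupp_singleton, MvPolynomial.X,
      MvPolynomial.monomial_mul, one_mul]

theorem card_support_sum_monomial {ι : Type*} [Fintype ι] {f : ι → ℕ →₀ ℕ}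
    (hf : Function.Injective f) :
    (∑ s, (MvPolynomial.monomial (f s) 1 : MvPolynomial ℕ ℤ)).support.card = Fintype.card ι := by
  classical
  rw [← Finset.card_univ, ← Finset.card_image_of_injective Finset.univ hf]
  congr 1
  ext e
  rw [MvPolynomial.mem_support_iff, MvPolynomial.coeff_sum]
  simp only [MvPolynomial.coeff_monomial, Finset.mem_image, Finset.mem_univ, true_and]
  constructor
  · intro h
    by_contra hc
    exact h (Finset.sum_eq_zero fun s _ => if_neg fun he => hc ⟨s, he⟩)
  · rintro ⟨s, rfl⟩
    simp only [hf.eq_iff, Finset.sum_ite_eq', Finset.mem_univ, if_true]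
    exact one_ne_zero

/-- The monomials are the multisets of size `k` in the interval of variables. -/
theorem card_support_completeHom (k a b : ℕ) :
    (completeHom k a b).support.card = Nat.multichoose (b + 1 - a) k := by
  have h : completeHom k a b = ∑ s : Sym (Finset.Icc a b) k,
      MvPolynomial.monomial (Multiset.toFinsupp (s.1.map Subtype.val)) 1 := by
    rw [completeHom, MvPolynomial.hsymm, map_sum]
    refine Finset.sum_congr rfl fun s _ => ?_
    rw [← prod_map_X_eq, map_multiset_prod, Multiset.map_map, Multiset.map_map]
    simp only [Function.comp_def, MvPolynomial.rename_X]
  rw [h, card_support_sum_monomial, Sym.card_sym_eq_multichoose, Fintype.card_coe, Nat.card_Icc]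
  intro s s' he
  exact Subtype.ext (Multiset.map_injective Subtype.val_injective (Multiset.toFinsupp.injective he))

theorem multichoose_le_multichoose {a b : ℕ} (h : a ≤ b) (k : ℕ) :
    Nat.multichoose a k ≤ Nat.multichoose b k := by
  induction b, h using Nat.le_induction with
  | base => exact le_rfl
  | succ b _ ih =>
    refine ih.trans ?_
    cases k with
    | zero => simp
    | succ k => rw [Nat.multichoose_succ_succ]; omega

theorem multichoose_pos {a : ℕ} (h : 1 ≤ a) (k : ℕ) : 0 < Nat.multichoose a k := by
  have := multichoose_le_multichoose h k
  rw [Nat.multichoose_one] at this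
  omega

theorem multichoose_lt_multichoose {a b k : ℕ} (h : a < b) (hk : 1 ≤ k) :
    Nat.multichoose a k < Nat.multichoose b k := by
  refine lt_of_lt_of_le ?_ (multichoose_le_multichoose (Nat.succ_le_of_lt h) k)
  obtain ⟨k, rfl⟩ : ∃ m, k = m + 1 := ⟨k - 1, by omega⟩
  rw [Nat.multichoose_succ_succ]
  have := multichoose_pos (show 1 ≤ a + 1 by omega) k
  omega

theorem card_support_gvEntry_le {β β' : ℕ → ℕ} {i j : ℕ} (h : β j ≤ β' j) :
    (gvEntry lam β i j).support.card ≤ (gvEntry lam β' i j).support.card := by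
  rw [gvEntry, gvEntry]
  split_ifs
  · rw [card_support_completeHom, card_support_completeHom]
    exact multichoose_le_multichoose (by omega) _
  · exact le_rfl

/-- No entry loses monomials when the bound grows, and one entry in the column of a changed bound
gains some. -/
theorem gvCost_lt {β β' : ℕ → ℕ} (hβ : β ∈ Upper n) (hβ' : β' ∈ Upper n)
    (hle : ∀ i, 1 ≤ i → i ≤ n → β i ≤ β' i) (hne : β ≠ β') : gvCost n lam β < gvCost n lam β' := by
  obtain ⟨j, hj1, hj2, hlt⟩ : ∃ j, 1 ≤ j ∧ j ≤ n ∧ β j < β' j := by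
    by_contra hc
    refine hne (Tuples.ext hβ.1 hβ'.1 fun i h1 h2 => le_antisymm (hle i h1 h2) ?_)
    by_contra hc'
    exact hc ⟨i, h1, h2, not_le.1 hc'⟩
  have hup := hβ.2 j hj1 hj2
  have htop := (hβ'.1.1 j hj1 hj2).2
  have hterm : ∀ i ∈ Finset.Icc 1 n, ∀ j ∈ Finset.Icc 1 n,
      (gvEntry lam β i j).support.card ≤ (gvEntry lam β' i j).support.card := by
    intro i _ j hj
    rw [Finset.mem_Icc] at hj
    exact card_support_gvEntry_le (hle j hj.1 hj.2)
  obtain ⟨i, hi, hlt'⟩ : ∃ i ∈ Finset.Icc 1 n,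
      (gvEntry lam β i j).support.card < (gvEntry lam β' i j).support.card := by
    rcases Nat.eq_zero_or_pos (row lam j) with h0 | hpos
    -- For `λ_j = 0` the diagonal entry is constant, but the one below it has degree one; `j + 1 ≤
    -- n` because `j ≤ β j < β' j ≤ n`.
    · refine ⟨j + 1, Finset.mem_Icc.2 (by omega), ?_⟩
      rw [gvEntry, gvEntry, if_pos (by omega), if_pos (by omega), card_support_completeHom,
        card_support_completeHom]
      exact multichoose_lt_multichoose (by omega) (by omega)
    · refine ⟨j, Finset.mem_Icc.2 (by omega), ?_⟩
      rw [gvEntry, gvEntry, if_pos (by omega), if_pos (by omega), card_support_completeHom,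
        card_support_completeHom]
      exact multichoose_lt_multichoose (by omega) (by omega)
  exact Finset.sum_lt_sum (fun i hi => Finset.sum_le_sum (hterm i hi))
    ⟨i, hi, Finset.sum_lt_sum (hterm i hi) ⟨j, Finset.mem_Icc.2 ⟨hj1, hj2⟩, hlt'⟩⟩

/-! ### Disjoint lattice paths -/

theorem IsLatticePath.exists_positions {P Q : ℕ × ℕ} {L : List (ℕ × ℕ)}
    (h : IsLatticePath P Q L) : ∃ (p : ℕ → ℕ × ℕ) (d : ℕ), p 0 = P ∧ p d = Q ∧
      (∀ t, t ≤ d → p t ∈ L) ∧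
      (∀ t, t < d → p (t + 1) = ((p t).1 + 1, (p t).2) ∨ p (t + 1) = ((p t).1, (p t).2 + 1)) := by
  obtain ⟨h1, h2, h3⟩ := h
  have hL : L ≠ [] := by rintro rfl; simp at h1
  have hlen := List.length_pos_iff.2 hL
  have hp : ∀ t (ht : t < L.length), L.getD t P = L[t] := fun t ht => by
    simp [List.getD_eq_getElem?_getD, ht]
  refine ⟨fun t => L.getD t P, L.length - 1, ?_, ?_, fun t ht => ?_, fun t ht => ?_⟩
  · simp only [hp 0 hlen]
    rw [List.head?_eq_getElem?, List.getElem?_eq_getElem hlen] at h1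
    exact Option.some.inj h1
  · simp only [hp (L.length - 1) (by omega)]
    rw [List.getLast?_eq_getElem?, List.getElem?_eq_getElem (by omega)] at h2
    exact Option.some.inj h2
  · simp only [hp t (by omega)]
    exact List.getElem_mem _
  · simp only [hp t (by omega), hp (t + 1) (by omega)]
    exact h3.getElem t (by omega)

theorem positions_sum {p : ℕ → ℕ × ℕ} {d : ℕ}
    (hp : ∀ t, t < d → p (t + 1) = ((p t).1 + 1, (p t).2) ∨ p (t + 1) = ((p t).1, (p t).2 + 1))
    {t : ℕ} (ht : t ≤ d) : (p t).1 + (p t).2 = (p 0).1 + (p 0).2 + t := by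
  induction t with
  | zero => rfl
  | succ t ih =>
    have := ih (by omega)
    rcases hp t (by omega) with h | h <;> rw [h] <;> simp only <;> omega

theorem positions_mono {p : ℕ → ℕ × ℕ} {d : ℕ}
    (hp : ∀ t, t < d → p (t + 1) = ((p t).1 + 1, (p t).2) ∨ p (t + 1) = ((p t).1, (p t).2 + 1))
    {t t' : ℕ} (htt : t ≤ t') (ht : t' ≤ d) : (p t).1 ≤ (p t').1 ∧ (p t).2 ≤ (p t').2 := by
  induction t', htt using Nat.le_induction with
  | base => exact ⟨le_rfl, le_rfl⟩
  | succ t' _ ih =>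
    have := ih (by omega)
    rcases hp t' (by omega) with h | h <;> rw [h] <;> simp only <;> omega

/-- Disjoint paths from the same antidiagonal keep their order. -/
theorem positions_lt {p p' : ℕ → ℕ × ℕ} {d d' : ℕ}
    (hp : ∀ t, t < d → p (t + 1) = ((p t).1 + 1, (p t).2) ∨ p (t + 1) = ((p t).1, (p t).2 + 1))
    (hp' : ∀ t, t < d' →
      p' (t + 1) = ((p' t).1 + 1, (p' t).2) ∨ p' (t + 1) = ((p' t).1, (p' t).2 + 1))
    (h0 : (p 0).1 + (p 0).2 = (p' 0).1 + (p' 0).2) (hlt : (p 0).2 < (p' 0).2)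
    (hne : ∀ t, t ≤ d → t ≤ d' → p t ≠ p' t) {t : ℕ} (ht : t ≤ d) (ht' : t ≤ d') :
    (p t).2 < (p' t).2 := by
  induction t with
  | zero => exact hlt
  | succ t ih =>
    have h1 := ih (by omega) (by omega)
    have h2 := positions_sum hp ht
    have h3 := positions_sum hp' ht'
    have h4 : (p (t + 1)).2 ≤ (p' (t + 1)).2 := by
      rcases hp t (by omega) with h | h <;> rcases hp' t (by omega) with h' | h' <;>
        rw [h, h'] <;> simp only <;> omega
    refine lt_of_le_of_ne h4 fun he => hne _ ht ht' (Prod.ext ?_ he)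
    omega

/-! ### Nonpermutability and efficiency -/

theorem row_anti {j l : ℕ} (h : j ≤ l) : row lam l ≤ row lam j :=
  lam.rowLen_anti _ _ (by omega)

/-- Row lengths drop after row `j` only if `j` is a column length, hence the end of a carrel. -/
theorem row_succ_eq (E : CarrelEnum n r q) (S : HasColumns n r q lam) {h j : ℕ} (h1 : 1 ≤ h)
    (h2 : h ≤ r + 1) (hj : q (h - 1) < j) (hj' : j < q h) : row lam (j + 1) = row lam j := by
  refine le_antisymm (row_anti (Nat.le_succ j)) ?_
  by_contra hc
  rw [not_le] at hc
  have h3 : (j - 1, row lam (j + 1)) ∈ lam := YoungDiagram.mem_iff_lt_rowLen.2 hc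
  have h4 : (j, row lam (j + 1)) ∉ lam := fun hm => by
    rw [YoungDiagram.mem_iff_lt_rowLen] at hm
    rw [row, Nat.add_sub_cancel] at hm
    exact lt_irrefl _ hm
  rw [mem_lam_succ] at h3 h4
  obtain ⟨g, hg1, hg2, hc'⟩ := S.exists_eq (j := row lam (j + 1) + 1) (i := j) (by omega) (by omega)
    (by omega)
  have hjg : j = q g := by omega
  rw [hjg] at hj hj'
  have h5 := E.lt_of_lt (by omega) hj
  have h6 := E.lt_of_lt hg2 hj'
  omega

theorem row_eq_of_carrel (E : CarrelEnum n r q) (S : HasColumns n r q lam) {h j l : ℕ}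
    (h1 : 1 ≤ h) (h2 : h ≤ r + 1) (hj : q (h - 1) < j) (hjl : j ≤ l) (hl : l ≤ q h) :
    row lam l = row lam j := by
  induction l, hjl using Nat.le_induction with
  | base => rfl
  | succ l hjl ih => rw [row_succ_eq E S h1 h2 (by omega) (by omega), ih (by omega)]

/-- A gapless tuple that decreases from `l` to `k` takes, in the carrel of `k`, all the values from
`γ k` to `γ l`. -/
theorem gapless_run (E : CarrelEnum n r q) {γ : ℕ → ℕ} (hγ : γ ∈ Gapless n r q) {l k : ℕ}
    (hl : 1 ≤ l) (hlk : l < k) (hk : k ≤ n) (hlt : γ k < γ l) :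
    ∃ h, 1 ≤ h ∧ h ≤ r + 1 ∧ q (h - 1) < k ∧
      ∀ s, γ k + s ≤ γ l → k + s ≤ q h ∧ γ (k + s) = γ k + s := by
  obtain ⟨h, X, h1, h2, h3, hkX, hX, hXc, -, hXe⟩ := gapless_exists_next E hγ.1 (i := k) (by omega) hk
  obtain ⟨g, Y, g1, g2, g3, hlY, hY, hYc, -, hYe⟩ := gapless_exists_next E hγ.1 hl (by omega)
  have hYX : Y ≤ X := by
    by_contra hc
    have := rIncreasing_add_le hγ.1.2 g1 g2 g3 hlk.le (by omega)
    omega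
  have hYX' := gapless_critical_mono E hγ hYc hXc hYX
  refine ⟨h, h1, h2, h3, fun s hs => ⟨by omega, ?_⟩⟩
  have e1 := rIncreasing_add_le hγ.1.2 h1 h2 h3 (show k ≤ k + s by omega) (by omega)
  have e2 := rIncreasing_add_le hγ.1.2 h1 h2 (show q (h - 1) < k + s by omega)
    (show k + s ≤ X by omega) hX
  omega

/-- Suppose `i < i'` and `w i > w i'`. Where the lower path ends, the upper one is on the same
antidiagonal at a height between `γ (w i)` and `γ (w i')`. Row lengths are constant on carrels, so
terminals with consecutive heights in one carrel lie on an antidiagonal; the run of `γ` after `w i`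
puts one exactly at that point. So a third path meets the upper one. -/
theorem nonpermutable_of_gapless (E : CarrelEnum n r q) (S : HasColumns n r q lam) {γ : ℕ → ℕ}
    (hγ : γ ∈ Gapless n r q) : Nonpermutable n lam γ := by
  rintro w hw ⟨L, hL, hdis⟩
  have hwr : ∀ i, 1 ≤ i → i ≤ n → 1 ≤ w i ∧ w i ≤ n := fun i h1 h2 => hw.mapsTo ⟨h1, h2⟩
  have hdis' : ∀ i j, 1 ≤ i → i ≤ n → 1 ≤ j → j ≤ n → i ≠ j → ∀ x, x ∈ L i → x ∉ L j := by
    intro i j hi hi' hj hj' hij x hx hx'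
    rcases Nat.lt_or_gt_of_ne hij with h | h
    · exact hdis i j hi h hj' hx hx'
    · exact hdis j i hj h hi' hx' hx
  have hmono : ∀ i i', 1 ≤ i → i < i' → i' ≤ n → w i < w i' := by
    intro i i' hi hii hi'
    by_contra hinv
    have hne : w i ≠ w i' := fun he => hii.ne (hw.injOn ⟨hi, by omega⟩ ⟨by omega, hi'⟩ he)
    obtain ⟨hk1, hk2⟩ := hwr i hi (by omega)
    obtain ⟨hl1, hl2⟩ := hwr i' (by omega) hi'
    obtain ⟨p, d, hp0, hpd, hpL, hp⟩ := (hL i hi (by omega)).exists_positions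
    obtain ⟨p', d', hp0', hpd', hpL', hp'⟩ := (hL i' (by omega) hi').exists_positions
    have hlt := fun t ht ht' => positions_lt (t := t) hp hp'
      (by rw [hp0, hp0', source, source]; simp only; omega)
      (by rw [hp0, hp0', source, source]; exact hii)
      (fun t ht ht' he => hdis' i i' hi (by omega) (by omega) hi' hii.ne _ (hpL t ht)
        (he ▸ hpL' t ht')) ht ht'
    have hs := positions_sum hp le_rfl
    have hs' := positions_sum hp' le_rfl
    have hrow := row_anti (lam := lam) (show w i' ≤ w i by omega)
    -- If the upper path ended first, the lower path would then be further east than its own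
    -- terminal, because `λ` decreases weakly.
    have hdd : d ≤ d' := by
      by_contra hc
      have h1 := hlt d' (by omega) le_rfl
      have h2 := positions_mono hp (show d' ≤ d by omega) le_rfl
      have h3 := positions_sum hp (show d' ≤ d by omega)
      simp only [hp0, hp0', hpd, hpd', source, terminal] at *
      omega
    have h1 := hlt d le_rfl hdd
    have h2 := positions_mono hp' hdd le_rfl
    have h3 := positions_sum hp' hdd
    have hy1 : γ (w i) < (p' d).2 := by rw [hpd] at h1; exact h1
    have hy2 : (p' d).2 ≤ γ (w i') := by have := h2.2; rw [hpd'] at this; exact this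
    obtain ⟨h, hh1, hh2, hh3, hrun⟩ := gapless_run E hγ hl1 (show w i' < w i by omega) hk2 (by omega)
    obtain ⟨hm1, hm2⟩ := hrun ((p' d).2 - γ (w i)) (by omega)
    -- The index of the terminal at the point `p' d`.
    set m := w i + ((p' d).2 - γ (w i)) with hm
    have hmn : m ≤ n := hm1.trans (E.le_top hh2)
    obtain ⟨i₂, hi₂, hwi₂⟩ := hw.surjOn (show m ∈ Set.Icc 1 n from ⟨by omega, hmn⟩)
    obtain ⟨p₂, d₂, hp0₂, hpd₂, hpL₂, hp₂⟩ := (hL i₂ hi₂.1 hi₂.2).exists_positions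
    have hs₂ := positions_sum hp₂ le_rfl
    have hrow₂ := row_eq_of_carrel E S hh1 hh2 hh3 (show w i ≤ m by omega) hm1
    have hii₂ : i' ≠ i₂ := by rintro rfl; omega
    have hi₂n := hi₂.2
    rw [hwi₂] at hpd₂
    refine hdis' i' i₂ (by omega) hi' hi₂.1 hi₂.2 hii₂ (p' d) (hpL' d hdd) ?_
    rw [hpd₂, hp0₂] at hs₂
    rw [hpd, hp0] at hs
    rw [hp0'] at h3
    simp only [source, terminal] at hs hs₂ h3
    have he : p' d = p₂ d₂ := by
      rw [hpd₂]
      refine Prod.ext ?_ ?_ <;> simp only [terminal] <;> omega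
    rw [he]
    exact hpL₂ d₂ le_rfl
  intro i h1 h2
  have hcard : (Finset.Icc 1 n).card = n := by rw [Nat.card_Icc, Nat.add_sub_cancel]
  rw [eq_srt_of_strict (B := Finset.Icc 1 n) (f := w)
    (fun i j hi hij hj => hmono i j hi hij (hcard ▸ hj))
    (fun i hi hi' => Finset.mem_Icc.2 (hwr i hi (hcard ▸ hi'))) h1 (by rwa [hcard]),
    srt_Icc_one h1 h2]

/-- The bounds with the polynomial of a given flag all share its core. That core is gapless,
nonpermutable and the least of them, thus strictly the cheapest. -/
theorem efficientInputs_eq (E : CarrelEnum n r q) (S : HasColumns n r q lam) :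
    EfficientInputs n lam = Gapless n r q := by
  have hsum : ∀ β ∈ Upper n, ∀ φ ∈ UpperFlags n, rowBoundSum n lam β = rowBoundSum n lam φ ↔
      core n r q β = core n r q φ := fun β hβ φ hφ => by
    rw [← rowBound_eq_iff E S hβ hφ.1]
    exact ⟨rowBound_eq_of_sum_eq E S hφ, fun h => congrArg (genFun n) h⟩
  have hcost : ∀ β ∈ Upper n, core n r q β ∈ Gapless n r q → β ≠ core n r q β →
      gvCost n lam (core n r q β) < gvCost n lam β := fun β hβ hg hne =>
    gvCost_lt hg.1.1 hβ (core_le_self E hβ) hne.symm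
  ext β
  constructor
  · rintro ⟨hβ, -, ⟨φ, hφ, hs⟩, hmin⟩
    have hc := (hsum β hβ φ hφ).1 hs
    have hg : core n r q β ∈ Gapless n r q := hc ▸ core_upperFlag_mem_gapless E hφ
    by_contra hn
    have hne : β ≠ core n r q β := fun he => hn (he ▸ hg)
    have hs' : rowBoundSum n lam (core n r q β) = rowBoundSum n lam β := by
      rw [hs, hsum _ hg.1.1 φ hφ, core_eq_self E hg.1, hc]
    exact lt_asymm (hmin _ hg.1.1 (nonpermutable_of_gapless E S hg) hs' hne.symm)
      (hcost β hβ hg hne)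
  · intro hβ
    obtain ⟨φ, hφ, hc⟩ := exists_upperFlag_core_eq E hβ
    have hs : rowBoundSum n lam β = rowBoundSum n lam φ :=
      (hsum β hβ.1.1 φ hφ).2 (by rw [hc, core_eq_self E hβ.1])
    refine ⟨hβ.1.1, nonpermutable_of_gapless E S hβ, ⟨φ, hφ, hs⟩, fun β' hβ' _ hs' hne => ?_⟩
    have hc' : core n r q β' = β := by rw [(hsum β' hβ' φ hφ).1 (hs'.trans hs), hc]
    have := hcost β' hβ' (hc'.symm ▸ hβ) (by rwa [hc'])
    rwa [hc'] at this

end gesselViennot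

end ParabolicCatalan

open ParabolicCatalan

namespace ParabolicCatalan

/-! ### Counting -/

theorem hasColumns_of_columnLengths {n r : ℕ} {q : ℕ → ℕ} {lam : YoungDiagram} {R : Finset ℕ}
    (hqn : q (r + 1) = n) (hqR : (Finset.Icc 1 r).image q = R)
    (hlam : lam.colLen 0 ≤ n) (hlamR : columnLengths n lam = (R : Set ℕ)) :
    HasColumns n r q lam := by
  refine ⟨hlam, fun j hj hjr => ?_, fun h h1 h2 => ?_⟩
  · by_cases hn : col lam j = n
    · exact ⟨r + 1, by omega, le_rfl, by rw [hn, hqn]⟩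
    · have hm : col lam j ∈ columnLengths n lam := ⟨hn, j, hj, hjr, rfl⟩
      rw [hlamR, Finset.mem_coe, ← hqR, Finset.mem_image] at hm
      obtain ⟨h, hh, he⟩ := hm
      rw [Finset.mem_Icc] at hh
      exact ⟨h, hh.1, by omega, he.symm⟩
  · have hm : q h ∈ (R : Set ℕ) := by
      rw [Finset.mem_coe, ← hqR]
      exact Finset.mem_image_of_mem _ (Finset.mem_Icc.2 ⟨h1, h2⟩)
    rw [← hlamR] at hm
    obtain ⟨-, j, hj, -, he⟩ := hm
    exact ⟨j, hj, he.symm⟩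

theorem ncard_gapless {n r : ℕ} {q : ℕ → ℕ} (E : CarrelEnum n r q) :
    (Gapless n r q).ncard = parabolicCatalan n r q :=
  (Set.BijOn.ncard_eq (colMaxChain_bijOn E)).trans (Set.BijOn.ncard_eq (chainOf_bijOn_avoid E)).symm

end ParabolicCatalan

/-! ### The combined count -/

theorem mainTheorem5
    (n : ℕ) (hn : 1 ≤ n)
    (R : Finset ℕ) (hR : R ⊆ Finset.Icc 1 (n - 1))
    (r : ℕ) (q : ℕ → ℕ) (hq0 : q 0 = 0) (hqn : q (r + 1) = n)
    (hq : ∀ h, h ≤ r → q h < q (h + 1)) (hqR : (Finset.Icc 1 r).image q = R)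
    (lam : YoungDiagram) (hlam : lam.colLen 0 ≤ n) (hlamR : columnLengths n lam = (R : Set ℕ)) :
    -- (i) ordered partitions and permutations avoiding a pattern
    ((OrderedPartitionsAvoid n r q ![3, 1, 2]).ncard = parabolicCatalan n r q ∧
      ∀ σ ∈ ({![1, 2, 3], ![1, 3, 2], ![2, 1, 3], ![2, 3, 1], ![3, 2, 1]} : Set (Fin 3 → ℕ)),
        (AvoidPattern n r q σ).ncard = parabolicCatalan n r q) ∧
    -- (ii) gapless tuples, canopy tuples, floor flags, ceiling flags
    ((Gapless n r q).ncard = parabolicCatalan n r q ∧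
      (Canopies n r q).ncard = parabolicCatalan n r q ∧
      (Floors n r q).ncard = parabolicCatalan n r q ∧
      (Ceilings n r q).ncard = parabolicCatalan n r q) ∧
    -- (iii) flag critical lists, sequences of shapes
    ((FlagCritLists n r q).ncard = parabolicCatalan n r q ∧
      (ShapeSequences n r q).ncard = parabolicCatalan n r q) ∧
    -- (iv) the four collections of equivalence classes
    ((classesOf (GaplessCore n r q) (below n r q)).ncard = parabolicCatalan n r q ∧
      (classesOf (UpperFlags n) (below n r q)).ncard = parabolicCatalan n r q ∧
      (classesOf (GaplessCore n r q) (RowBound n lam)).ncard = parabolicCatalan n r q ∧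
      (classesOf (UpperFlags n) (RowBound n lam)).ncard = parabolicCatalan n r q) ∧
    -- (v) rightmost clump deleting chains, gapless keys
    ((ClumpDeletingChains n r q).ncard = parabolicCatalan n r q ∧
      (GaplessKeys n r q lam).ncard = parabolicCatalan n r q) ∧
    -- (vi) convex sets of Demazure tableaux
    {D : Set (SemistandardYoungTableau lam) | (∃ π ∈ RPerms n r q, D = Demazure n lam π) ∧
      IsConvexPolytope (toPoint '' D)}.ncard = parabolicCatalan n r q ∧
    -- (vii) distinct tableau sets
    ((Demazure n lam '' Avoid312 n r q).ncard = parabolicCatalan n r q ∧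
      (RowBound n lam '' GaplessCore n r q).ncard = parabolicCatalan n r q ∧
      (RowBound n lam '' UpperFlags n).ncard = parabolicCatalan n r q) ∧
    -- (viii) coincident pairs of tableau sets
    {p : Set (SemistandardYoungTableau lam) × Set (SemistandardYoungTableau lam) |
      (∃ β ∈ Upper n, ∃ π ∈ RPerms n r q, p = (RowBound n lam β, Demazure n lam π)) ∧
        p.1 = p.2}.ncard = parabolicCatalan n r q ∧
    -- (ix) distinct polynomials
    ((demazurePoly n lam '' Avoid312 n r q).ncard = parabolicCatalan n r q ∧
      (rowBoundSum n lam '' GaplessCore n r q).ncard = parabolicCatalan n r q ∧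
      (rowBoundSum n lam '' UpperFlags n).ncard = parabolicCatalan n r q) ∧
    -- (x) coincident pairs of polynomials
    {p : MvPolynomial ℕ ℤ × MvPolynomial ℕ ℤ |
      (∃ β ∈ Upper n, ∃ π ∈ RPerms n r q, p = (rowBoundSum n lam β, demazurePoly n lam π)) ∧
        p.1 = p.2}.ncard = parabolicCatalan n r q ∧
    -- (xi) maximally efficient valid inputs to Gessel-Viennot determinants
    (EfficientInputs n lam).ncard = parabolicCatalan n r q := by
  have E : CarrelEnum n r q := ⟨hq0, hqn, hq⟩
  have S : HasColumns n r q lam := hasColumns_of_columnLengths hqn hqR hlam hlamR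
  have hG := ncard_gapless E
  have hGC : GaplessCore n r q ⊆ Upper n := fun β hβ => hβ.1
  have hUF : UpperFlags n ⊆ Upper n := fun β hβ => hβ.1
  have hbelow : ∀ {U : Set (ℕ → ℕ)}, U ⊆ Upper n → core n r q '' U = Gapless n r q →
      (classesOf U (below n r q)).ncard = parabolicCatalan n r q := fun hU hc => by
    rw [ncard_classesOf, ncard_image_eq_of_fibres (g := core n r q)
      fun β hβ β' hβ' => below_eq_iff E (hU hβ) (hU hβ'), hc, hG]
  have hDem : (Demazure n lam '' Avoid312 n r q).ncard = parabolicCatalan n r q :=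
    ((demazure_injOn E S).mono fun π hπ => hπ.1).ncard_image
  have hpoly : (demazurePoly n lam '' Avoid312 n r q).ncard = parabolicCatalan n r q :=
    ((demazurePoly_injOn E S).mono fun π hπ => hπ.1).ncard_image
  have hRB : ∀ {U : Set (ℕ → ℕ)}, U ⊆ Upper n → core n r q '' U = Gapless n r q →
      (RowBound n lam '' U).ncard = parabolicCatalan n r q := fun hU hc => by
    rw [rowBound_image_eq E S hU hc, hDem]
  have hRP : ∀ {U : Set (ℕ → ℕ)}, U ⊆ Upper n → core n r q '' U = Gapless n r q →
      (rowBoundSum n lam '' U).ncard = parabolicCatalan n r q := fun {U} hU hc => by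
    -- Both families of polynomials are images of tableau sets under `genFun`, so equality of the
    -- families of sets carries over.
    have h1 : rowBoundSum n lam '' U = genFun n '' (RowBound n lam '' U) := by
      rw [Set.image_image]; rfl
    have h2 : demazurePoly n lam '' Avoid312 n r q =
        genFun n '' (Demazure n lam '' Avoid312 n r q) := by
      rw [Set.image_image]; rfl
    rw [h1, rowBound_image_eq E S hU hc, ← h2, hpoly]
  have hcanopies := (canopies_bijOn E).ncard_eq
  refine ⟨ncard_avoidPattern_eq E, ⟨hG, hcanopies.trans hG, (floors_bijOn E).ncard_eq.trans hG,
    (ceilings_bijOn E).ncard_eq.trans hG⟩,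
    ⟨((critList_bijOn E).ncard_eq.symm.trans hcanopies).trans hG,
      (tupleOfShapes_bijOn E).ncard_eq.trans hG⟩,
    ⟨hbelow hGC (core_image_gaplessCore E), hbelow hUF (core_image_upperFlags E), ?_, ?_⟩,
    ⟨?_, (keyTab_bijOn E S).ncard_eq.symm⟩, ?_,
    ⟨hDem, hRB hGC (core_image_gaplessCore E), hRB hUF (core_image_upperFlags E)⟩, ?_,
    ⟨hpoly, hRP hGC (core_image_gaplessCore E), hRP hUF (core_image_upperFlags E)⟩, ?_, ?_⟩
  · rw [ncard_classesOf, hRB hGC (core_image_gaplessCore E)]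
  · rw [ncard_classesOf, hRB hUF (core_image_upperFlags E)]
  · rw [clumpDeletingChains_eq E]
    exact (chainOf_bijOn_avoid E).ncard_eq.symm
  · rw [← hDem]
    congr 1
    ext D
    constructor
    · rintro ⟨⟨π, hπ, rfl⟩, hc⟩
      exact ⟨π, (isConvexPolytope_demazure_iff E S hπ).1 hc, rfl⟩
    · rintro ⟨π, hπ, rfl⟩
      exact ⟨⟨π, hπ.1, rfl⟩, (isConvexPolytope_demazure_iff E S hπ.1).2 hπ⟩
  -- Coincident pairs are diagonal; by convexity their common component comes from an avoiding
  -- permutation.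
  · rw [← hDem, ← Set.ncard_image_of_injective (Demazure n lam '' Avoid312 n r q)
      (f := fun D => (D, D)) fun D D' h => congrArg Prod.fst h]
    congr 1
    ext p
    constructor
    · rintro ⟨⟨β, hβ, π, hπ, rfl⟩, he⟩
      exact ⟨_, ⟨π, mem_avoid312_of_rowBound_eq E S hβ hπ he, rfl⟩, Prod.ext he.symm rfl⟩
    · rintro ⟨_, ⟨π, hπ, rfl⟩, rfl⟩
      obtain ⟨γ, hγ, he⟩ := exists_gapless_rowBound_eq E S hπ
      exact ⟨⟨γ, hγ.1.1, π, hπ.1, by rw [he]⟩, rfl⟩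
  · rw [← hpoly, ← Set.ncard_image_of_injective (demazurePoly n lam '' Avoid312 n r q)
      (f := fun D => (D, D)) fun D D' h => congrArg Prod.fst h]
    congr 1
    ext p
    constructor
    · rintro ⟨⟨β, hβ, π, hπ, rfl⟩, he⟩
      exact ⟨_, ⟨π, mem_avoid312_of_rowBound_eq E S hβ hπ
        (rowBound_eq_demazure_of_poly_eq E S hπ he), rfl⟩, Prod.ext he.symm rfl⟩
    · rintro ⟨_, ⟨π, hπ, rfl⟩, rfl⟩
      obtain ⟨γ, hγ, he⟩ := exists_gapless_rowBound_eq E S hπ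
      exact ⟨⟨γ, hγ.1.1, π, hπ.1, by rw [rowBoundSum, he, demazurePoly]⟩, rfl⟩
  · rw [efficientInputs_eq E S, hG]
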